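/- Let $X\subset\mathbb P^N=\mathbb P(V)$ be an irreducible projective surface over $\mathbb C$. For a smooth point $x\in X$ let $\mathbb T_xX$ be the embedded tangent plane, $\hat{\mathbb T}_xX\subset V$ the cone over it, $N_xX=V/\hat{\mathbb T}_xX$, and let $\mathbb T^{(2)}_xX$ be the embedded osculating space, spanned by the partial derivatives of order $\le 2$ at the origin of a local parametrization of $X$ at $x$ by formal power series. Let $II_x:T_xX\times T_xX\to N_xX$ be the projective second fundamental form (the symmetric bilinear map induced by the differential of the Gauss map), and let $|II_x|$ be the linear system of quadrics in $\mathbb P(T_xX)\cong\mathbb P^1$ given by the quadratic forms $v\mapsto \ell(II_x(v,v))$, $\ell\in (N_xX)^\vee$ (dimension $-1$ if it is empty). Two directions $[v],[w]\in\mathbb P(T_xX)$ are conjugate if $II_x(v,w)=0$, and $[v]$ is asymptotic if it is conjugate to itself. Call $X$ a ruled developable surface if through a general point of $X$ there passes a line contained in $X$ along which the tangent plane (at smooth points of $X$) is constant. Then $\dim|II_x|$ has the same value $d\in\{-1,0,1,2\}$ at all general points $x$ of $X$ (i.e. for all $x$ in some non-empty Zariski open subset, contained in the smooth locus). For such $x$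 one has $\dim|II_x|=\dim\mathbb T^{(2)}_xX-3$ and the following holds. 1. $\dim |II_x|=-1$ if and only if $|II_x|=\emptyset$, if and only if $\mathbb T^{(2)}_xX=\mathbb T_xX$, if and only if $X$ is a plane. 2. $\dim|II_x|=0$ if and only if $|II_x|$ consists of a unique quadric, if and only if $\dim\mathbb T^{(2)}_xX=3$. In this case every tangent direction at $x$ has a conjugate direction, and either $X$ is contained in a linear subspace $\mathbb P^3$ of $\mathbb P^N$, or $X$ is a ruled developable surface. 3. $\dim|II_x|=1$ if and only if $\dim\mathbb T^{(2)}_xX=4$. When moreover $N\ge5$, these are exactly the $\Phi$ surfaces, i.e. the surfaces in $\mathbb P^N$, $N\ge 5$, whose osculating space at a general point has dimension $4$. If $\dim|II_x|=1$, one of the following holds: (a) there is exactly one unordered pair $\{p,q\}$ of conjugate directions at $x$, and $p\ne q$. There is then an involution $\sigma$ of $\mathbb P(T_xX)$ (a projectivity of order two) whose pairs $\{r,\sigma(r)\}$ are exactly the pairs of tangents at $x$ (the two points, possibly equal, of the projectivized tangent cone) of the hyperplane sections of $X$ having a double point at $x$, and the fixed points of $\sigma$ are exactly $p$ and $q$;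 or (b) there is exactly one asymptotic direction $p$ at $x$ and no other pair of conjugate directions. The involution degenerates: the pairs of tangents at $x$ of the hyperplane sections having a double point at $x$ are exactly the pairs $\{p,s\}$, $s\in\mathbb P(T_xX)$. In both cases, a direction $r$ has a conjugate direction if and only if the pair $\{r,r\}$ occurs, i.e. some hyperplane section of $X$ has a double point at $x$ whose tangent cone is the line $r$ counted twice (a cuspidal tangent hyperplane section). 4. $\dim|II_x|=2$ if and only if $\mathbb T^{(2)}_xX$ has the expected dimension $5$. In this case there are no conjugate directions at $x$. -/

import Mathlib

open scoped LinearAlgebra.Projectivization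

noncomputable section

namespace ProjSurface

/-- The affine space `V = ℂ^(N+1)` whose lines are the points of `ℙ^N`. -/
abbrev Vec (N : ℕ) : Type := Fin (N + 1) → ℂ

/-- Complex projective space `ℙ^N`. -/
abbrev PSpace (N : ℕ) : Type := ℙ ℂ (Vec N)

/-- Points of the projective line `ℙ(T_x X)`, where `T_x X` is identified with `ℂ²` through the
differential of a local parametrization of `X` at `x`. -/
abbrev Direction : Type := ℙ ℂ (Fin 2 → ℂ)

variable {N : ℕ}

/-! ### Projective surfaces, general points -/

/-- `Z` is the common zero locus of a set of homogeneous polynomials. -/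
def IsZariskiClosed (Z : Set (PSpace N)) : Prop :=
  ∃ S : Set (MvPolynomial (Fin (N + 1)) ℂ),
    (∀ f ∈ S, ∃ d : ℕ, f.IsHomogeneous d) ∧
      ∀ x : PSpace N, x ∈ Z ↔ ∀ f ∈ S, MvPolynomial.eval x.rep f = 0

/-- The affine cone over `X`, without its vertex. -/
def cone (X : Set (PSpace N)) : Set (Vec N) :=
  {v | ∃ hv : v ≠ 0, Projectivization.mk ℂ v hv ∈ X}

/-- The (homogeneous) ideal of `X`: the polynomials vanishing on the cone over `X`. -/
def idealOf (X : Set (PSpace N)) : Ideal (MvPolynomial (Fin (N + 1)) ℂ) :=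
  MvPolynomial.vanishingIdeal ℂ (cone X)

/-- `X` is an irreducible projective surface: it is closed, its ideal is prime, and its
homogeneous coordinate ring has dimension `2 + 1`. -/
structure IsProjectiveSurface (X : Set (PSpace N)) : Prop where
  closed : IsZariskiClosed X
  prime : (idealOf X).IsPrime
  dim : ringKrullDim (MvPolynomial (Fin (N + 1)) ℂ ⧸ idealOf X) = 3

/-- `P` holds at a general point of `X`: at all points of `X` outside a closed set which does not
contain `X`. -/
def ForGeneralPoint (X : Set (PSpace N)) (P : PSpace N → Prop) : Prop :=
  ∃ Z : Set (PSpace N), IsZariskiClosed Z ∧ ¬ X ⊆ Z ∧ ∀ x ∈ X, x ∉ Z → P x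

/-- The cone in `V` over the embedded tangent space `𝕋_x X`: the common kernel of the differentials
at `x` of the equations of `X`. -/
def tangentSpace (X : Set (PSpace N)) (x : PSpace N) : Submodule ℂ (Vec N) :=
  ⨅ f ∈ idealOf X,
    LinearMap.ker (∑ k, MvPolynomial.eval x.rep (MvPolynomial.pderiv k f) •
      (LinearMap.proj k : Vec N →ₗ[ℂ] ℂ))

/-- Smooth points of a surface: the embedded tangent space is a plane. -/
def IsSmoothPoint (X : Set (PSpace N)) (x : PSpace N) : Prop :=
  x ∈ X ∧ Module.finrank ℂ (tangentSpace X x) = 3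

/-- The set of points of the linear subspace `ℙ(W)` of `ℙ(V)`. -/
def linearSubspace (W : Submodule ℂ (Vec N)) : Set (PSpace N) :=
  {x | x.submodule ≤ W}

/-- `X` is a plane. -/
def IsPlane (X : Set (PSpace N)) : Prop :=
  ∃ W : Submodule ℂ (Vec N), Module.finrank ℂ W = 3 ∧ X = linearSubspace W

/-- `X` is contained in a linear subspace of dimension `3`. -/
def LiesInThreeSpace (X : Set (PSpace N)) : Prop :=
  ∃ W : Submodule ℂ (Vec N), Module.finrank ℂ W = 4 ∧ X ⊆ linearSubspace W

/-- `X` is a ruled developable surface: through a general point of `X` there passes a line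
contained in `X` along which the tangent plane to `X` is constant. -/
def IsRuledDevelopable (X : Set (PSpace N)) : Prop :=
  ForGeneralPoint X fun x => IsSmoothPoint X x ∧
    ∃ L : Submodule ℂ (Vec N), Module.finrank ℂ L = 2 ∧ x ∈ linearSubspace L ∧
      linearSubspace L ⊆ X ∧
        ∀ y ∈ linearSubspace L, IsSmoothPoint X y → tangentSpace X y = tangentSpace X x

/-- Multiplying a point of the cone by a nonzero scalar gives a point of the cone. -/
theorem smul_mem_cone {X : Set (PSpace N)} {c : ℂ} (hc : c ≠ 0) {v : Vec N} (hv : v ∈ cone X) :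
    c • v ∈ cone X := by
  obtain ⟨h, hX⟩ := hv
  refine ⟨smul_ne_zero hc h, ?_⟩
  have : Projectivization.mk ℂ (c • v) (smul_ne_zero hc h) = Projectivization.mk ℂ v h :=
    (Projectivization.mk_eq_mk_iff' ℂ _ _ _ _).2 ⟨c, rfl⟩
  rwa [this]

/-- The chain rule for a polynomial substituted by power series or polynomials. -/
theorem derivation_aeval {A : Type*} [CommRing A] [Algebra ℂ A] (D : Derivation ℂ A A)
    (F : Fin (N + 1) → A) (f : MvPolynomial (Fin (N + 1)) ℂ) :
    D (MvPolynomial.aeval F f) =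
      ∑ k, MvPolynomial.aeval F (MvPolynomial.pderiv k f) * D (F k) := by
  induction f using MvPolynomial.induction_on with
  | C a => simp
  | add p q hp hq => simp [hp, hq, add_mul, Finset.sum_add_distrib]
  | mul_X p i hp =>
    simp only [map_mul, MvPolynomial.aeval_X, Derivation.leibniz, hp, smul_eq_mul, map_add,
      MvPolynomial.pderiv_X, add_mul, Finset.sum_add_distrib]
    congr 1
    · rw [Finset.sum_eq_single i] <;> simp +contextual [eq_comm]
    · rw [Finset.mul_sum]
      exact Finset.sum_congr rfl fun k _ => by ring

/-! ### Local parametrizations -/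

/-- The value at the origin of a vector of formal power series. -/
def valueAt (F : Fin (N + 1) → MvPowerSeries (Fin 2) ℂ) : Vec N :=
  fun k => MvPowerSeries.constantCoeff (F k)

/-- The partial derivative `∂F/∂t_i` of a vector of formal power series. -/
def partialDeriv (i : Fin 2) (F : Fin (N + 1) → MvPowerSeries (Fin 2) ℂ) :
    Fin (N + 1) → MvPowerSeries (Fin 2) ℂ :=
  fun k => MvPowerSeries.pderiv ℂ i (F k)

/-- A local parametrization of the surface `X` at `x` by formal power series in `t_0, t_1`, written
in homogeneous coordinates: a vector `Φ` of power series satisfying the equations of `X`, with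
`[Φ(0)] = x`, such that the induced map to `ℙ^N` is an immersion at the origin. -/
structure LocalParam (X : Set (PSpace N)) (x : PSpace N) where
  series : Fin (N + 1) → MvPowerSeries (Fin 2) ℂ
  base : ∃ h : valueAt series ≠ 0, Projectivization.mk ℂ (valueAt series) h = x
  equations : ∀ f ∈ idealOf X, MvPolynomial.aeval series f = 0
  immersion : LinearIndependent ℂ
    ![valueAt series, valueAt (partialDeriv 0 series), valueAt (partialDeriv 1 series)]

namespace LocalParam

variable {X : Set (PSpace N)} {x : PSpace N} (φ : LocalParam X x)

/-- The cone in `V` over the embedded osculating space `𝕋_x^{(2)} X`: the span of all partial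
derivatives of order at most `2` at the origin. -/
def osculatingSpace : Submodule ℂ (Vec N) :=
  Submodule.span ℂ
    ({valueAt φ.series} ∪ Set.range (fun i => valueAt (partialDeriv i φ.series)) ∪
      Set.range (fun p : Fin 2 × Fin 2 => valueAt (partialDeriv p.1 (partialDeriv p.2 φ.series))))

/-- The (projective) dimension of `𝕋_x^{(2)} X`. -/
def dimOsc : ℤ := (Module.finrank ℂ φ.osculatingSpace : ℤ) - 1

/-- The derivative at the origin, in the direction `a`, of the vector `∑ j, b j • ∂Φ/∂t_j` of the
moving tangent space. -/
def secondDeriv : (Fin 2 → ℂ) →ₗ[ℂ] (Fin 2 → ℂ) →ₗ[ℂ] Vec N :=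
  LinearMap.mk₂ ℂ
    (fun a b => ∑ i, ∑ j, (a i * b j) • valueAt (partialDeriv i (partialDeriv j φ.series)))
    (by intro a a' b; simp [add_mul, add_smul, Finset.sum_add_distrib])
    (by intro c a b; simp [smul_smul, mul_assoc])
    (by intro a b b'; simp [mul_add, add_smul, Finset.sum_add_distrib])
    (by intro c a b; simp [smul_smul, mul_left_comm])

/-- The projective second fundamental form `T_x X × T_x X → N_x X = V / 𝕋_x`, i.e. the
differential of the Gauss map `γ`: `II(a, b)` is the class of the derivative in the direction `a` of
a vector moving in the tangent spaces `γ` whose value at `x` represents `b`. The choice of the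
moving vector does not matter, see `derivative_of_moving_tangent`
and `frame_le_tangentSpace`. -/
def II : LinearMap.BilinMap ℂ (Fin 2 → ℂ) (Vec N ⧸ tangentSpace X x) :=
  φ.secondDeriv.compr₂ (tangentSpace X x).mkQ

/-- Each linear form on the normal space, i.e. each equation `ℓ` of a tangent hyperplane, gives the
quadratic form `v ↦ ℓ (II(v, v))` on the tangent space. These forms make up the vector space
underlying the linear system `|II_x|`. -/
def quadrics : Submodule ℂ (QuadraticForm ℂ (Fin 2 → ℂ)) :=
  LinearMap.range
    ({ toFun := fun l => LinearMap.BilinMap.toQuadraticMap (φ.II.compr₂ l)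
       map_add' := fun _ _ => by ext; simp
       map_smul' := fun _ _ => by ext; simp } :
      Module.Dual ℂ (Vec N ⧸ tangentSpace X x) →ₗ[ℂ] QuadraticForm ℂ (Fin 2 → ℂ))

/-- The linear system of quadrics `|II_x|` in `ℙ(T_x X)`, as a set of points of the projective
space of quadratic forms. -/
def linearSystem : Set (ℙ ℂ (QuadraticForm ℂ (Fin 2 → ℂ))) :=
  {Q | Q.submodule ≤ φ.quadrics}

/-- The projective dimension of `|II_x|` (`-1` if it is empty). -/
def dimII : ℤ := (Module.finrank ℂ φ.quadrics : ℤ) - 1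

/-- Two directions are conjugate if `II` vanishes on them. -/
def Conjugate (r s : Direction) : Prop := φ.II r.rep s.rep = 0

/-- The local equation at `x` of the intersection of `X` with the hyperplane `ℓ = 0`. -/
def sectionEquation (l : Module.Dual ℂ (Vec N)) : MvPowerSeries (Fin 2) ℂ :=
  ∑ k, l (Pi.single k 1) • φ.series k

/-- The hyperplane section has a double point at `x`. -/
def HasDoublePoint (l : Module.Dual ℂ (Vec N)) : Prop := (φ.sectionEquation l).order = 2

/-- The tangent directions at `x` of a hyperplane section with a double point at `x`, i.e. the
points of its projectivized tangent cone: the zeros of the part of degree `2` of its equation. -/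
def tangentDirections (l : Module.Dual ℂ (Vec N)) : Set Direction :=
  {r | MvPolynomial.eval r.rep ((φ.sectionEquation l).truncTotal 3) = 0}

/-- `r` and `s` are the two tangents at `x` of some hyperplane section with a double point
at `x`. If `r = s` the tangent cone of the section is a double line. -/
def IsTangentPair (r s : Direction) : Prop :=
  ∃ l : Module.Dual ℂ (Vec N), φ.HasDoublePoint l ∧ φ.tangentDirections l = {r, s}

/-- Whatever the vector `c₀ Φ + ∑ j, c j ∂Φ/∂t_j` moving in the tangent spaces of `X`, its derivative
at the origin is, modulo the tangent space at the origin, given by `secondDeriv`. -/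
theorem derivative_of_moving_tangent (a : Fin 2 → ℂ) (c₀ : MvPowerSeries (Fin 2) ℂ)
    (c : Fin 2 → MvPowerSeries (Fin 2) ℂ) :
    (∑ i, a i • valueAt (partialDeriv i
        (fun k => c₀ * φ.series k + ∑ j, c j * partialDeriv j φ.series k))) -
      φ.secondDeriv a (fun j => MvPowerSeries.constantCoeff (c j)) ∈
    Submodule.span ℂ
      ({valueAt φ.series} ∪ Set.range (fun i => valueAt (partialDeriv i φ.series))) := by
  have h0 : valueAt φ.series ∈ Submodule.span ℂ
      ({valueAt φ.series} ∪ Set.range (fun i => valueAt (partialDeriv i φ.series))) :=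
    Submodule.subset_span (Or.inl rfl)
  have h1 : ∀ i, valueAt (partialDeriv i φ.series) ∈ Submodule.span ℂ
      ({valueAt φ.series} ∪ Set.range (fun i => valueAt (partialDeriv i φ.series))) :=
    fun i => Submodule.subset_span (Or.inr ⟨i, rfl⟩)
  have key : (∑ i, a i • valueAt (partialDeriv i
        (fun k => c₀ * φ.series k + ∑ j, c j * partialDeriv j φ.series k))) -
      φ.secondDeriv a (fun j => MvPowerSeries.constantCoeff (c j)) =
      (∑ i, a i * MvPowerSeries.constantCoeff (MvPowerSeries.pderiv ℂ i c₀)) •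
          valueAt φ.series +
        ∑ i, a i • (MvPowerSeries.constantCoeff c₀ • valueAt (partialDeriv i φ.series) +
          ∑ j, MvPowerSeries.constantCoeff (MvPowerSeries.pderiv ℂ i (c j)) •
            valueAt (partialDeriv j φ.series)) := by
    ext k
    simp [valueAt, partialDeriv, secondDeriv, Fin.sum_univ_two]
    ring
  rw [key]
  exact add_mem (Submodule.smul_mem _ _ h0) (Submodule.sum_mem _ fun i _ =>
    Submodule.smul_mem _ _ (add_mem (Submodule.smul_mem _ _ (h1 i))
      (Submodule.sum_mem _ fun j _ => Submodule.smul_mem _ _ (h1 j))))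

/-- The moving tangent plane of a parametrization at the origin lies in the embedded tangent
space. -/
theorem frame_le_tangentSpace (hx : x ∈ X) :
    Submodule.span ℂ
      ({valueAt φ.series} ∪ Set.range (fun i => valueAt (partialDeriv i φ.series))) ≤
    tangentSpace X x := by
  obtain ⟨h, hb⟩ := φ.base
  obtain ⟨c, hc⟩ := (Projectivization.mk_eq_mk_iff' ℂ _ _ (Projectivization.rep_nonzero x) h).1
    (by rw [Projectivization.mk_rep, hb])
  have hc0 : c ≠ 0 := by
    rintro rfl
    exact Projectivization.rep_nonzero x (by simpa using hc.symm)
  have hrep : x.rep ∈ cone X := ⟨Projectivization.rep_nonzero x, by rwa [Projectivization.mk_rep]⟩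
  rw [Submodule.span_le]
  rintro u hu
  simp only [tangentSpace, SetLike.mem_coe, Submodule.mem_iInf, LinearMap.mem_ker]
  intro f hf
  have hf' := hf
  rw [idealOf, MvPolynomial.mem_vanishingIdeal_iff] at hf'
  simp only [LinearMap.sum_apply, LinearMap.smul_apply, LinearMap.proj_apply, smul_eq_mul]
  rcases hu with rfl | ⟨i, rfl⟩
  · -- Euler's relation
    set q : Polynomial ℂ := MvPolynomial.aeval
      (fun k => Polynomial.C (x.rep k) * Polynomial.X) f with hq
    have heval : ∀ (s : ℂ) (g : MvPolynomial (Fin (N + 1)) ℂ), Polynomial.eval s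
        (MvPolynomial.aeval (fun k => Polynomial.C (x.rep k) * Polynomial.X) g) =
        MvPolynomial.eval (s • x.rep) g := by
      intro s g
      induction g using MvPolynomial.induction_on with
      | C a => simp
      | add p q hp hq => simp [hp, hq]
      | mul_X p i hp => simp [hp, mul_comm s]
    have hq0 : q = 0 := by
      refine Polynomial.eq_zero_of_infinite_isRoot q
        (Set.Infinite.mono (s := {0}ᶜ) ?_ (Set.finite_singleton (0 : ℂ)).infinite_compl)
      intro s hs
      change Polynomial.eval s q = 0
      rw [hq, heval]
      simpa [MvPolynomial.aeval_eq_eval] using hf' _ (smul_mem_cone hs hrep)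
    have hd := derivation_aeval Polynomial.derivative'
      (fun k => Polynomial.C (x.rep k) * Polynomial.X) f
    rw [← hq, hq0, map_zero] at hd
    have := congrArg (Polynomial.eval 1) hd
    simp only [Polynomial.eval_zero, Polynomial.eval_finsetSum, Polynomial.eval_mul, heval] at this
    have hv : ∀ k, x.rep k = c * valueAt φ.series k := fun k => by rw [← hc]; simp
    have h2 : c * ∑ k, MvPolynomial.eval x.rep (MvPolynomial.pderiv k f) * valueAt φ.series k = 0 := by
      rw [Finset.mul_sum, this]
      refine Finset.sum_congr rfl fun k _ => ?_
      simp [hv k]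
      ring
    exact (mul_eq_zero.1 h2).resolve_left hc0
  · -- the chain rule for `f (c Φ)`
    set g : MvPolynomial (Fin (N + 1)) ℂ :=
      MvPolynomial.aeval (fun k => MvPolynomial.C c * MvPolynomial.X k) f with hg
    have hgI : g ∈ idealOf X := by
      rw [idealOf, MvPolynomial.mem_vanishingIdeal_iff]
      intro v hv
      have := hf' _ (smul_mem_cone hc0 hv)
      rw [hg, ← AlgHom.comp_apply, MvPolynomial.comp_aeval]
      simpa [Pi.smul_def] using this
    have h1 : MvPolynomial.aeval (fun k => MvPowerSeries.C c * φ.series k) f = 0 := by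
      have := φ.equations g hgI
      rw [hg, ← AlgHom.comp_apply, MvPolynomial.comp_aeval] at this
      convert this using 3
      simp [MvPowerSeries.algebraMap_apply]
    have hd := derivation_aeval (MvPowerSeries.pderiv ℂ i)
      (fun k => MvPowerSeries.C c * φ.series k) f
    rw [h1, map_zero] at hd
    have h3 := congrArg MvPowerSeries.constantCoeff hd
    have heval : ∀ p : MvPolynomial (Fin (N + 1)) ℂ, MvPowerSeries.constantCoeff
        (MvPolynomial.aeval (fun k => MvPowerSeries.C c * φ.series k) p) =
        MvPolynomial.eval x.rep p := by
      intro p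
      rw [← hc]
      induction p using MvPolynomial.induction_on with
      | C a => simp [MvPowerSeries.algebraMap_apply]
      | add p q hp hq => simp [hp, hq]
      | mul_X p i hp => simp [hp, valueAt]
    simp only [map_zero, map_sum, map_mul, heval] at h3
    have h4 : c * ∑ k, MvPolynomial.eval x.rep (MvPolynomial.pderiv k f) *
        valueAt (partialDeriv i φ.series) k = 0 := by
      rw [Finset.mul_sum, h3]
      refine Finset.sum_congr rfl fun k _ => ?_
      simp [valueAt, partialDeriv]
      ring
    exact (mul_eq_zero.1 h4).resolve_left hc0

end LocalParam

/-- `Φ` surfaces: surfaces in `ℙ^N`, `N ≥ 5`, whose osculating space at a general point has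
dimension `4`. -/
def IsPhiSurface (X : Set (PSpace N)) : Prop :=
  5 ≤ N ∧ ForGeneralPoint X fun x => ∀ φ : LocalParam X x, φ.dimOsc = 4

/-- `σ` is an involution of the projective line: a projectivity of order two. -/
def IsProjectiveInvolution (σ : Direction → Direction) : Prop :=
  (∃ g : (Fin 2 → ℂ) ≃ₗ[ℂ] (Fin 2 → ℂ), σ = Projectivization.map g.toLinearMap g.injective) ∧
    σ ≠ id ∧ ∀ r, σ (σ r) = r

end ProjSurface

end

open scoped LinearAlgebra.Projectivization

noncomputable section

namespace ProjSurface

/-! ### Derivations of function fields -/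

/-! Let `L` be the function field of the affine cone over `X`. The cone has dimension 3, so the
derivations of `L` over `ℂ` form a 3-dimensional `L`-space. Applied to the generic point (the vector
of coordinate functions in `L^(N+1)`) they sweep out the moving tangent space `movingTangent`, which
contains the generic point itself because the ideal is homogeneous (Euler). Adding second
derivatives gives `movingOsc`, of dimension `r` between 3 and 6. All numerical claims follow from
one comparison, `exists_general_point`: at a general point, for every parametrization, `r = 3 + dim`
of the span of the values of `II`, while `dim |II| = r - 4`.

This comparison has two ingredients. Ranks over `L` specialize to ranks over `ℂ` off a hypersurface
(`exists_finrank_span_eval`). Moreover second derivatives modulo the tangent space depend only on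
first derivatives: differentiating an equation `f` twice gives Hessian plus differential equal to
zero. Hence polynomial vector fields and formal parametrizations have the same osculating space
(`jet_mem_sup_span`, `Frame.osculatingSpace_eq`).

The global statements come from moving frames. A subspace of `L^n` stable under all derivations has
a basis of constant vectors (`exists_constant_frame`). If `r = 3`, the tangent space is stable, so
`X` lies in a plane and equals it by dimension. If `r = 4`, either the osculating space is stable
and `X` lies in a `ℙ³`, or commuting two derivations forces `II` to be degenerate along some field
`A` (`movingOsc_stable_or_exists_degenerate`). In the latter case the acceleration of `A` is a
combination of position and velocity, and the tangent frame moves within itself along `A`; the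
formal flow of `A` then traces a line with constant tangent plane, and algebraic identities spread
from the formal curve to the whole line.

The conjugate directions are binary algebra. Conjugacy of `u` and `w` means that the symmetric
product of `u` and `w` is a linear relation between the three second derivatives modulo the tangent
space. With one-dimensional span, solutions exist for every `u`; with three-dimensional span, none
do. With two-dimensional span there is one relation up to scalars; it factors as `p · q`, and this
is the only conjugate pair. The forms in `|II|` are those apolar to `p · q`, so their root pairs are
the pairs harmonic to `p, q`: the orbits of an involution if `p ≠ q`, and the pairs containing `p`
if `p = q`. -/

/-- An injective integral extension does not change the Krull dimension. -/
theorem ringKrullDim_eq_of_integral {A B : Type*} [CommRing A] [CommRing B] [IsDomain B]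
    [Algebra A B] [Algebra.IsIntegral A B] (hinj : Function.Injective (algebraMap A B)) :
    ringKrullDim B = ringKrullDim A := by
  have : IsDomain A := hinj.isDomain _
  apply le_antisymm
  -- Incomparability: distinct nested primes of `B` have distinct contractions.
  · refine Order.krullDim_le_of_strictMono (PrimeSpectrum.comap (algebraMap A B)) ?_
    intro P Q hPQ
    exact Ideal.IsIntegral.comap_lt_comap (R := A) (I := P.asIdeal) (J := Q.asIdeal) hPQ
  · refine iSup_le fun l => ?_
    have := l.head.2
    -- Lying over for the smallest prime of the chain, then going up for the rest.
    obtain ⟨Q, -, hQ, hl⟩ := Ideal.exists_ideal_over_prime_of_isIntegral (S := B) l.head.asIdeal ⊥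
      (by
        have : Ideal.comap (algebraMap A B) ⊥ = ⊥ := by
          rw [← RingHom.ker_eq_comap_bot]; exact (RingHom.injective_iff_ker_eq_bot _).1 hinj
        rw [this]; exact bot_le)
    have : Q.LiesOver l.head.asIdeal := ⟨hl.symm⟩
    obtain ⟨M, hM, -⟩ := Ideal.exists_ltSeries_of_hasGoingUp l Q
    rw [← hM]
    exact Order.LTSeries.length_le_krullDim M

section Differentials

variable {L : Type} [Field L] [Algebra ℂ L]

/-- The differentials of a transcendence basis form a basis of the Kähler differentials. -/
theorem exists_basis_kaehler {ι : Type} {x : ι → L} (hx : IsTranscendenceBasis ℂ x) :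
    ∃ b : Module.Basis ι L (Ω[L⁄ℂ]), ∀ i, b i = KaehlerDifferential.D ℂ L (x i) := by
  -- In characteristic zero `L` is separable algebraic over `ℂ(x)`, and `ℂ(x)` is a localization of
  -- `ℂ[x]`. Both steps are formally étale, so the basis `dx_i` of the differentials of `ℂ[x]` is
  -- carried over by base change.
  let : Algebra (MvPolynomial ι ℂ) L := (MvPolynomial.aeval x).toAlgebra
  have hmap : ∀ p : MvPolynomial ι ℂ, algebraMap (MvPolynomial ι ℂ) L p = MvPolynomial.aeval x p :=
    fun p => rfl
  have : IsScalarTower ℂ (MvPolynomial ι ℂ) L := IsScalarTower.of_algebraMap_eq fun c => by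
    rw [hmap]; simp
  have hinj : Function.Injective (algebraMap (MvPolynomial ι ℂ) L) := hx.1
  have : FaithfulSMul (MvPolynomial ι ℂ) L := (faithfulSMul_iff_algebraMap_injective _ _).2 hinj
  let : Algebra (FractionRing (MvPolynomial ι ℂ)) L := FractionRing.liftAlgebra _ L
  have : IsScalarTower (MvPolynomial ι ℂ) (FractionRing (MvPolynomial ι ℂ)) L :=
    FractionRing.isScalarTower_liftAlgebra _ L
  have : Algebra.IsAlgebraic (MvPolynomial ι ℂ) L := by
    have h := hx.isAlgebraic
    refine ⟨fun a => ?_⟩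
    obtain ⟨p, hp0, hp⟩ := h.isAlgebraic a
    -- Algebraicity is known over the subalgebra generated by `x`; the coefficients are moved back
    -- to the polynomial ring.
    let e := hx.1.aevalEquiv
    refine ⟨p.map (e.symm : _ →+* MvPolynomial ι ℂ), ?_, ?_⟩
    · exact (Polynomial.map_ne_zero_iff e.symm.injective).2 hp0
    · rw [Polynomial.aeval_def, Polynomial.eval₂_map]
      rw [Polynomial.aeval_def] at hp
      convert hp using 2
      ext q
      obtain ⟨r, rfl⟩ := e.surjective q
      simp only [RingHom.comp_apply, RingHom.coe_coe, e.symm_apply_apply, hmap]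
      rw [hx.1.algebraMap_aevalEquiv]
  have : Algebra.IsAlgebraic (FractionRing (MvPolynomial ι ℂ)) L :=
    Algebra.IsAlgebraic.extendScalars (R := MvPolynomial ι ℂ)
      (IsFractionRing.injective (MvPolynomial ι ℂ) (FractionRing (MvPolynomial ι ℂ)))
  have : CharZero (FractionRing (MvPolynomial ι ℂ)) := inferInstance
  have : Algebra.FormallyEtale (FractionRing (MvPolynomial ι ℂ)) L :=
    Algebra.FormallyEtale.of_isSeparable _ L
  have : Algebra.FormallyEtale (MvPolynomial ι ℂ) (FractionRing (MvPolynomial ι ℂ)) :=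
    Algebra.FormallyEtale.of_isLocalization (nonZeroDivisors (MvPolynomial ι ℂ))
  have : Algebra.FormallyEtale (MvPolynomial ι ℂ) L :=
    Algebra.FormallyEtale.comp _ (FractionRing (MvPolynomial ι ℂ)) _
  refine ⟨((KaehlerDifferential.mvPolynomialBasis ℂ ι).baseChange L).map
    (KaehlerDifferential.tensorKaehlerEquivOfFormallyEtale ℂ (MvPolynomial ι ℂ) L), fun i => ?_⟩
  rw [Module.Basis.map_apply, Module.Basis.baseChange_apply,
    KaehlerDifferential.mvPolynomialBasis_apply,
    KaehlerDifferential.tensorKaehlerEquivOfFormallyEtale_apply,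
    KaehlerDifferential.mapBaseChange_tmul, one_smul, KaehlerDifferential.map_D, hmap]
  simp

/-- The constants of all derivations of `L` over `ℂ` are the complex numbers. -/
theorem mem_range_of_forall_derivation_eq_zero {c : L} (hc : ∀ D : Derivation ℂ L L, D c = 0) :
    ∃ a : ℂ, algebraMap ℂ L a = c := by
  by_cases hal : IsAlgebraic ℂ c
  · have hint : IsIntegral ℂ c := hal.isIntegral
    exact minpoly.mem_range_of_degree_eq_one ℂ c
      (IsAlgClosed.degree_eq_one_of_irreducible ℂ (minpoly.irreducible hint))
  -- A transcendental `c` belongs to a transcendence basis, and the derivation dual to `dc` takes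
  -- the value 1 on it.
  · have hind : AlgebraicIndepOn ℂ id ({c} : Set L) := by
      have : Transcendental ℂ c := hal
      exact algebraicIndependent_singleton_iff (i := (⟨c, rfl⟩ : ({c} : Set L))) |>.2 this
    obtain ⟨s, hs, hb⟩ := exists_isTranscendenceBasis_superset hind
    obtain ⟨b, hbD⟩ := exists_basis_kaehler hb
    have h1 := hc ((KaehlerDifferential.linearMapEquivDerivation ℂ L)
      (b.coord ⟨c, hs rfl⟩))
    have h2 : b ⟨c, hs rfl⟩ = KaehlerDifferential.D ℂ L c := hbD _
    simp [← h2] at h1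

/-- The space of derivations has dimension the transcendence degree. -/
theorem finrank_derivation {m : ℕ} {x : Fin m → L} (hx : IsTranscendenceBasis ℂ x) :
    Module.finrank L (Derivation ℂ L L) = m ∧ Module.Finite L (Derivation ℂ L L) := by
  obtain ⟨b, -⟩ := exists_basis_kaehler hx
  have : Module.Finite L (Ω[L⁄ℂ]) := Module.Finite.of_basis b
  have e := KaehlerDifferential.linearMapEquivDerivation (M := L) ℂ L
  refine ⟨?_, Module.Finite.equiv e⟩
  rw [← e.finrank_eq]
  rw [show Module.finrank L (Ω[L⁄ℂ] →ₗ[L] L) = _ from Subspace.dual_finrank_eq,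
    Module.finrank_eq_card_basis b, Fintype.card_fin]

end Differentials

/-- The function field of a finitely generated domain of dimension `m` has a transcendence basis
of `m` elements. -/
theorem exists_isTranscendenceBasis_of_ringKrullDim {R L : Type} [CommRing R] [IsDomain R]
    [Algebra ℂ R] [Algebra.FiniteType ℂ R] [Field L] [Algebra R L] [IsFractionRing R L]
    [Algebra ℂ L] [IsScalarTower ℂ R L] {m : ℕ} (hdim : ringKrullDim R = m) :
    ∃ x : Fin m → L, IsTranscendenceBasis ℂ x := by
  -- Noether normalization: the images of the `s` variables form a transcendence basis, and `s` is
  -- the Krull dimension.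
  obtain ⟨s, g, hinj, hint⟩ := exists_integral_inj_algHom_of_fg ℂ R
  have hs : s = m := by
    let : Algebra (MvPolynomial (Fin s) ℂ) R := g.toAlgebra
    have : Algebra.IsIntegral (MvPolynomial (Fin s) ℂ) R := ⟨hint⟩
    have := ringKrullDim_eq_of_integral (A := MvPolynomial (Fin s) ℂ) (B := R) hinj
    rw [hdim, MvPolynomial.ringKrullDim_of_isNoetherianRing] at this
    simp at this
    exact_mod_cast this.symm
  subst hs
  refine ⟨fun i => algebraMap R L (g (MvPolynomial.X i)), ?_⟩
  have hcomp : ∀ p, MvPolynomial.aeval (fun i => algebraMap R L (g (MvPolynomial.X i))) p =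
      algebraMap R L (g p) := by
    intro p
    have : (MvPolynomial.aeval (fun i => algebraMap R L (g (MvPolynomial.X i)))) =
      (IsScalarTower.toAlgHom ℂ R L).comp g := by
      ext i; simp
    rw [this]; rfl
  have hind : AlgebraicIndependent ℂ (fun i => algebraMap R L (g (MvPolynomial.X i))) := by
    intro p q hpq
    rw [hcomp, hcomp] at hpq
    exact hinj (IsFractionRing.injective R L hpq)
  rw [hind.isTranscendenceBasis_iff_isAlgebraic]
  set A := Algebra.adjoin ℂ (Set.range fun i => algebraMap R L (g (MvPolynomial.X i))) with hA
  have hmem : ∀ p, algebraMap R L (g p) ∈ A := by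
    intro p
    rw [← hcomp p, hA, Algebra.adjoin_range_eq_range_aeval]
    exact ⟨p, rfl⟩
  have hR : ∀ r : R, IsIntegral A (algebraMap R L r) := by
    intro r
    obtain ⟨p, hp, hpr⟩ := hint r
    let φ : MvPolynomial (Fin s) ℂ →+* A :=
      ((algebraMap R L).comp (g : _ →+* R)).codRestrict A hmem
    refine ⟨p.map φ, hp.map _, ?_⟩
    rw [Polynomial.eval₂_map]
    have : (algebraMap A L).comp φ = (algebraMap R L).comp (g : _ →+* R) := by ext <;> rfl
    rw [this, ← Polynomial.hom_eval₂]
    have h0 : Polynomial.eval₂ (g : _ →+* R) r p = 0 := hpr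
    rw [h0, map_zero]
  refine ⟨fun y => ?_⟩
  obtain ⟨a, b, hb, rfl⟩ := IsFractionRing.div_surjective (A := R) y
  exact (hR a).isAlgebraic.mul ((hR b).isAlgebraic.inv) |> fun h => by rwa [← div_eq_mul_inv] at h

/-! ### Moving frames over a function field -/

section MovingFrame

variable {L : Type} [Field L] [Algebra ℂ L] {n : ℕ}

/-- The coordinatewise action of a derivation on vectors. -/
def ap (C : Derivation ℂ L L) (u : Fin n → L) : Fin n → L := fun k => C (u k)

theorem ap_add (C : Derivation ℂ L L) (u v : Fin n → L) : ap C (u + v) = ap C u + ap C v := by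
  ext k; simp [ap]

theorem ap_smul (C : Derivation ℂ L L) (a : L) (u : Fin n → L) :
    ap C (a • u) = C a • u + a • ap C u := by
  ext k; simp [ap]; ring

theorem add_ap (C D : Derivation ℂ L L) (u : Fin n → L) : ap (C + D) u = ap C u + ap D u := by
  ext k; simp [ap]

theorem smul_ap (a : L) (C : Derivation ℂ L L) (u : Fin n → L) : ap (a • C) u = a • ap C u := by
  ext k; simp [ap]

theorem ap_lie (C D : Derivation ℂ L L) (u : Fin n → L) :
    ap C (ap D u) = ap D (ap C u) + ap ⁅C, D⁆ u := by
  ext k; simp [ap, Derivation.commutator_apply]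

/-- A subspace of `Lⁿ` stable under all derivations of `L` is defined over the constants. -/
theorem exists_constant_frame
    (hconst : ∀ c : L, (∀ D : Derivation ℂ L L, D c = 0) → ∃ a : ℂ, algebraMap ℂ L a = c)
    (U : Submodule L (Fin n → L)) (hU : ∀ C : Derivation ℂ L L, ∀ u ∈ U, ap C u ∈ U) :
    ∃ w : Fin (Module.finrank L U) → (Fin n → ℂ), LinearIndependent ℂ w ∧
      ∀ u ∈ U, ∃ y : Fin (Module.finrank L U) → L,
        ∀ k, u k = ∑ i, y i * algebraMap ℂ L (w i k) := by
  classical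
  -- The ambient coordinates separate the points of `U`, hence span its dual. A subfamily indexed by
  -- `κ` is a basis of the dual, and `b` below is the dual basis of `U`, a reduced echelon form.
  let coord : Fin n → Module.Dual L U := fun k => (LinearMap.proj k).comp U.subtype
  obtain ⟨κ, a, ha, hspan, hli⟩ := exists_linearIndependent' L coord
  have hfin : Finite κ := Finite.of_injective a ha
  have : Fintype κ := Fintype.ofFinite κ
  have htop : Submodule.span L (Set.range coord) = ⊤ := by
    have h := Subspace.dualAnnihilator_dualCoannihilator_eq
      (W := (⊤ : Submodule L U))
    have h0 : (Submodule.span L (Set.range coord)).dualCoannihilator = ⊥ := by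
      rw [eq_bot_iff]
      intro u hu
      rw [Submodule.mem_dualCoannihilator] at hu
      rw [Submodule.mem_bot]
      ext k
      exact hu (coord k) (Submodule.subset_span ⟨k, rfl⟩)
    have h1 := Subspace.dualCoannihilator_dualAnnihilator_eq
      (W := Submodule.span L (Set.range coord))
    rw [h0] at h1
    rw [← h1, Submodule.dualAnnihilator_bot]
  let f : U →ₗ[L] (κ → L) := LinearMap.pi fun i => coord (a i)
  have hinj : Function.Injective f := by
    rw [← LinearMap.ker_eq_bot, eq_bot_iff]
    intro u hu
    rw [LinearMap.mem_ker] at hu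
    rw [Submodule.mem_bot]
    have hall : ∀ l : Module.Dual L U, l u = 0 := by
      intro l
      have hl : l ∈ Submodule.span L (Set.range (coord ∘ a)) := by rw [hspan, htop]; trivial
      induction hl using Submodule.span_induction with
      | mem x hx => obtain ⟨i, rfl⟩ := hx; exact congrFun hu i
      | zero => rfl
      | add x y _ _ hx hy => simp [hx, hy]
      | smul c x _ hx => simp [hx]
    ext k
    exact hall (coord k)
  have hcard : Fintype.card κ = Module.finrank L U := by
    rw [← Subspace.dual_finrank_eq (V := U), ← finrank_top, ← htop, ← hspan,
      finrank_span_eq_card hli]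
  let e : U ≃ₗ[L] (κ → L) := LinearEquiv.ofInjectiveOfFinrankEq f hinj (by simp [hcard])
  have he : ∀ u : U, ∀ i, e u i = (u : Fin n → L) (a i) := fun u i => rfl
  let b : κ → U := fun i => e.symm (Pi.single i 1)
  have hb : ∀ i j, (b i : Fin n → L) (a j) = (Pi.single i (1 : L) : κ → L) j := by
    intro i j
    rw [← he, LinearEquiv.apply_symm_apply]
  -- The pivot coordinates of `b i` are 0 or 1, so those of its derivative vanish. As the derivative
  -- stays in `U`, it is zero: all entries of `b i` are constants.
  have hDb : ∀ (D : Derivation ℂ L L) i k, D ((b i : Fin n → L) k) = 0 := by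
    intro D i k
    have h0 : (⟨ap D (b i), hU D _ (b i).2⟩ : U) = 0 := by
      apply hinj
      ext j
      change D ((b i : Fin n → L) (a j)) = 0
      rw [hb]
      rcases eq_or_ne j i with rfl | h
      · simp
      · simp [h]
    exact congrFun (congrArg Subtype.val h0) k
  choose w hw using fun i k => hconst ((b i : Fin n → L) k) (fun D => hDb D i k)
  have hw' : ∀ i j, w i (a j) = (Pi.single i (1 : ℂ) : κ → ℂ) j := by
    intro i j
    apply (algebraMap ℂ L).injective
    rw [hw, hb]
    rcases eq_or_ne j i with rfl | h
    · simp
    · simp [h]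
  let r : Fin (Module.finrank L U) ≃ κ := (Fintype.equivFinOfCardEq hcard).symm
  refine ⟨w ∘ r, ?_, fun u hu => ⟨fun i => u (a (r i)), fun k => ?_⟩⟩
  · refine LinearIndependent.comp ?_ r r.injective
    rw [Fintype.linearIndependent_iff]
    intro g hg j
    have := congrFun hg (a j)
    simpa [hw', Pi.single_apply] using this
  · have h1 : (⟨u, hu⟩ : U) = ∑ i, u (a i) • b i := by
      apply hinj
      ext j
      rw [map_sum]
      simp only [map_smul, Finset.sum_apply, Pi.smul_apply, smul_eq_mul]
      have : ∀ i, f (b i) j = (Pi.single i (1 : L) : κ → L) j := fun i => hb i j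
      simp only [this, Pi.single_apply]
      simp [f, coord]
    have h2 := congrFun (congrArg Subtype.val h1) k
    simp only [Submodule.coe_sum, Submodule.coe_smul, Finset.sum_apply, Pi.smul_apply,
      smul_eq_mul] at h2
    rw [h2, ← r.sum_comp]
    simp [hw]

/-- The map sending a derivation to the derivative of the moving point `X`. -/
def tangentMap (X : Fin n → L) : Derivation ℂ L L →ₗ[L] (Fin n → L) where
  toFun C := ap C X
  map_add' C D := add_ap C D X
  map_smul' a C := smul_ap a C X

/-- The moving tangent space. -/
def movingTangent (X : Fin n → L) : Submodule L (Fin n → L) := LinearMap.range (tangentMap X)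

/-- The moving osculating space. -/
def movingOsc (X : Fin n → L) : Submodule L (Fin n → L) :=
  movingTangent X ⊔ Submodule.span L (Set.range fun p : Derivation ℂ L L × Derivation ℂ L L =>
    ap p.1 (ap p.2 X))

variable {X : Fin n → L}

theorem ap_mem_movingTangent (C : Derivation ℂ L L) : ap C X ∈ movingTangent X := ⟨C, rfl⟩

theorem ap_ap_mem_movingOsc (C D : Derivation ℂ L L) : ap C (ap D X) ∈ movingOsc X :=
  Submodule.mem_sup_right (Submodule.subset_span ⟨(C, D), rfl⟩)

theorem movingTangent_le_movingOsc : movingTangent X ≤ movingOsc X := le_sup_left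

theorem ap_mem_movingOsc (C : Derivation ℂ L L) {u : Fin n → L} (hu : u ∈ movingTangent X) :
    ap C u ∈ movingOsc X := by
  obtain ⟨D, rfl⟩ := hu
  exact ap_ap_mem_movingOsc C D

/-- If the moving osculating space is one dimension larger than the moving tangent space, then
either it does not move, or there is a degenerate direction `A` whose integral curves are lines. -/
theorem movingOsc_stable_or_exists_degenerate (hinj : Function.Injective (tangentMap X))
    (hder : Module.finrank L (Derivation ℂ L L) = 3)
    (hosc : Module.finrank L (movingOsc X) = 4) {E : Derivation ℂ L L} (hE : ap E X = X)
    (hE0 : E ≠ 0) :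
    (∀ C : Derivation ℂ L L, ∀ u ∈ movingOsc X, ap C u ∈ movingOsc X) ∨
      ∃ A : Derivation ℂ L L, A ∉ Submodule.span L {E} ∧
        (∀ C, ap A (ap C X) ∈ movingTangent X) ∧
        ap A (ap A X) ∈ Submodule.span L {X, ap A X} := by
  have hfinD : Module.Finite L (Derivation ℂ L L) :=
    Module.finite_of_finrank_pos (by rw [hder]; norm_num)
  have hT3 : Module.finrank L (movingTangent X) = 3 := by
    rw [movingTangent, LinearMap.finrank_range_of_inj hinj, hder]
  set T := movingTangent X with hT
  set O := movingOsc X with hO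
  have hTO : T ≤ O := movingTangent_le_movingOsc
  -- The normal space inside `O` is a line spanned by `ν`; the functional `ψ` reads off the normal
  -- component, so `ψ (ap C (ap D X))` is a scalar second fundamental form.
  obtain ⟨ν, hνO, hνT⟩ : ∃ ν ∈ O, ν ∉ T := by
    by_contra! h
    have := Submodule.finrank_mono (show O ≤ T from h)
    omega
  obtain ⟨ψ, hψν, hψT⟩ := Submodule.exists_le_ker_of_notMem hνT
  have hψT' : ∀ t ∈ T, ψ t = 0 := fun t ht => hψT ht
  have hdecomp : ∀ u ∈ O, ∃ t ∈ T, u = t + (ψ u / ψ ν) • ν := by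
    have hle : T ⊔ Submodule.span L {ν} = O := by
      apply Submodule.eq_of_le_of_finrank_le
      · exact sup_le hTO ((Submodule.span_singleton_le_iff_mem _ _).2 hνO)
      · rw [hosc]
        have : T < T ⊔ Submodule.span L {ν} := by
          refine lt_of_le_of_ne le_sup_left fun h => hνT ?_
          rw [h]
          exact Submodule.mem_sup_right (Submodule.mem_span_singleton_self ν)
        have := Submodule.finrank_lt_finrank_of_lt this
        omega
    intro u hu
    rw [← hle] at hu
    obtain ⟨t, ht, s, hs, rfl⟩ := Submodule.mem_sup.1 hu
    obtain ⟨c, rfl⟩ := Submodule.mem_span_singleton.1 hs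
    refine ⟨t, ht, ?_⟩
    rw [map_add, hψT' t ht, zero_add, map_smul, smul_eq_mul, mul_div_cancel_right₀ _ hψν]
  have hmemT : ∀ u ∈ O, ψ u = 0 → u ∈ T := by
    intro u hu h
    obtain ⟨t, ht, hut⟩ := hdecomp u hu
    rw [h] at hut
    simpa [hut] using ht
  by_cases hst : ∀ C : Derivation ℂ L L, ∀ u ∈ O, ap C u ∈ O
  · exact Or.inl hst
  right
  push Not at hst
  obtain ⟨C₀, u₀, hu₀, hCu⟩ := hst
  obtain ⟨χ, hχu, hχO⟩ := Submodule.exists_le_ker_of_notMem hCu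
  have hχO' : ∀ t ∈ O, χ t = 0 := fun t ht => hχO ht
  -- `m` measures how `ν` leaves `O`. Derivatives of tangent vectors remain in `O`, so only the
  -- `ν`-component of `u ∈ O` contributes to `χ (ap C u)`.
  let m : Derivation ℂ L L →ₗ[L] L := χ.comp (tangentMap ν)
  have hm : ∀ C, m C = χ (ap C ν) := fun C => rfl
  have hχ : ∀ C, ∀ u ∈ O, χ (ap C u) = ψ u / ψ ν * m C := by
    intro C u hu
    obtain ⟨t, ht, hut⟩ := hdecomp u hu
    conv_lhs => rw [hut]
    rw [ap_add, ap_smul, map_add, map_add, hχO' _ (ap_mem_movingOsc C ht), map_smul,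
      hχO' ν hνO, map_smul, hm]
    simp
  have hm₀ : m C₀ ≠ 0 := by
    intro h
    rw [hχ C₀ u₀ hu₀, h, mul_zero] at hχu
    exact hχu rfl
  -- The bracket term `ap ⁅C, D⁆ (ap F X)` lies in `O`, so the third derivatives commute under `χ`.
  -- This makes the scalar second fundamental form proportional to `m` in each argument, hence of
  -- rank one.
  have hsymm : ∀ C D F, ψ (ap D (ap F X)) * m C = ψ (ap C (ap F X)) * m D := by
    intro C D F
    have h1 := hχ C _ (ap_ap_mem_movingOsc (X := X) D F)
    have h2 := hχ D _ (ap_ap_mem_movingOsc (X := X) C F)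
    rw [ap_lie C D, map_add, h2, hχO' _ (ap_mem_movingOsc _ (ap_mem_movingTangent F)),
      add_zero] at h1
    field_simp at h1
    linear_combination -h1
  -- The kernel of a linear form on a 3-dimensional space has dimension at least 2, so it exceeds
  -- the Euler line.
  obtain ⟨A, hAm, hAE⟩ : ∃ A ∈ LinearMap.ker m, A ∉ Submodule.span L {E} := by
    by_contra! h
    have h1 := Submodule.finrank_mono (show LinearMap.ker m ≤ Submodule.span L {E} from h)
    have h2 := LinearMap.finrank_range_add_finrank_ker m
    have h3 := Submodule.finrank_le (LinearMap.range m)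
    have h4 := finrank_span_singleton (K := L) hE0
    rw [Module.finrank_self] at h3
    omega
  rw [LinearMap.mem_ker] at hAm
  have hAT : ∀ F, ap A (ap F X) ∈ T := by
    intro F
    apply hmemT _ (ap_ap_mem_movingOsc A F)
    have := hsymm C₀ A F
    rw [hAm, mul_zero] at this
    exact (mul_eq_zero.1 this).resolve_right hm₀
  -- `K` is the kernel of the second fundamental form. It contains `E` and `A` and is not
  -- everything, so dimension 3 leaves only their span.
  let K : Submodule L (Derivation ℂ L L) :=
    { carrier := {C | ∀ F, ap C (ap F X) ∈ T}
      add_mem' := fun {C D} hC hD F => by rw [add_ap]; exact T.add_mem (hC F) (hD F)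
      zero_mem' := fun F => by
        have : ap (0 : Derivation ℂ L L) (ap F X) = 0 := by ext; simp [ap]
        rw [this]; exact T.zero_mem
      smul_mem' := fun a C hC F => by rw [smul_ap]; exact T.smul_mem a (hC F) }
  have hKA : A ∈ K := hAT
  have hKE : E ∈ K := by
    intro F
    rw [ap_lie, hE]
    exact T.add_mem (ap_mem_movingTangent F) (ap_mem_movingTangent _)
  have hKtop : K ≠ ⊤ := by
    intro h
    apply hνT
    have hle : O ≤ T := by
      refine sup_le le_rfl (Submodule.span_le.2 ?_)
      rintro _ ⟨p, rfl⟩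
      have : p.1 ∈ K := by rw [h]; trivial
      exact this p.2
    exact hle hνO
  have hK : K = Submodule.span L {E, A} := by
    symm
    apply Submodule.eq_of_le_of_finrank_le
    · rw [Submodule.span_le]
      rintro _ (rfl | rfl)
      · exact hKE
      · exact hKA
    · have h1 := Submodule.finrank_lt hKtop
      have hli : LinearIndependent L ![E, A] := by
        rw [LinearIndependent.pair_iff' hE0]
        intro a h
        exact hAE (Submodule.mem_span_singleton.2 ⟨a, h⟩)
      have h2 := finrank_span_eq_card hli
      rw [Matrix.range_cons, Matrix.range_cons, Matrix.range_empty, Set.union_empty,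
        Set.singleton_union, Fintype.card_fin] at h2
      omega
  refine ⟨A, hAE, hAT, ?_⟩
  have hT_A : ∀ t ∈ T, ap A t ∈ T := by
    rintro _ ⟨F, rfl⟩
    exact hAT F
  have hswap : ∀ B, ap B (ap A X) ∈ T := fun B => by
    rw [ap_lie]
    exact T.add_mem (hAT B) (ap_mem_movingTangent _)
  -- The acceleration of `A` is the velocity of some `Y`. Moving `B` past `A` shows that `B` applied
  -- to this acceleration is again tangent, so `Y` lies in `K` and is a combination of `E` and `A`.
  obtain ⟨Y, hY⟩ := hAT A
  have hYK : Y ∈ K := by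
    intro B
    rw [ap_lie]
    refine T.add_mem ?_ (ap_mem_movingTangent _)
    have : ap Y X = ap A (ap A X) := hY
    rw [this, ap_lie B A]
    exact T.add_mem (hT_A _ (hswap B)) (hswap _)
  rw [hK] at hYK
  obtain ⟨a, b, hab⟩ := Submodule.mem_span_pair.1 hYK
  rw [← hY, ← hab]
  refine Submodule.mem_span_pair.2 ⟨a, b, ?_⟩
  change _ = ap (a • E + b • A) X
  rw [add_ap, smul_ap, smul_ap, hE]

end MovingFrame

/-! ### Taylor expansion along vector fields -/

section Taylor

open PowerSeries in
/-- A power series solving the differential equation of the flow of `D` is determined by its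
constant coefficient. -/
theorem coeff_eq_of_derivative_eq {A : Type*} [CommRing A] [Algebra ℂ A] (D : Derivation ℂ A A)
    (F : A⟦X⟧) (hF : ∀ n, coeff (n + 1) F * (n + 1) = D (coeff n F)) (n : ℕ) :
    coeff n F = ((n.factorial : ℂ)⁻¹) • (D : A →ₗ[ℂ] A)^[n] (coeff 0 F) := by
  induction n with
  | zero => simp
  | succ n ih =>
    have h := hF n
    rw [ih, ← Derivation.coeFn_coe, map_smul] at h
    rw [Function.iterate_succ_apply']
    have hn : ((n : ℂ) + 1) ≠ 0 := by exact_mod_cast n.succ_ne_zero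
    have h2 : coeff (n + 1) F * ((n : A) + 1) = ((n : ℂ) + 1) • coeff (n + 1) F := by
      rw [Algebra.smul_def]; simp [mul_comm]
    rw [h2, ← eq_inv_smul_iff₀ hn] at h
    rw [h, Nat.factorial_succ, Nat.cast_mul, mul_inv, Nat.cast_succ, mul_smul]

open PowerSeries in
/-- The flow of a derivation, as a homomorphism to formal power series. -/
def expDer {A : Type*} [CommRing A] [Algebra ℂ A] (D : Derivation ℂ A A) : A →ₐ[ℂ] A⟦X⟧ :=
  have hstep : ∀ (a : A) (n : ℕ),
      (((n + 1).factorial : ℂ)⁻¹ • (D : A →ₗ[ℂ] A)^[n + 1] a) * ((n : A) + 1) =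
        D ((n.factorial : ℂ)⁻¹ • (D : A →ₗ[ℂ] A)^[n] a) := by
    intro a n
    have hn : ((n : ℂ) + 1) ≠ 0 := by exact_mod_cast n.succ_ne_zero
    have h2 : ∀ b : A, b * ((n : A) + 1) = ((n : ℂ) + 1) • b := by
      intro b; rw [Algebra.smul_def]; simp [mul_comm]
    rw [← Derivation.coeFn_coe, map_smul, Function.iterate_succ_apply', h2, smul_smul,
      Nat.factorial_succ, Nat.cast_mul, mul_inv, Nat.cast_succ, mul_inv_cancel_left₀ hn]
  AlgHom.ofLinearMap
    { toFun := fun a => PowerSeries.mk fun n =>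
        ((n.factorial : ℂ)⁻¹) • (D : A →ₗ[ℂ] A)^[n] a
      map_add' := by intro a b; ext n; simp [iterate_map_add, -Derivation.coeFn_coe]
      map_smul' := by
        intro c a
        ext n
        have : (D : A →ₗ[ℂ] A)^[n] (c • a) = c • (D : A →ₗ[ℂ] A)^[n] a := by
          rw [← Module.End.coe_pow, map_smul]
        simp only [coeff_mk, this, RingHom.id_apply, coeff_smul]
        rw [smul_comm] }
    (by
      ext n
      simp only [LinearMap.coe_mk, AddHom.coe_mk, coeff_mk]
      rcases n with _ | n
      · simp
      · rw [Function.iterate_succ_apply]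
        have : (D : A →ₗ[ℂ] A) 1 = 0 := D.map_one_eq_zero
        rw [this, iterate_map_zero]
        simp [coeff_one])
    (by
      intro a b
      ext n
      simp only [LinearMap.coe_mk, AddHom.coe_mk]
      rw [coeff_mk]
      symm
      -- Multiplicativity by uniqueness: the product of two solutions of the flow equation is, by
      -- the Leibniz rule, a solution with initial value `a * b`.
      rw [coeff_eq_of_derivative_eq D]
      · simp
      · intro n
        set F := PowerSeries.mk fun n => ((n.factorial : ℂ)⁻¹) • (D : A →ₗ[ℂ] A)^[n] a with hF
        set G := PowerSeries.mk fun n => ((n.factorial : ℂ)⁻¹) • (D : A →ₗ[ℂ] A)^[n] b with hG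
        have hF' : ∀ n, coeff n (derivative A F) = D (coeff n F) := by
          intro n
          rw [coeff_derivative, hF, coeff_mk, coeff_mk, hstep]
        have hG' : ∀ n, coeff n (derivative A G) = D (coeff n G) := by
          intro n
          rw [coeff_derivative, hG, coeff_mk, coeff_mk, hstep]
        rw [← coeff_derivative, Derivation.leibniz, map_add, smul_eq_mul, smul_eq_mul,
          mul_comm G, coeff_mul, coeff_mul, coeff_mul, map_sum, ← Finset.sum_add_distrib]
        refine Finset.sum_congr rfl fun p _ => ?_
        rw [hF', hG', Derivation.leibniz, smul_eq_mul, smul_eq_mul]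
        ring)

theorem coeff_expDer {A : Type*} [CommRing A] [Algebra ℂ A] (D : Derivation ℂ A A) (a : A)
    (n : ℕ) : PowerSeries.coeff n (expDer D a) =
      ((n.factorial : ℂ)⁻¹) • (D : A →ₗ[ℂ] A)^[n] a := by
  simp [expDer, -Derivation.coeFn_coe]

/-- The flow of `D` through the point `v`. -/
def flow {m : ℕ} (D : Derivation ℂ (MvPolynomial (Fin m) ℂ) (MvPolynomial (Fin m) ℂ))
    (v : Fin m → ℂ) : MvPolynomial (Fin m) ℂ →ₐ[ℂ] PowerSeries ℂ :=
  (PowerSeries.mapAlgHom (MvPolynomial.aeval v)).comp (expDer D)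

theorem coeff_flow {m : ℕ} (D : Derivation ℂ (MvPolynomial (Fin m) ℂ) (MvPolynomial (Fin m) ℂ))
    (v : Fin m → ℂ) (f : MvPolynomial (Fin m) ℂ) (n : ℕ) :
    PowerSeries.coeff n (flow D v f) =
      (n.factorial : ℂ)⁻¹ * MvPolynomial.eval v
        ((D : MvPolynomial (Fin m) ℂ →ₗ[ℂ] MvPolynomial (Fin m) ℂ)^[n] f) := by
  rw [flow, AlgHom.comp_apply, PowerSeries.mapAlgHom_apply, PowerSeries.coeff_map, coeff_expDer]
  simp [-Derivation.coeFn_coe]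

/-- The composition of the flows of two vector fields, as formal power series in two variables. -/
def doubleFlow {m : ℕ} (D₀ D₁ : Derivation ℂ (MvPolynomial (Fin m) ℂ) (MvPolynomial (Fin m) ℂ))
    (v : Fin m → ℂ) : MvPolynomial (Fin m) ℂ →ₐ[ℂ] MvPowerSeries (Fin 2) ℂ :=
  -- The outer variable `t_0` carries `expDer D₀`; each coefficient is then developed along `D₁` in
  -- `t_1`. The fields need not commute, since only a composite of algebra homomorphisms is needed.
  ((MvPowerSeries.finSuccEquiv ℂ 1).symm : _ →ₐ[ℂ] MvPowerSeries (Fin 2) ℂ).comp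
    ((PowerSeries.mapAlgHom
      (((MvPowerSeries.finSuccEquiv ℂ 0).symm : _ →ₐ[ℂ] MvPowerSeries (Fin 1) ℂ).comp
        ((PowerSeries.mapAlgHom (Algebra.ofId ℂ (MvPowerSeries (Fin 0) ℂ))).comp
          (flow D₁ v)))).comp (expDer D₀))

theorem coeff_doubleFlow {m : ℕ}
    (D₀ D₁ : Derivation ℂ (MvPolynomial (Fin m) ℂ) (MvPolynomial (Fin m) ℂ))
    (v : Fin m → ℂ) (f : MvPolynomial (Fin m) ℂ) (k l : ℕ) :
    MvPowerSeries.coeff (Finsupp.cons k (Finsupp.cons l 0)) (doubleFlow D₀ D₁ v f) =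
      (k.factorial : ℂ)⁻¹ * ((l.factorial : ℂ)⁻¹ * MvPolynomial.eval v
        ((D₁ : MvPolynomial (Fin m) ℂ →ₗ[ℂ] MvPolynomial (Fin m) ℂ)^[l]
          ((D₀ : MvPolynomial (Fin m) ℂ →ₗ[ℂ] MvPolynomial (Fin m) ℂ)^[k] f))) := by
  rw [← MvPowerSeries.coeff_coeff_finSuccEquiv]
  simp only [doubleFlow, AlgHom.comp_apply, AlgEquiv.coe_toAlgHom, AlgEquiv.apply_symm_apply]
  rw [PowerSeries.mapAlgHom_apply, PowerSeries.coeff_map, coeff_expDer]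
  simp only [map_smul, RingHom.coe_coe, AlgHom.comp_apply, AlgEquiv.coe_toAlgHom, smul_eq_mul]
  congr 1
  rw [← MvPowerSeries.coeff_coeff_finSuccEquiv, AlgEquiv.apply_symm_apply,
    PowerSeries.mapAlgHom_apply, PowerSeries.coeff_map, coeff_flow]
  simp [MvPowerSeries.algebraMap_apply]

end Taylor

/-! ### The function field of a cone and specialization to points -/

section Extension

open TrivSqZeroExt

/-- The first order deformation of a homomorphism from a polynomial ring. -/
theorem exists_algHom_trivSqZeroExt {n : ℕ} {L : Type} [Field L] [Algebra ℂ L]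
    (π : MvPolynomial (Fin n) ℂ →ₐ[ℂ] L) (u : Fin n → L) :
    ∃ Φ : MvPolynomial (Fin n) ℂ →ₐ[ℂ] TrivSqZeroExt L L, (∀ f, fst (Φ f) = π f) ∧
      ∀ f, snd (Φ f) = ∑ k, π (MvPolynomial.pderiv k f) * u k := by
  let Φ : MvPolynomial (Fin n) ℂ →ₐ[ℂ] TrivSqZeroExt L L :=
    MvPolynomial.aeval fun k => inl (π (MvPolynomial.X k)) + inr (u k)
  have hfst : ∀ f, fst (Φ f) = π f := by
    intro f
    have : (fstHom ℂ L L).comp Φ = π := by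
      ext k; simp [Φ]
    rw [← this]; rfl
  refine ⟨Φ, hfst, fun f => ?_⟩
  induction f using MvPolynomial.induction_on with
  | C a =>
    have : Φ (MvPolynomial.C a) = algebraMap ℂ _ a := by
      rw [← MvPolynomial.algebraMap_eq, AlgHom.commutes]
    rw [this]
    simp [algebraMap_eq_inl']
  | add f g hf hg => simp [hf, hg, add_mul, Finset.sum_add_distrib]
  | mul_X f i hf =>
    have hX : Φ (MvPolynomial.X i) = inl (π (MvPolynomial.X i)) + inr (u i) := by simp [Φ]
    rw [map_mul, snd_mul, hf, hfst, hX]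
    simp only [Derivation.leibniz, smul_eq_mul, map_add, map_mul, MvPolynomial.pderiv_X, add_mul,
      Finset.sum_add_distrib, snd_add, snd_inl, snd_inr, fst_add, fst_inl, fst_inr, zero_add,
      add_zero, MulOpposite.smul_eq_mul_unop, MulOpposite.unop_op]
    congr 1
    · rw [Finset.sum_eq_single i] <;> simp +contextual [eq_comm]
    · rw [Finset.sum_mul]
      exact Finset.sum_congr rfl fun k _ => by ring

/-- A first order deformation of the inclusion of a domain in its fraction field is a
derivation. -/
theorem exists_derivation_of_algHom {R L : Type} [CommRing R] [IsDomain R] [Algebra ℂ R]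
    [Field L] [Algebra R L] [IsFractionRing R L] [Algebra ℂ L] [IsScalarTower ℂ R L]
    (Φ : R →ₐ[ℂ] TrivSqZeroExt L L) (hΦ : ∀ r, fst (Φ r) = algebraMap R L r) :
    ∃ C : Derivation ℂ L L, ∀ r, C (algebraMap R L r) = snd (Φ r) := by
  -- In `L[ε]/ε²` an element with nonzero constant part is a unit, so `Φ` extends to `L`.
  -- Multiplicativity of the extension is the Leibniz rule for its `ε`-part.
  have hunit : ∀ y : nonZeroDivisors R, IsUnit (Φ y) := by
    rintro ⟨y, hy⟩
    rw [isUnit_iff_isUnit_fst, hΦ, isUnit_iff_ne_zero]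
    exact fun h => nonZeroDivisors.ne_zero hy
      ((map_eq_zero_iff _ (IsFractionRing.injective R L)).1 h)
  let Ψ : L →ₐ[ℂ] TrivSqZeroExt L L :=
    IsLocalization.liftAlgHom (M := nonZeroDivisors R) (f := Φ) hunit
  have hΨ : ∀ r, Ψ (algebraMap R L r) = Φ r := fun r => IsLocalization.lift_eq hunit _
  have hfstΨ : ∀ y, fst (Ψ y) = y := by
    intro y
    obtain ⟨a, b, hb, rfl⟩ := IsFractionRing.div_surjective (A := R) y
    have h := map_div₀ ((fstHom ℂ L L).comp Ψ) (algebraMap R L a) (algebraMap R L b)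
    have h' : ∀ f, ((fstHom ℂ L L).comp Ψ) (algebraMap R L f) = algebraMap R L f := fun f => by
      change fst (Ψ (algebraMap R L f)) = _
      rw [hΨ, hΦ]
    rw [h', h'] at h
    exact h
  refine ⟨Derivation.mk' ((sndHom L L).restrictScalars ℂ ∘ₗ Ψ.toLinearMap) ?_, ?_⟩
  · intro a b
    simp [hfstΨ, mul_comm]
  · intro k
    change snd (Ψ _) = _
    rw [hΨ]

end Extension

section FunctionField

variable {n : ℕ} (I : Ideal (MvPolynomial (Fin n) ℂ)) [I.IsPrime]

/-- The field of rational functions on the affine variety with ideal `I`. -/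
def FunctionField : Type := FractionRing (MvPolynomial (Fin n) ℂ ⧸ I)

instance : Field (FunctionField I) :=
  inferInstanceAs (Field (FractionRing (MvPolynomial (Fin n) ℂ ⧸ I)))

instance : Algebra ℂ (FunctionField I) :=
  inferInstanceAs (Algebra ℂ (FractionRing (MvPolynomial (Fin n) ℂ ⧸ I)))

instance : Algebra (MvPolynomial (Fin n) ℂ ⧸ I) (FunctionField I) :=
  inferInstanceAs (Algebra (MvPolynomial (Fin n) ℂ ⧸ I)
    (FractionRing (MvPolynomial (Fin n) ℂ ⧸ I)))

instance : IsScalarTower ℂ (MvPolynomial (Fin n) ℂ ⧸ I) (FunctionField I) :=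
  inferInstanceAs (IsScalarTower ℂ (MvPolynomial (Fin n) ℂ ⧸ I)
    (FractionRing (MvPolynomial (Fin n) ℂ ⧸ I)))

instance : IsFractionRing (MvPolynomial (Fin n) ℂ ⧸ I) (FunctionField I) :=
  inferInstanceAs (IsFractionRing (MvPolynomial (Fin n) ℂ ⧸ I)
    (FractionRing (MvPolynomial (Fin n) ℂ ⧸ I)))

/-- A polynomial as a rational function on the variety. -/
def toFF : MvPolynomial (Fin n) ℂ →ₐ[ℂ] FunctionField I :=
  (IsScalarTower.toAlgHom ℂ (MvPolynomial (Fin n) ℂ ⧸ I) (FunctionField I)).comp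
    (Ideal.Quotient.mkₐ ℂ I)

theorem toFF_apply (f : MvPolynomial (Fin n) ℂ) :
    toFF I f = algebraMap (MvPolynomial (Fin n) ℂ ⧸ I) (FunctionField I)
      (Ideal.Quotient.mk I f) := rfl

variable {I}

theorem toFF_eq_zero {f : MvPolynomial (Fin n) ℂ} : toFF I f = 0 ↔ f ∈ I := by
  rw [toFF_apply, map_eq_zero_iff _ (IsFractionRing.injective _ _), Ideal.Quotient.eq_zero_iff_mem]

theorem toFF_eq_toFF {f g : MvPolynomial (Fin n) ℂ} : toFF I f = toFF I g ↔ f - g ∈ I := by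
  rw [← toFF_eq_zero, map_sub, sub_eq_zero]

/-- The coordinate functions, as rational functions. -/
def genericPoint (I : Ideal (MvPolynomial (Fin n) ℂ)) [I.IsPrime] : Fin n → FunctionField I :=
  fun k => toFF I (MvPolynomial.X k)

theorem exists_clear_denominators {ι : Type*} [Finite ι] (y : ι → FunctionField I) :
    ∃ h ∉ I, ∃ p : ι → MvPolynomial (Fin n) ℂ, ∀ i, toFF I h * y i = toFF I (p i) := by
  obtain ⟨⟨b, hb⟩, hy⟩ := IsLocalization.exist_integer_multiples_of_finite
    (nonZeroDivisors (MvPolynomial (Fin n) ℂ ⧸ I)) y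
  obtain ⟨h, rfl⟩ := Ideal.Quotient.mk_surjective b
  choose q hq using hy
  choose p hp using fun i => Ideal.Quotient.mk_surjective (q i)
  refine ⟨h, fun hI => ?_, p, fun i => ?_⟩
  · exact nonZeroDivisors.ne_zero hb (Ideal.Quotient.eq_zero_iff_mem.2 hI)
  · rw [toFF_apply, toFF_apply, hp, hq, Algebra.smul_def]

/-- Every derivation of the function field is, up to a factor, given by a polynomial vector
field. -/
theorem exists_polynomial_derivation (C : Derivation ℂ (FunctionField I) (FunctionField I)) :
    ∃ h ∉ I, ∃ D : Derivation ℂ (MvPolynomial (Fin n) ℂ) (MvPolynomial (Fin n) ℂ),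
      ∀ f, toFF I (D f) = toFF I h * C (toFF I f) := by
  obtain ⟨h, hI, p, hp⟩ := exists_clear_denominators fun k => C (toFF I (MvPolynomial.X k))
  refine ⟨h, hI, MvPolynomial.mkDerivation ℂ p, fun f => ?_⟩
  induction f using MvPolynomial.induction_on with
  | C a =>
    rw [← MvPolynomial.algebraMap_eq, Derivation.map_algebraMap, AlgHom.commutes,
      Derivation.map_algebraMap, map_zero, mul_zero]
  | add f g hf hg => simp only [map_add, hf, hg, mul_add]
  | mul_X f i hf =>
    rw [Derivation.leibniz, map_mul, Derivation.leibniz, map_add, MvPolynomial.mkDerivation_X,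
      smul_eq_mul, smul_eq_mul, map_mul, map_mul, hf, ← hp]
    simp only [smul_eq_mul]
    ring

/-- A derivation of the function field is determined by its values at the coordinates. -/
theorem derivation_ext {C D : Derivation ℂ (FunctionField I) (FunctionField I)}
    (h : ∀ k, C (genericPoint I k) = D (genericPoint I k)) : C = D := by
  have hp : ∀ f, C (toFF I f) = D (toFF I f) := by
    intro f
    induction f using MvPolynomial.induction_on with
    | C a =>
      rw [← MvPolynomial.algebraMap_eq, AlgHom.commutes, Derivation.map_algebraMap,
        Derivation.map_algebraMap]
    | add f g hf hg => simp only [map_add, hf, hg]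
    | mul_X f i hf =>
      rw [map_mul, Derivation.leibniz, Derivation.leibniz, hf]
      rw [show C (toFF I (MvPolynomial.X i)) = D (toFF I (MvPolynomial.X i)) from h i]
  ext y
  obtain ⟨a, b, hb, rfl⟩ := IsFractionRing.div_surjective (A := MvPolynomial (Fin n) ℂ ⧸ I) y
  obtain ⟨a, rfl⟩ := Ideal.Quotient.mk_surjective a
  obtain ⟨b, rfl⟩ := Ideal.Quotient.mk_surjective b
  rw [← toFF_apply, ← toFF_apply, Derivation.leibniz_div, Derivation.leibniz_div, hp, hp]

/-- A vector of rational functions in the kernel of the differentials of the equations comes from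
a derivation. -/
theorem exists_derivation (u : Fin n → FunctionField I)
    (hu : ∀ f ∈ I, ∑ k, toFF I (MvPolynomial.pderiv k f) * u k = 0) :
    ∃ C : Derivation ℂ (FunctionField I) (FunctionField I), ∀ k, C (genericPoint I k) = u k := by
  obtain ⟨Φ, hfst, hsnd⟩ := exists_algHom_trivSqZeroExt (toFF I) u
  have hker : ∀ f ∈ I, Φ f = 0 := fun f hf => by
    apply TrivSqZeroExt.ext
    · rw [hfst, toFF_eq_zero.2 hf, TrivSqZeroExt.fst_zero]
    · rw [hsnd, hu f hf, TrivSqZeroExt.snd_zero]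
  obtain ⟨C, hC⟩ := exists_derivation_of_algHom (L := FunctionField I)
    (Ideal.Quotient.liftₐ I Φ hker) (fun r => by
      obtain ⟨f, rfl⟩ := Ideal.Quotient.mk_surjective r
      exact hfst f)
  refine ⟨C, fun k => ?_⟩
  rw [genericPoint, toFF_apply, hC]
  change TrivSqZeroExt.snd (Φ (MvPolynomial.X k)) = _
  rw [hsnd, Finset.sum_eq_single k]
  · simp
  · intro j _ hj
    simp [MvPolynomial.pderiv_X_of_ne hj.symm]
  · simp

/-- Linear independence at the generic point implies linear independence at general points. -/
theorem exists_linearIndependent_eval {ι : Type*} [Finite ι] {m : ℕ}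
    {u : ι → Fin m → MvPolynomial (Fin n) ℂ}
    (hu : LinearIndependent (FunctionField I) fun i k => toFF I (u i k)) :
    ∃ g ∉ I, ∀ v : Fin n → ℂ, (∀ f ∈ I, MvPolynomial.eval v f = 0) → MvPolynomial.eval v g ≠ 0 →
      LinearIndependent ℂ fun i k => MvPolynomial.eval v (u i k) := by
  classical
  have := Fintype.ofFinite ι
  -- Independence is certified by a left inverse over the function field. With common denominator
  -- `g` it becomes a polynomial identity modulo `I`, which specializes wherever `g` does not
  -- vanish.
  obtain ⟨φ, hφ⟩ := LinearMap.exists_leftInverse_of_injective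
    (Fintype.linearCombination (FunctionField I) fun i k => toFF I (u i k))
    (LinearMap.ker_eq_bot.2 (hu.fintypeLinearCombination_injective))
  obtain ⟨g, hg, p, hp⟩ := exists_clear_denominators
    fun q : ι × Fin m => φ (Pi.single q.2 1) q.1
  have hdual : ∀ i j, ∑ k, u j k * p (i, k) - (if i = j then g else 0) ∈ I := by
    intro i j
    rw [← toFF_eq_toFF, map_sum]
    have h1 := congrFun (LinearMap.congr_fun hφ (Pi.single j 1)) i
    rw [LinearMap.comp_apply, Fintype.linearCombination_apply_single, one_smul,
      LinearMap.id_apply] at h1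
    have h2 : (fun k => toFF I (u j k)) = ∑ k, toFF I (u j k) • Pi.single k 1 := by
      rw [← pi_eq_sum_univ' (fun k => toFF I (u j k))]
    rw [h2, map_sum, Finset.sum_apply] at h1
    simp only [map_smul, Pi.smul_apply, smul_eq_mul] at h1
    have h3 : ∑ k, toFF I (u j k * p (i, k)) =
        toFF I g * ∑ k, toFF I (u j k) * φ (Pi.single k 1) i := by
      rw [Finset.mul_sum]
      refine Finset.sum_congr rfl fun k _ => ?_
      rw [map_mul, ← hp]; ring
    rw [h3, h1]
    by_cases hij : i = j
    · subst hij; simp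
    · simp [hij]
  refine ⟨g, hg, fun v hv hgv => ?_⟩
  rw [Fintype.linearIndependent_iff]
  intro c hc i
  have h1 : ∑ j, c j * ∑ k, MvPolynomial.eval v (u j k) * MvPolynomial.eval v (p (i, k)) = 0 := by
    simp only [Finset.mul_sum]
    rw [Finset.sum_comm]
    refine Finset.sum_eq_zero fun k _ => ?_
    have := congrFun hc k
    simp only [Finset.sum_apply, Pi.smul_apply, smul_eq_mul, Pi.zero_apply] at this
    simp only [← mul_assoc]
    rw [← Finset.sum_mul, this, zero_mul]
  have h2 : ∀ j, ∑ k, MvPolynomial.eval v (u j k) * MvPolynomial.eval v (p (i, k)) =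
      if i = j then MvPolynomial.eval v g else 0 := by
    intro j
    have h := hv _ (hdual i j)
    simp only [map_sub, map_sum, map_mul] at h
    rw [sub_eq_zero] at h
    rw [h]
    split_ifs <;> simp
  simp only [h2] at h1
  simpa [hgv] using h1

/-- Linear relations at the generic point, with denominators cleared. -/
theorem exists_relation_of_mem_span {ι : Type*} [Fintype ι] {m : ℕ}
    {u : ι → Fin m → MvPolynomial (Fin n) ℂ} {w : Fin m → MvPolynomial (Fin n) ℂ}
    (hw : (fun k => toFF I (w k)) ∈
      Submodule.span (FunctionField I) (Set.range fun i k => toFF I (u i k))) :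
    ∃ g ∉ I, ∃ c : ι → MvPolynomial (Fin n) ℂ, ∀ k, g * w k - ∑ i, c i * u i k ∈ I := by
  obtain ⟨y, hy⟩ := (Submodule.mem_span_range_iff_exists_fun _).1 hw
  obtain ⟨g, hg, c, hc⟩ := exists_clear_denominators y
  refine ⟨g, hg, c, fun k => ?_⟩
  rw [← toFF_eq_toFF, map_mul, map_sum]
  have := congrFun hy k
  rw [Finset.sum_apply] at this
  simp only [Pi.smul_apply, smul_eq_mul] at this
  rw [← this, Finset.mul_sum]
  refine Finset.sum_congr rfl fun i _ => ?_
  rw [map_mul, ← hc]; ring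

theorem exists_prod_notMem {ι : Type*} [Fintype ι] (g : ι → MvPolynomial (Fin n) ℂ)
    (hg : ∀ i, g i ∉ I) : ∏ i, g i ∉ I := by
  intro h
  obtain ⟨i, -, hi⟩ := (Ideal.IsPrime.prod_mem_iff (p := I)).1 h
  exact hg i hi

/-- The rank of a finite family of vectors at general points is the rank at the generic point. -/
theorem exists_finrank_span_eval {ι : Type*} [Fintype ι] {m : ℕ}
    (u : ι → Fin m → MvPolynomial (Fin n) ℂ) :
    ∃ g ∉ I, ∀ v : Fin n → ℂ, (∀ f ∈ I, MvPolynomial.eval v f = 0) → MvPolynomial.eval v g ≠ 0 →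
      Module.finrank ℂ (Submodule.span ℂ (Set.range fun i k => MvPolynomial.eval v (u i k))) =
        Module.finrank (FunctionField I)
          (Submodule.span (FunctionField I) (Set.range fun i k => toFF I (u i k))) := by
  -- A maximal independent subfamily stays independent off `g₀ = 0`, and the relations expressing
  -- the remaining vectors survive off the zeros of their denominators.
  obtain ⟨κ, a, ha, hspan, hli⟩ := exists_linearIndependent' (FunctionField I)
    fun i k => toFF I (u i k)
  have hfin : Finite κ := Finite.of_injective a ha
  have : Fintype κ := Fintype.ofFinite κ
  obtain ⟨g₀, hg₀, hind⟩ := exists_linearIndependent_eval (u := u ∘ a) hli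
  have hrel : ∀ i, ∃ g ∉ I, ∃ c : κ → MvPolynomial (Fin n) ℂ,
      ∀ k, g * u i k - ∑ j, c j * u (a j) k ∈ I := by
    intro i
    refine exists_relation_of_mem_span (u := u ∘ a) ?_
    have : (fun i k => toFF I ((u ∘ a) i k)) = (fun i k => toFF I (u i k)) ∘ a := rfl
    rw [this, hspan]
    exact Submodule.subset_span ⟨i, rfl⟩
  choose g hg c hc using hrel
  refine ⟨g₀ * ∏ i, g i, ?_, fun v hv hgv => ?_⟩
  · intro h
    rcases Ideal.IsPrime.mem_or_mem ‹_› h with h | h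
    · exact hg₀ h
    · exact exists_prod_notMem g hg h
  rw [map_mul] at hgv
  have hli' := hind v hv (left_ne_zero_of_mul hgv)
  have hgi : ∀ i, MvPolynomial.eval v (g i) ≠ 0 := by
    intro i h
    apply right_ne_zero_of_mul hgv
    rw [map_prod]
    exact Finset.prod_eq_zero (Finset.mem_univ i) h
  have hspan' : Submodule.span ℂ (Set.range fun i k => MvPolynomial.eval v (u i k)) =
      Submodule.span ℂ (Set.range fun i k => MvPolynomial.eval v ((u ∘ a) i k)) := by
    apply le_antisymm
    · rw [Submodule.span_le]
      rintro _ ⟨i, rfl⟩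
      have : (fun k => MvPolynomial.eval v (u i k)) = (MvPolynomial.eval v (g i))⁻¹ •
          ∑ j, MvPolynomial.eval v (c i j) • (fun k => MvPolynomial.eval v ((u ∘ a) j k)) := by
        rw [eq_inv_smul_iff₀ (hgi i)]
        ext k
        have h := hv _ (hc i k)
        simp only [map_sub, map_mul, map_sum] at h
        rw [sub_eq_zero] at h
        simpa [Finset.sum_apply] using h
      simp only [SetLike.mem_coe]
      rw [this]
      exact Submodule.smul_mem _ _ (Submodule.sum_mem _ fun j _ => Submodule.smul_mem _ _
        (Submodule.subset_span ⟨j, rfl⟩))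
    · refine Submodule.span_mono ?_
      rintro _ ⟨j, rfl⟩
      exact ⟨a j, rfl⟩
  rw [hspan', finrank_span_eq_card hli', ← hspan, finrank_span_eq_card hli]

end FunctionField

variable {N : ℕ}

/-! ### The homogeneous ideal and general points -/

section Cone

variable {X : Set (PSpace N)}

theorem mem_idealOf {f : MvPolynomial (Fin (N + 1)) ℂ} :
    f ∈ idealOf X ↔ ∀ v ∈ cone X, MvPolynomial.eval v f = 0 := by
  rw [idealOf, MvPolynomial.mem_vanishingIdeal_iff]
  simp [MvPolynomial.aeval_eq_eval]

theorem eval_smul_of_isHomogeneous {n d : ℕ} {f : MvPolynomial (Fin n) ℂ}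
    (hf : f.IsHomogeneous d) (c : ℂ) (v : Fin n → ℂ) :
    MvPolynomial.eval (c • v) f = c ^ d * MvPolynomial.eval v f := by
  rw [MvPolynomial.eval_eq', MvPolynomial.eval_eq', Finset.mul_sum]
  refine Finset.sum_congr rfl fun m hm => ?_
  have hd : ∑ i, m i = d := by
    have := hf (MvPolynomial.mem_support_iff.1 hm)
    rw [Finsupp.weight_apply, Finsupp.sum_fintype] at this
    · simpa using this
    · simp
  simp only [Pi.smul_apply, smul_eq_mul, mul_pow, Finset.prod_mul_distrib]
  rw [Finset.prod_pow_eq_pow_sum, hd]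
  ring

/-- The restriction of a polynomial to the line through the origin and `v`. -/
def linePoly {n : ℕ} (v : Fin n → ℂ) (f : MvPolynomial (Fin n) ℂ) : Polynomial ℂ :=
  ∑ d ∈ Finset.range (f.totalDegree + 1),
    Polynomial.monomial d (MvPolynomial.eval v (MvPolynomial.homogeneousComponent d f))

theorem eval_linePoly {n : ℕ} (v : Fin n → ℂ) (f : MvPolynomial (Fin n) ℂ) (s : ℂ) :
    Polynomial.eval s (linePoly v f) = MvPolynomial.eval (s • v) f := by
  conv_rhs => rw [← MvPolynomial.sum_homogeneousComponent f]
  rw [linePoly, Polynomial.eval_finsetSum, map_sum]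
  refine Finset.sum_congr rfl fun d _ => ?_
  rw [eval_smul_of_isHomogeneous (MvPolynomial.homogeneousComponent_isHomogeneous d f),
    Polynomial.eval_monomial, mul_comm]

theorem coeff_linePoly {n : ℕ} (v : Fin n → ℂ) (f : MvPolynomial (Fin n) ℂ) (d : ℕ) :
    (linePoly v f).coeff d =
      MvPolynomial.eval v (MvPolynomial.homogeneousComponent d f) := by
  rw [linePoly, Polynomial.finsetSum_coeff]
  simp only [Polynomial.coeff_monomial, Finset.sum_ite_eq', Finset.mem_range]
  split_ifs with h
  · rfl
  · rw [MvPolynomial.homogeneousComponent_eq_zero _ _ (by omega), map_zero]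

theorem linePoly_ne_zero_exists {n : ℕ} {v : Fin n → ℂ} {f : MvPolynomial (Fin n) ℂ}
    (h : linePoly v f ≠ 0) : ∃ s : ℂ, s ≠ 0 ∧ MvPolynomial.eval (s • v) f ≠ 0 := by
  by_contra! hall
  apply h
  refine Polynomial.eq_zero_of_infinite_isRoot _
    (Set.Infinite.mono (s := {0}ᶜ) ?_ (Set.finite_singleton (0 : ℂ)).infinite_compl)
  intro s hs
  change Polynomial.eval s _ = 0
  rw [eval_linePoly]
  exact hall s hs

/-- The ideal of a projective variety is homogeneous. -/
theorem homogeneousComponent_mem {f : MvPolynomial (Fin (N + 1)) ℂ} (hf : f ∈ idealOf X) (d : ℕ) :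
    MvPolynomial.homogeneousComponent d f ∈ idealOf X := by
  rw [mem_idealOf] at hf ⊢
  intro v hv
  -- The homogeneous components are the coefficients of `s ↦ f (s v)`, a polynomial vanishing at
  -- every nonzero `s` because the cone is stable under scaling.
  rw [← coeff_linePoly]
  by_contra h
  obtain ⟨s, hs, hsf⟩ := linePoly_ne_zero_exists (v := v) (f := f) fun h0 => h (by rw [h0]; simp)
  exact hsf (hf _ (smul_mem_cone hs hv))

theorem rep_mem_cone {x : PSpace N} (hx : x ∈ X) : x.rep ∈ cone X :=
  ⟨x.rep_nonzero, by rwa [x.mk_rep]⟩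

/-- Closed sets are tested on the chosen representative `rep`; for forms any other vector on the
same line will do. -/
theorem eval_rep_eq_zero_iff {f : MvPolynomial (Fin (N + 1)) ℂ} {d : ℕ} (hf : f.IsHomogeneous d)
    (v : Vec N) (hv : v ≠ 0) :
    MvPolynomial.eval (Projectivization.mk ℂ v hv).rep f = 0 ↔ MvPolynomial.eval v f = 0 := by
  obtain ⟨a, ha⟩ := Projectivization.exists_smul_eq_mk_rep ℂ v hv
  rw [← ha, Units.smul_def, eval_smul_of_isHomogeneous hf]
  simp

/-- A property holds at a general point if and only if it holds outside a hypersurface of the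
cone. -/
theorem forGeneralPoint_iff {P : PSpace N → Prop} :
    ForGeneralPoint X P ↔ ∃ g ∉ idealOf X, ∀ (v : Vec N) (hv : v ≠ 0),
      Projectivization.mk ℂ v hv ∈ X → MvPolynomial.eval v g ≠ 0 →
        P (Projectivization.mk ℂ v hv) := by
  constructor
  · rintro ⟨Z, ⟨S, hS, hZ⟩, hXZ, hP⟩
    obtain ⟨x, hxX, hxZ⟩ := Set.not_subset.1 hXZ
    have : ∃ f ∈ S, MvPolynomial.eval x.rep f ≠ 0 := by
      by_contra! h
      exact hxZ ((hZ x).2 h)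
    obtain ⟨f, hfS, hfx⟩ := this
    refine ⟨f, fun h => hfx (mem_idealOf.1 h _ (rep_mem_cone hxX)), fun v hv hvX hvf => ?_⟩
    refine hP _ hvX fun hmem => hvf ?_
    obtain ⟨d, hd⟩ := hS f hfS
    exact (eval_rep_eq_zero_iff hd v hv).1 ((hZ _).1 hmem f hfS)
  · rintro ⟨g, hg, hP⟩
    -- `g` need not be homogeneous, so the closed set is cut out by all its components. Off it, `g`
    -- is nonzero at some multiple of the representative.
    refine ⟨{x | ∀ d, MvPolynomial.eval x.rep (MvPolynomial.homogeneousComponent d g) = 0},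
      ⟨Set.range fun d => MvPolynomial.homogeneousComponent d g, ?_, ?_⟩, ?_, ?_⟩
    · rintro _ ⟨d, rfl⟩
      exact ⟨d, MvPolynomial.homogeneousComponent_isHomogeneous d g⟩
    · intro x
      simp
    · intro hsub
      apply hg
      rw [← MvPolynomial.sum_homogeneousComponent g]
      refine Ideal.sum_mem _ fun d _ => mem_idealOf.2 ?_
      rintro v ⟨hv, hvX⟩
      exact (eval_rep_eq_zero_iff (MvPolynomial.homogeneousComponent_isHomogeneous d g) v hv).1
        (hsub hvX d)
    · intro x hx hxZ
      simp only [Set.mem_ofPred_eq, not_forall] at hxZ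
      obtain ⟨d, hd⟩ := hxZ
      obtain ⟨s, hs, hsg⟩ := linePoly_ne_zero_exists (v := x.rep) (f := g) fun h0 => hd (by
        rw [← coeff_linePoly, h0]; simp)
      have hmk : Projectivization.mk ℂ (s • x.rep) (smul_ne_zero hs x.rep_nonzero) = x := by
        conv_rhs => rw [← x.mk_rep]
        exact (Projectivization.mk_eq_mk_iff' ℂ _ _ _ _).2 ⟨s, rfl⟩
      have := hP (s • x.rep) (smul_ne_zero hs x.rep_nonzero) (by rwa [hmk]) hsg
      rwa [hmk] at this

theorem exists_mem_cone_of_notMem {g : MvPolynomial (Fin (N + 1)) ℂ} (hg : g ∉ idealOf X) :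
    ∃ (v : Vec N) (hv : v ≠ 0), Projectivization.mk ℂ v hv ∈ X ∧ MvPolynomial.eval v g ≠ 0 := by
  rw [mem_idealOf] at hg
  push Not at hg
  obtain ⟨v, ⟨hv, hvX⟩, hvg⟩ := hg
  exact ⟨v, hv, hvX, hvg⟩

/-- The Euler vector field. -/
def euler (n : ℕ) : Derivation ℂ (MvPolynomial (Fin n) ℂ) (MvPolynomial (Fin n) ℂ) :=
  MvPolynomial.mkDerivation ℂ MvPolynomial.X

theorem euler_X (n : ℕ) (k : Fin n) : euler n (MvPolynomial.X k) = MvPolynomial.X k :=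
  MvPolynomial.mkDerivation_X _ _ _

theorem derivation_apply {n : ℕ}
    (D : Derivation ℂ (MvPolynomial (Fin (n + 1)) ℂ) (MvPolynomial (Fin (n + 1)) ℂ))
    (f : MvPolynomial (Fin (n + 1)) ℂ) :
    D f = ∑ k, MvPolynomial.pderiv k f * D (MvPolynomial.X k) := by
  have h := derivation_aeval D MvPolynomial.X f
  simpa [MvPolynomial.aeval_X_left_apply] using h

theorem euler_of_isHomogeneous {n d : ℕ} {f : MvPolynomial (Fin (n + 1)) ℂ}
    (hf : f.IsHomogeneous d) : euler (n + 1) f = d • f := by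
  rw [derivation_apply, ← hf.sum_X_mul_pderiv]
  exact Finset.sum_congr rfl fun k _ => by rw [euler_X, mul_comm]

/-- The Euler field multiplies each homogeneous component by its degree, and the components belong
to the ideal. -/
theorem euler_mem {f : MvPolynomial (Fin (N + 1)) ℂ} (hf : f ∈ idealOf X) :
    euler (N + 1) f ∈ idealOf X := by
  rw [← MvPolynomial.sum_homogeneousComponent f, map_sum]
  refine Ideal.sum_mem _ fun d _ => ?_
  rw [euler_of_isHomogeneous (MvPolynomial.homogeneousComponent_isHomogeneous d f), nsmul_eq_mul]
  exact Ideal.mul_mem_left _ _ (homogeneousComponent_mem hf d)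

/-! ### Differentials, Hessians and tangent spaces of cones -/

/-- The differential of `f` at `v`. -/
def differential {n : ℕ} (v : Fin n → ℂ) (f : MvPolynomial (Fin n) ℂ) : (Fin n → ℂ) →ₗ[ℂ] ℂ :=
  ∑ k, MvPolynomial.eval v (MvPolynomial.pderiv k f) • LinearMap.proj k

theorem differential_apply {n : ℕ} (v : Fin n → ℂ) (f : MvPolynomial (Fin n) ℂ) (w : Fin n → ℂ) :
    differential v f w = ∑ k, MvPolynomial.eval v (MvPolynomial.pderiv k f) * w k := by
  simp [differential]

/-- The Hessian of `f` at `v`. -/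
def hessian {n : ℕ} (v : Fin n → ℂ) (f : MvPolynomial (Fin n) ℂ) :
    LinearMap.BilinForm ℂ (Fin n → ℂ) :=
  LinearMap.mk₂ ℂ (fun a b => ∑ k, ∑ l,
      MvPolynomial.eval v (MvPolynomial.pderiv l (MvPolynomial.pderiv k f)) * (a l * b k))
    (by intro a a' b; simp [add_mul, mul_add, Finset.sum_add_distrib])
    (by intro c a b; simp only [Pi.smul_apply, smul_eq_mul, Finset.mul_sum]
        exact Finset.sum_congr rfl fun k _ => Finset.sum_congr rfl fun l _ => by ring)
    (by intro a b b'; simp [mul_add, Finset.sum_add_distrib])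
    (by intro c a b; simp only [Pi.smul_apply, smul_eq_mul, Finset.mul_sum]
        exact Finset.sum_congr rfl fun k _ => Finset.sum_congr rfl fun l _ => by ring)

theorem hessian_apply {n : ℕ} (v : Fin n → ℂ) (f : MvPolynomial (Fin n) ℂ) (a b : Fin n → ℂ) :
    hessian v f a b = ∑ k, ∑ l,
      MvPolynomial.eval v (MvPolynomial.pderiv l (MvPolynomial.pderiv k f)) * (a l * b k) := rfl

theorem pderiv_pderiv_comm {n : ℕ} (k l : Fin n) (f : MvPolynomial (Fin n) ℂ) :
    MvPolynomial.pderiv k (MvPolynomial.pderiv l f) =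
      MvPolynomial.pderiv l (MvPolynomial.pderiv k f) := by
  have h : ⁅(MvPolynomial.pderiv k : Derivation ℂ (MvPolynomial (Fin n) ℂ) _),
      (MvPolynomial.pderiv l : Derivation ℂ (MvPolynomial (Fin n) ℂ) _)⁆ = 0 := by
    refine MvPolynomial.derivation_ext fun i => ?_
    simp [Derivation.commutator_apply, MvPolynomial.pderiv_X, Pi.single_apply, apply_ite]
  have := Derivation.congr_fun h f
  rwa [Derivation.commutator_apply, Derivation.zero_apply, sub_eq_zero] at this

theorem hessian_comm {n : ℕ} (v : Fin n → ℂ) (f : MvPolynomial (Fin n) ℂ) (a b : Fin n → ℂ) :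
    hessian v f a b = hessian v f b a := by
  rw [hessian_apply, hessian_apply, Finset.sum_comm]
  refine Finset.sum_congr rfl fun k _ => Finset.sum_congr rfl fun l _ => ?_
  rw [pderiv_pderiv_comm, mul_comm (a k)]

/-- The cone over the embedded tangent space, at a point of the cone. -/
def tangentAt {n : ℕ} (I : Ideal (MvPolynomial (Fin n) ℂ)) (v : Fin n → ℂ) :
    Submodule ℂ (Fin n → ℂ) :=
  ⨅ f ∈ I, LinearMap.ker (differential v f)

theorem mem_tangentAt {n : ℕ} {I : Ideal (MvPolynomial (Fin n) ℂ)} {v w : Fin n → ℂ} :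
    w ∈ tangentAt I v ↔ ∀ f ∈ I, differential v f w = 0 := by
  simp [tangentAt]

/-- Composing an equation with a homothety gives an equation. -/
theorem aeval_smul_mem {f : MvPolynomial (Fin (N + 1)) ℂ} (hf : f ∈ idealOf X) {c : ℂ}
    (hc : c ≠ 0) :
    MvPolynomial.aeval (fun k => MvPolynomial.C c * MvPolynomial.X k) f ∈ idealOf X := by
  rw [mem_idealOf] at hf ⊢
  intro v hv
  rw [← MvPolynomial.coe_aeval_eq_eval, RingHom.coe_coe, ← AlgHom.comp_apply,
    MvPolynomial.comp_aeval]
  simpa [Pi.smul_def] using hf _ (smul_mem_cone hc hv)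

/-- The ideal is stable under `f ↦ f (c ·)`, whose differential at `v` is `c` times the differential
of `f` at `c • v`. -/
theorem tangentAt_le_tangentAt_smul {c : ℂ} (hc : c ≠ 0) (v : Vec N) :
    tangentAt (idealOf X) v ≤ tangentAt (idealOf X) (c • v) := by
  intro w hw
  rw [mem_tangentAt] at hw ⊢
  intro f hf
  have h := hw _ (aeval_smul_mem hf hc)
  rw [differential_apply] at h ⊢
  have hk : ∀ k, MvPolynomial.eval v (MvPolynomial.pderiv k
      (MvPolynomial.aeval (fun k => MvPolynomial.C c * MvPolynomial.X k) f)) =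
      c * MvPolynomial.eval (c • v) (MvPolynomial.pderiv k f) := by
    intro k
    rw [derivation_aeval, map_sum, Finset.sum_eq_single k]
    · rw [map_mul, mul_comm]
      congr 1
      · simp
      · rw [← MvPolynomial.coe_aeval_eq_eval, RingHom.coe_coe, ← AlgHom.comp_apply,
          MvPolynomial.comp_aeval]
        simp [Pi.smul_def, MvPolynomial.aeval_eq_eval]
    · intro j _ hj
      simp [MvPolynomial.pderiv_X_of_ne hj]
    · simp
  simp only [hk, mul_assoc, ← Finset.mul_sum] at h
  exact (mul_eq_zero.1 h).resolve_left hc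

theorem tangentAt_smul {c : ℂ} (hc : c ≠ 0) (v : Vec N) :
    tangentAt (idealOf X) (c • v) = tangentAt (idealOf X) v := by
  refine le_antisymm ?_ (tangentAt_le_tangentAt_smul hc v)
  have := tangentAt_le_tangentAt_smul (X := X) (inv_ne_zero hc) (c • v)
  rwa [inv_smul_smul₀ hc] at this

theorem tangentSpace_mk (v : Vec N) (hv : v ≠ 0) :
    tangentSpace X (Projectivization.mk ℂ v hv) = tangentAt (idealOf X) v := by
  obtain ⟨a, ha⟩ := Projectivization.exists_smul_eq_mk_rep ℂ v hv
  rw [← tangentAt_smul a.ne_zero, ← Units.smul_def, ha]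
  rfl

/-- The second derivatives of a composition. -/
theorem second_derivative {A : Type*} [CommRing A] [Algebra ℂ A] (ε : A →+* ℂ)
    (hε : ∀ c, ε (algebraMap ℂ A c) = c) (d d' : Derivation ℂ A A) (F : Fin (N + 1) → A)
    (f : MvPolynomial (Fin (N + 1)) ℂ) :
    ε (d (d' (MvPolynomial.aeval F f))) =
      hessian (fun k => ε (F k)) f (fun k => ε (d (F k))) (fun k => ε (d' (F k))) +
        differential (fun k => ε (F k)) f (fun k => ε (d (d' (F k)))) := by
  -- `ε` is later either the constant coefficient of a power series or the evaluation of polynomials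
  -- at a point, so one chain rule serves parametrizations and vector fields alike.
  have heval : ∀ p : MvPolynomial (Fin (N + 1)) ℂ,
      ε (MvPolynomial.aeval F p) = MvPolynomial.eval (fun k => ε (F k)) p := by
    intro p
    induction p using MvPolynomial.induction_on with
    | C a => simp [hε]
    | add p q hp hq => simp [hp, hq]
    | mul_X p i hp => simp [hp]
  rw [derivation_aeval, map_sum, map_sum, hessian_apply, differential_apply,
    ← Finset.sum_add_distrib]
  refine Finset.sum_congr rfl fun k _ => ?_
  rw [Derivation.leibniz, derivation_aeval, smul_eq_mul, smul_eq_mul, map_add, map_mul, map_mul,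
    map_sum, heval, add_comm, Finset.mul_sum]
  congr 1
  refine Finset.sum_congr rfl fun l _ => ?_
  rw [map_mul, heval]
  ring

end Cone

/-! ### Comparison of second order jets -/

/-- Second order data of two frames of the same tangent space span the same space modulo the
tangent space. -/
theorem jet_mem_sup_span {V J ι κ : Type*} [AddCommGroup V] [Module ℂ V] [Fintype ι]
    {T : Submodule ℂ V} {d : J → V →ₗ[ℂ] ℂ} (hT : ∀ w, (∀ j, d j w = 0) → w ∈ T)
    {B : J → LinearMap.BilinForm ℂ V} {e : ι → V} {s : ι → ι → V}
    (hs : ∀ j a b, B j (e a) (e b) + d j (s a b) = 0) {e' : κ → V} {s' : κ → κ → V}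
    (hs' : ∀ j a b, B j (e' a) (e' b) + d j (s' a b) = 0)
    (he : ∀ a, e' a ∈ Submodule.span ℂ (Set.range e)) (a b : κ) :
    s' a b ∈ T ⊔ Submodule.span ℂ (Set.range fun p : ι × ι => s p.1 p.2) := by
  obtain ⟨x, hx⟩ := (Submodule.mem_span_range_iff_exists_fun _).1 (he a)
  obtain ⟨y, hy⟩ := (Submodule.mem_span_range_iff_exists_fun _).1 (he b)
  -- The differentials of second derivatives are minus the Hessians, which are bilinear in the first
  -- derivatives. Expanding `e'` in `e` thus determines `s'` up to the common kernel of the `d j`.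
  have h1 : s' a b - ∑ i, ∑ k, (x i * y k) • s i k ∈ T := by
    refine hT _ fun j => ?_
    have h2 : B j (e' a) (e' b) = ∑ i, ∑ k, x i * y k * B j (e i) (e k) := by
      rw [← hx, ← hy]
      simp only [map_sum, LinearMap.sum_apply, map_smul, LinearMap.smul_apply, smul_eq_mul]
      rw [Finset.sum_comm]
      refine Finset.sum_congr rfl fun i _ => ?_
      rw [Finset.mul_sum]
      exact Finset.sum_congr rfl fun k _ => by ring
    have h3 : ∀ i k, d j (s i k) = -B j (e i) (e k) := fun i k => by
      linear_combination hs j i k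
    have h4 := hs' j a b
    rw [h2] at h4
    simp only [map_sub, map_sum, map_smul, smul_eq_mul, h3]
    simp only [mul_neg, Finset.sum_neg_distrib]
    linear_combination h4
  rw [← sub_add_cancel (s' a b) (∑ i, ∑ k, (x i * y k) • s i k)]
  exact Submodule.add_mem_sup h1 (Submodule.sum_mem _ fun i _ => Submodule.sum_mem _ fun k _ =>
    Submodule.smul_mem _ _ (Submodule.subset_span ⟨(i, k), rfl⟩))

/-! ### Binary quadratic forms -/

section Binary

/-- The determinant of two vectors of the plane. -/
def det2 (u w : Fin 2 → ℂ) : ℂ := u 0 * w 1 - u 1 * w 0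

theorem vec2_eq_zero_iff {u : Fin 2 → ℂ} : u = 0 ↔ u 0 = 0 ∧ u 1 = 0 := by
  rw [funext_iff, Fin.forall_fin_two]; rfl

theorem mk_eq_mk_iff_det2 {u w : Fin 2 → ℂ} (hu : u ≠ 0) (hw : w ≠ 0) :
    (Projectivization.mk ℂ u hu : Direction) = Projectivization.mk ℂ w hw ↔ det2 u w = 0 := by
  rw [Projectivization.mk_eq_mk_iff']
  constructor
  · rintro ⟨a, rfl⟩
    simp [det2]; ring
  · intro h
    rw [det2] at h
    by_cases h0 : w 0 = 0
    · have h1 : w 1 ≠ 0 := fun h1 => hw (vec2_eq_zero_iff.2 ⟨h0, h1⟩)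
      refine ⟨u 1 / w 1, ?_⟩
      ext i
      fin_cases i
      · have : u 0 * w 1 = 0 := by rw [h0] at h; linear_combination h
        simp [h0, (mul_eq_zero.1 this).resolve_right h1]
      · simp [h1]
    · refine ⟨u 0 / w 0, ?_⟩
      ext i
      fin_cases i
      · simp [h0]
      · simp only [Fin.mk_one, Pi.smul_apply, smul_eq_mul]
        field_simp
        linear_combination h

/-- The three hypotheses are the coefficients of the product of the linear forms with coefficient
vectors `u` and `w`; polynomials over a field have no zero divisors. -/
theorem symm_product_eq_zero {u w : Fin 2 → ℂ} (h0 : u 0 * w 0 = 0)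
    (h1 : u 0 * w 1 + u 1 * w 0 = 0) (h2 : u 1 * w 1 = 0) : u = 0 ∨ w = 0 := by
  simp only [vec2_eq_zero_iff]
  rcases mul_eq_zero.1 h0 with h | h <;> rcases mul_eq_zero.1 h2 with h' | h' <;>
    simp_all

/-- Every binary quadratic form is a product of two linear forms. -/
theorem exists_factorization {α β γ : ℂ} (h : ¬ (α = 0 ∧ β = 0 ∧ γ = 0)) :
    ∃ p q : Fin 2 → ℂ, p ≠ 0 ∧ q ≠ 0 ∧ p 0 * q 0 = α ∧ p 0 * q 1 + p 1 * q 0 = β ∧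
      p 1 * q 1 = γ := by
  by_cases hα : α = 0
  · refine ⟨![0, 1], ![β, γ], ?_, ?_, ?_, ?_, ?_⟩ <;> simp_all
  -- `δ` is a square root of the discriminant; the two factors come from the quadratic formula.
  · obtain ⟨δ, hδ⟩ := IsAlgClosed.exists_eq_mul_self (β ^ 2 - 4 * α * γ)
    refine ⟨![α, (β - δ) / 2], ![1, (β + δ) / (2 * α)], ?_, ?_, ?_, ?_, ?_⟩
    · simp [hα]
    · simp
    · simp
    · simp; field_simp; ring
    · simp; field_simp; linear_combination hδ

/-- The factorization of a binary quadratic form is unique. -/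
theorem factorization_unique {u w p q : Fin 2 → ℂ} (hu : u ≠ 0) (hw : w ≠ 0) (hp : p ≠ 0)
    (hq : q ≠ 0) :
    (∃ t : ℂ, u 0 * w 0 = t * (p 0 * q 0) ∧
      u 0 * w 1 + u 1 * w 0 = t * (p 0 * q 1 + p 1 * q 0) ∧ u 1 * w 1 = t * (p 1 * q 1)) ↔
    (det2 u p = 0 ∧ det2 w q = 0) ∨ (det2 u q = 0 ∧ det2 w p = 0) := by
  constructor
  · rintro ⟨t, h0, h1, h2⟩
    have ht : t ≠ 0 := by
      rintro rfl
      rcases symm_product_eq_zero (u := u) (w := w) (by simpa using h0) (by simpa using h1)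
        (by simpa using h2) with h | h
      · exact hu h
      · exact hw h
    -- Evaluation of both products at `(z 1, -z 0)`. Taking `z` to be each of the four vectors
    -- matches the roots.
    have key : ∀ z : Fin 2 → ℂ, det2 u z * det2 w z = t * (det2 p z * det2 q z) := by
      intro z
      simp only [det2]
      linear_combination (z 1) ^ 2 * h0 - z 0 * z 1 * h1 + (z 0) ^ 2 * h2
    have hself : ∀ z, det2 z z = 0 := fun z => by simp [det2]; ring
    have hup : det2 u p = 0 ∨ det2 w p = 0 := by
      have := key p; rw [hself] at this; simpa using this
    have huq : det2 u q = 0 ∨ det2 w q = 0 := by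
      have := key q; rw [hself] at this; simpa using this
    have hpu : det2 p u = 0 ∨ det2 q u = 0 := by
      have := key u; rw [hself] at this; simpa [ht] using this.symm
    have hpw : det2 p w = 0 ∨ det2 q w = 0 := by
      have := key w; rw [hself] at this; simpa [ht] using this.symm
    have hneg : ∀ a b, det2 a b = 0 → det2 b a = 0 := fun a b h => by
      simp only [det2] at h ⊢; linear_combination -h
    -- When one of `u`, `w` is proportional to both `p` and `q`, the relations `hpw` and `hpu` place
    -- the other one.
    rcases hup with h | h <;> rcases huq with h' | h'
    · rcases hpw with h'' | h''
      · exact Or.inr ⟨h', hneg _ _ h''⟩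
      · exact Or.inl ⟨h, hneg _ _ h''⟩
    · exact Or.inl ⟨h, h'⟩
    · exact Or.inr ⟨h', h⟩
    · rcases hpu with h'' | h''
      · exact Or.inl ⟨hneg _ _ h'', h'⟩
      · exact Or.inr ⟨hneg _ _ h'', h⟩
  · have aux : ∀ a b : Fin 2 → ℂ, ∀ ha : a ≠ 0, ∀ hb : b ≠ 0, det2 a b = 0 → ∃ c : ℂ, c • b = a :=
      fun a b ha hb h => (Projectivization.mk_eq_mk_iff' ℂ a b ha hb).1
        ((mk_eq_mk_iff_det2 ha hb).2 h)
    rintro (⟨h, h'⟩ | ⟨h, h'⟩)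
    · obtain ⟨c, rfl⟩ := aux _ _ hu hp h
      obtain ⟨d, rfl⟩ := aux _ _ hw hq h'
      refine ⟨c * d, ?_, ?_, ?_⟩ <;> simp <;> ring
    · obtain ⟨c, rfl⟩ := aux _ _ hu hq h
      obtain ⟨d, rfl⟩ := aux _ _ hw hp h'
      refine ⟨c * d, ?_, ?_, ?_⟩ <;> simp <;> ring

/-- A binary quadratic form vanishing at `u` is a product with one factor `det2 · u`. -/
theorem exists_factor_of_zero {a b c : ℂ} (h : ¬ (a = 0 ∧ b = 0 ∧ c = 0)) {u : Fin 2 → ℂ}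
    (hu : u ≠ 0) (hz : a * u 0 ^ 2 + 2 * b * (u 0 * u 1) + c * u 1 ^ 2 = 0) :
    ∃ s : Fin 2 → ℂ, s ≠ 0 ∧ a = u 1 * s 1 ∧ 2 * b = -(u 0 * s 1 + u 1 * s 0) ∧
      c = u 0 * s 0 := by
  have main : ∃ s : Fin 2 → ℂ, a = u 1 * s 1 ∧ 2 * b = -(u 0 * s 1 + u 1 * s 0) ∧
      c = u 0 * s 0 := by
    by_cases h0 : u 0 = 0
    · have h1 : u 1 ≠ 0 := fun h1 => hu (vec2_eq_zero_iff.2 ⟨h0, h1⟩)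
      have hc : c = 0 := by simpa [h0, h1] using hz
      refine ⟨![-2 * b / u 1, a / u 1], ?_, ?_, ?_⟩ <;> simp [h0, hc] <;> field_simp
    · refine ⟨![c / u 0, (-2 * b - u 1 * (c / u 0)) / u 0], ?_, ?_, ?_⟩
      · simp; field_simp; linear_combination hz
      · simp; field_simp; ring
      · simp; field_simp
  obtain ⟨s, h1, h2, h3⟩ := main
  refine ⟨s, fun hs => h ?_, h1, h2, h3⟩
  subst hs
  simp at h1 h2 h3
  exact ⟨h1, h2, h3⟩

end Binary

/-! ### The second fundamental form at a smooth point -/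

namespace LocalParam

variable {X : Set (PSpace N)} {x : PSpace N} (φ : LocalParam X x)

/-- The second partial derivatives at the origin. -/
def second (i j : Fin 2) : Vec N := valueAt (partialDeriv i (partialDeriv j φ.series))

theorem second_comm (i j : Fin 2) : φ.second i j = φ.second j i := by
  ext k
  simp only [second, valueAt, partialDeriv]
  rw [← MvPowerSeries.coeff_zero_eq_constantCoeff_apply,
    ← MvPowerSeries.coeff_zero_eq_constantCoeff_apply]
  simp only [MvPowerSeries.coeff_pderiv]
  fin_cases i <;> fin_cases j <;> simp [add_comm]

/-- The classes of the second derivatives in the normal space. -/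
def normal (i j : Fin 2) : Vec N ⧸ tangentSpace X x := (tangentSpace X x).mkQ (φ.second i j)

theorem normal_comm (i j : Fin 2) : φ.normal i j = φ.normal j i := by
  rw [normal, second_comm, normal]

theorem II_apply (a b : Fin 2 → ℂ) :
    φ.II a b = (a 0 * b 0) • φ.normal 0 0 + (a 0 * b 1 + a 1 * b 0) • φ.normal 0 1 +
      (a 1 * b 1) • φ.normal 1 1 := by
  have : φ.II a b = (tangentSpace X x).mkQ (∑ i, ∑ j, (a i * b j) • φ.second i j) := rfl
  rw [this]
  simp only [Fin.sum_univ_two, map_add, map_smul]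
  change (a 0 * b 0) • φ.normal 0 0 + (a 0 * b 1) • φ.normal 0 1 +
    ((a 1 * b 0) • φ.normal 1 0 + (a 1 * b 1) • φ.normal 1 1) = _
  rw [φ.normal_comm 1 0, add_smul]
  abel

theorem II_comm (a b : Fin 2 → ℂ) : φ.II a b = φ.II b a := by
  rw [II_apply, II_apply]
  congr 2
  · rw [mul_comm]
  · congr 1; ring
  · rw [mul_comm]

/-- The first normal space, spanned by the values of the second fundamental form. -/
def firstNormal : Submodule ℂ (Vec N ⧸ tangentSpace X x) :=
  Submodule.span ℂ (Set.range ![φ.normal 0 0, φ.normal 0 1, φ.normal 1 1])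

theorem normal_mem (i j : Fin 2) : φ.normal i j ∈ φ.firstNormal := by
  have h : ∀ k, ![φ.normal 0 0, φ.normal 0 1, φ.normal 1 1] k ∈ φ.firstNormal :=
    fun k => Submodule.subset_span ⟨k, rfl⟩
  fin_cases i <;> fin_cases j
  · exact h 0
  · exact h 1
  · change φ.normal 1 0 ∈ _
    rw [normal_comm]; exact h 1
  · exact h 2

theorem II_mem (a b : Fin 2 → ℂ) : φ.II a b ∈ φ.firstNormal := by
  rw [II_apply]
  exact add_mem (add_mem (Submodule.smul_mem _ _ (φ.normal_mem _ _))
    (Submodule.smul_mem _ _ (φ.normal_mem _ _))) (Submodule.smul_mem _ _ (φ.normal_mem _ _))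

theorem finrank_quadrics : Module.finrank ℂ φ.quadrics = Module.finrank ℂ φ.firstNormal := by
  set ψ : Module.Dual ℂ (Vec N ⧸ tangentSpace X x) →ₗ[ℂ] QuadraticForm ℂ (Fin 2 → ℂ) :=
      { toFun := fun l => LinearMap.BilinMap.toQuadraticMap (φ.II.compr₂ l)
        map_add' := fun _ _ => by ext; simp
        map_smul' := fun _ _ => by ext; simp } with hψ
  -- By polarization a functional gives the zero quadric exactly when it kills all values of `II`.
  -- Rank-nullity then makes the space of quadrics dual to `firstNormal`.
  have hker : LinearMap.ker ψ = φ.firstNormal.dualAnnihilator := by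
    ext l
    rw [LinearMap.mem_ker, Submodule.mem_dualAnnihilator]
    have hval : ∀ z, ψ l z = l (φ.II z z) := fun z => rfl
    constructor
    · intro h
      have hz : ∀ z, l (φ.II z z) = 0 := fun z => by rw [← hval, h]; rfl
      have hpol : ∀ z w, l (φ.II z w) = 0 := by
        intro z w
        have h1 := hz (z + w)
        simp only [map_add, LinearMap.add_apply, hz, φ.II_comm w z] at h1
        have : (2 : ℂ) * l (φ.II z w) = 0 := by linear_combination h1
        simpa using this
      intro w hw
      induction hw using Submodule.span_induction with
      | mem y hy =>
        obtain ⟨k, rfl⟩ := hy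
        have h00 := hpol ![1, 0] ![1, 0]
        have h01 := hpol ![1, 0] ![0, 1]
        have h11 := hpol ![0, 1] ![0, 1]
        rw [II_apply] at h00 h01 h11
        fin_cases k
        · simpa using h00
        · simpa using h01
        · simpa using h11
      | zero => simp
      | add y z _ _ hy hz => simp [hy, hz]
      | smul c y _ hy => simp [hy]
    · intro h
      ext z
      rw [hval, h _ (φ.II_mem z z)]
      rfl
  have h1 := LinearMap.finrank_range_add_finrank_ker ψ
  have h2 := Subspace.finrank_add_finrank_dualAnnihilator_eq φ.firstNormal
  rw [hker, Subspace.dual_finrank_eq] at h1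
  have h3 : φ.quadrics = LinearMap.range ψ := rfl
  rw [h3]
  omega

variable {φ}

/-- At a smooth point the frame of a parametrization spans the tangent space. -/
theorem span_frame (hx : IsSmoothPoint X x) :
    Submodule.span ℂ ({valueAt φ.series} ∪ Set.range (fun i => valueAt (partialDeriv i φ.series))) =
      tangentSpace X x := by
  apply Submodule.eq_of_le_of_finrank_le (φ.frame_le_tangentSpace hx.1)
  rw [hx.2]
  have h := finrank_span_eq_card φ.immersion
  rw [Fintype.card_fin] at h
  refine h.symm.le.trans ?_
  apply Submodule.finrank_mono
  rw [Submodule.span_le]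
  rintro _ ⟨k, rfl⟩
  fin_cases k
  · exact Submodule.subset_span (Or.inl rfl)
  · exact Submodule.subset_span (Or.inr ⟨0, rfl⟩)
  · exact Submodule.subset_span (Or.inr ⟨1, rfl⟩)

theorem osculatingSpace_eq (hx : IsSmoothPoint X x) :
    φ.osculatingSpace = tangentSpace X x ⊔
      Submodule.span ℂ (Set.range fun p : Fin 2 × Fin 2 => φ.second p.1 p.2) := by
  rw [osculatingSpace, Submodule.span_union, span_frame hx]
  rfl

theorem finrank_osculatingSpace (hx : IsSmoothPoint X x) :
    Module.finrank ℂ φ.osculatingSpace = 3 + Module.finrank ℂ φ.firstNormal := by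
  -- Modulo the tangent space, the osculating space is the first normal space.
  have hmap : φ.osculatingSpace.map (tangentSpace X x).mkQ = φ.firstNormal := by
    rw [osculatingSpace_eq hx, Submodule.map_sup, Submodule.map_span, ← Set.range_comp]
    have : (tangentSpace X x).map (tangentSpace X x).mkQ = ⊥ := by
      rw [← LinearMap.le_ker_iff_map, Submodule.ker_mkQ]
    rw [this, bot_sup_eq]
    apply le_antisymm
    · rw [Submodule.span_le]
      rintro _ ⟨p, rfl⟩
      exact φ.normal_mem p.1 p.2
    · rw [firstNormal, Submodule.span_le]
      rintro _ ⟨k, rfl⟩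
      apply Submodule.subset_span
      fin_cases k
      · exact ⟨(0, 0), rfl⟩
      · exact ⟨(0, 1), rfl⟩
      · exact ⟨(1, 1), rfl⟩
  have hle : tangentSpace X x ≤ φ.osculatingSpace := by
    rw [osculatingSpace_eq hx]; exact le_sup_left
  rw [← hmap, ← hx.2]
  have h := LinearMap.finrank_range_add_finrank_ker
    ((tangentSpace X x).mkQ.domRestrict φ.osculatingSpace)
  rw [LinearMap.range_domRestrict] at h
  have hk : Module.finrank ℂ (LinearMap.ker ((tangentSpace X x).mkQ.domRestrict
      φ.osculatingSpace)) = Module.finrank ℂ (tangentSpace X x) := by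
    rw [LinearMap.ker_domRestrict, Submodule.ker_mkQ]
    exact (Submodule.comapSubtypeEquivOfLe hle).finrank_eq
  rw [hk] at h
  omega

theorem dimII_eq (φ : LocalParam X x) : φ.dimII = (Module.finrank ℂ φ.firstNormal : ℤ) - 1 := by
  rw [dimII, finrank_quadrics]

theorem dimOsc_eq (hx : IsSmoothPoint X x) :
    φ.dimOsc = (Module.finrank ℂ φ.firstNormal : ℤ) + 2 := by
  rw [dimOsc, finrank_osculatingSpace hx]
  push_cast
  ring

theorem finrank_firstNormal_le (φ : LocalParam X x) : Module.finrank ℂ φ.firstNormal ≤ 3 := by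
  have := finrank_range_le_card (R := ℂ) ![φ.normal 0 0, φ.normal 0 1, φ.normal 1 1]
  rwa [Fintype.card_fin] at this

theorem osculatingSpace_eq_tangentSpace_iff (hx : IsSmoothPoint X x) :
    φ.osculatingSpace = tangentSpace X x ↔ Module.finrank ℂ φ.firstNormal = 0 := by
  have hle : tangentSpace X x ≤ φ.osculatingSpace := by
    rw [osculatingSpace_eq hx]; exact le_sup_left
  have h := finrank_osculatingSpace (φ := φ) hx
  constructor
  · intro he
    rw [he, hx.2] at h
    omega
  · intro h0
    symm
    apply Submodule.eq_of_le_of_finrank_le hle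
    rw [h, hx.2, h0]

end LocalParam

/-! ### Empty and one-point linear systems -/

/-- The points of a projective space lying in a linear subspace. -/
theorem setOf_submodule_le_eq_empty_iff {V : Type*} [AddCommGroup V] [Module ℂ V]
    (U : Submodule ℂ V) : {Q : ℙ ℂ V | Q.submodule ≤ U} = ∅ ↔ U = ⊥ := by
  rw [Set.eq_empty_iff_forall_notMem]
  constructor
  · intro h
    rw [Submodule.eq_bot_iff]
    intro v hv
    by_contra hv0
    refine h (Projectivization.mk ℂ v hv0) ?_
    rw [Set.mem_ofPred_eq, Projectivization.submodule_mk]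
    exact (Submodule.span_singleton_le_iff_mem _ _).2 hv
  · rintro rfl Q hQ
    have := hQ
    rw [Set.mem_ofPred_eq, Projectivization.submodule_eq,
      Submodule.span_singleton_le_iff_mem] at this
    exact Q.rep_nonzero this

theorem existsUnique_submodule_le_iff {V : Type*} [AddCommGroup V] [Module ℂ V]
    (U : Submodule ℂ V) :
    (∃! Q : ℙ ℂ V, Q ∈ {Q : ℙ ℂ V | Q.submodule ≤ U}) ↔ Module.finrank ℂ U = 1 := by
  have hmem : ∀ (v : V) (hv : v ≠ 0),
      Projectivization.mk ℂ v hv ∈ {Q : ℙ ℂ V | Q.submodule ≤ U} ↔ v ∈ U := by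
    intro v hv
    rw [Set.mem_ofPred_eq, Projectivization.submodule_mk, Submodule.span_singleton_le_iff_mem]
  constructor
  · rintro ⟨Q, hQ, huniq⟩
    have hrep : Q.rep ∈ U := by
      rw [← hmem _ Q.rep_nonzero, Q.mk_rep]; exact hQ
    refine finrank_eq_one_iff'.2
      ⟨⟨Q.rep, hrep⟩, fun h => Q.rep_nonzero (congrArg Subtype.val h), ?_⟩
    rintro ⟨w, hw⟩
    by_cases hw0 : w = 0
    · exact ⟨0, by ext; simp [hw0]⟩
    · have h1 := huniq (Projectivization.mk ℂ w hw0) ((hmem w hw0).2 hw)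
      rw [← Q.mk_rep] at h1
      obtain ⟨a, ha⟩ := (Projectivization.mk_eq_mk_iff' ℂ _ _ _ _).1 h1
      exact ⟨a, Subtype.ext ha⟩
  · intro h
    obtain ⟨⟨v, hv⟩, hv0, hall⟩ := finrank_eq_one_iff'.1 h
    have hv0' : v ≠ 0 := fun h => hv0 (Subtype.ext h)
    refine ⟨Projectivization.mk ℂ v hv0', (hmem v hv0').2 hv, ?_⟩
    intro Q hQ
    induction Q using Projectivization.ind with
    | h w hw =>
      obtain ⟨a, ha⟩ := hall ⟨w, (hmem w hw).1 hQ⟩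
      exact (Projectivization.mk_eq_mk_iff' ℂ _ _ _ _).2 ⟨a, congrArg Subtype.val ha⟩

namespace LocalParam

variable {X : Set (PSpace N)} {x : PSpace N} (φ : LocalParam X x)

/-! ### Conjugate directions -/

theorem conjugate_mk {u w : Fin 2 → ℂ} (hu : u ≠ 0) (hw : w ≠ 0) :
    φ.Conjugate (Projectivization.mk ℂ u hu) (Projectivization.mk ℂ w hw) ↔ φ.II u w = 0 := by
  obtain ⟨a, ha⟩ := Projectivization.exists_smul_eq_mk_rep ℂ u hu
  obtain ⟨b, hb⟩ := Projectivization.exists_smul_eq_mk_rep ℂ w hw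
  rw [Conjugate, ← ha, ← hb, Units.smul_def, Units.smul_def, map_smul, map_smul,
    LinearMap.smul_apply]
  simp

/-- `II(u, ·)` maps a plane to a space of dimension at most one, so it has a kernel. -/
theorem exists_conjugate_of_finrank_le_one (h : Module.finrank ℂ φ.firstNormal ≤ 1)
    (r : Direction) : ∃ s, φ.Conjugate r s := by
  induction r using Projectivization.ind with
  | h u hu =>
    let f : (Fin 2 → ℂ) →ₗ[ℂ] φ.firstNormal := (φ.II u).codRestrict _ fun w => φ.II_mem u w
    have h1 := LinearMap.finrank_range_add_finrank_ker f
    have h2 := Submodule.finrank_le (LinearMap.range f)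
    rw [Module.finrank_fin_fun] at h1
    have h3 : LinearMap.ker f ≠ ⊥ := by
      intro hk
      rw [hk, finrank_bot] at h1
      omega
    obtain ⟨w, hw, hw0⟩ := Submodule.exists_mem_ne_zero_of_ne_bot h3
    exact ⟨Projectivization.mk ℂ w hw0, (φ.conjugate_mk hu hw0).2 (congrArg Subtype.val hw)⟩

/-- The three normal vectors are independent, so `II(u, w) = 0` would make the symmetric product of
two nonzero vectors vanish. -/
theorem not_conjugate_of_finrank_eq_three (h : Module.finrank ℂ φ.firstNormal = 3)
    (r s : Direction) : ¬ φ.Conjugate r s := by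
  induction r using Projectivization.ind with
  | h u hu =>
    induction s using Projectivization.ind with
    | h w hw =>
      rw [conjugate_mk, II_apply]
      intro h0
      have hli : LinearIndependent ℂ ![φ.normal 0 0, φ.normal 0 1, φ.normal 1 1] := by
        rw [linearIndependent_iff_card_eq_finrank_span, Fintype.card_fin]
        exact h.symm
      have := Fintype.linearIndependent_iff.1 hli
        ![u 0 * w 0, u 0 * w 1 + u 1 * w 0, u 1 * w 1] (by simpa [Fin.sum_univ_three] using h0)
      rcases symm_product_eq_zero (this 0) (this 1) (this 2) with h | h
      · exact hu h
      · exact hw h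

/-- If the first normal space is a plane, there is exactly one linear relation between the three
values of the second fundamental form. -/
theorem exists_relation_of_finrank_eq_two (h : Module.finrank ℂ φ.firstNormal = 2) :
    ∃ p q : Fin 2 → ℂ, p ≠ 0 ∧ q ≠ 0 ∧ φ.II p q = 0 ∧
      (∀ a b c : ℂ, a • φ.normal 0 0 + b • φ.normal 0 1 + c • φ.normal 1 1 = 0 →
        ∃ t : ℂ, a = t * (p 0 * q 0) ∧ b = t * (p 0 * q 1 + p 1 * q 0) ∧ c = t * (p 1 * q 1)) ∧
      ∀ a b c : ℂ, a * (p 0 * q 0) + b * (p 0 * q 1 + p 1 * q 0) + c * (p 1 * q 1) = 0 →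
        ∃ l : Module.Dual ℂ (Vec N ⧸ tangentSpace X x), l (φ.normal 0 0) = a ∧
          l (φ.normal 0 1) = b ∧ l (φ.normal 1 1) = c := by
  set v := ![φ.normal 0 0, φ.normal 0 1, φ.normal 1 1] with hv
  let F : (Fin 3 → ℂ) →ₗ[ℂ] (Vec N ⧸ tangentSpace X x) := Fintype.linearCombination ℂ v
  have hF : ∀ a b c, F ![a, b, c] =
      a • φ.normal 0 0 + b • φ.normal 0 1 + c • φ.normal 1 1 := by
    intro a b c
    simp [F, Fintype.linearCombination_apply, Fin.sum_univ_three, hv]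
  have hrange : LinearMap.range F = φ.firstNormal := Fintype.range_linearCombination ℂ v
  have hker : Module.finrank ℂ (LinearMap.ker F) = 1 := by
    have := LinearMap.finrank_range_add_finrank_ker F
    rw [hrange, h, Module.finrank_fin_fun] at this
    omega
  -- The unique relation `k`, read as a binary quadratic form, factors as `p · q`; this says `II(p,
  -- q) = 0`.
  obtain ⟨⟨k, hk⟩, hk0, hall⟩ := finrank_eq_one_iff'.1 hker
  have hk0' : ¬ (k 0 = 0 ∧ k 1 = 0 ∧ k 2 = 0) := by
    rintro ⟨h0, h1, h2⟩
    apply hk0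
    ext i
    fin_cases i <;> assumption
  obtain ⟨p, q, hp, hq, h0, h1, h2⟩ := exists_factorization hk0'
  have hkvec : k = ![k 0, k 1, k 2] := by ext i; fin_cases i <;> rfl
  have hrel : ∀ a b c : ℂ, a • φ.normal 0 0 + b • φ.normal 0 1 + c • φ.normal 1 1 = 0 →
        ∃ t : ℂ, a = t * (p 0 * q 0) ∧ b = t * (p 0 * q 1 + p 1 * q 0) ∧
          c = t * (p 1 * q 1) := by
    intro a b c habc
    obtain ⟨t, ht⟩ := hall ⟨![a, b, c], by rw [LinearMap.mem_ker, hF, habc]⟩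
    have ht' := congrArg Subtype.val ht
    refine ⟨t, ?_, ?_, ?_⟩
    · rw [h0]; exact (congrFun ht' 0).symm
    · rw [h1]; exact (congrFun ht' 1).symm
    · rw [h2]; exact (congrFun ht' 2).symm
  refine ⟨p, q, hp, hq, ?_, hrel, ?_⟩
  · rw [II_apply, h0, h1, h2, ← hF, ← hkvec]
    exact hk
  · intro a b c habc
    let m : (Fin 3 → ℂ) →ₗ[ℂ] ℂ :=
      Fintype.linearCombination ℂ ![a, b, c]
    have hm : ∀ y, m y = y 0 * a + y 1 * b + y 2 * c := by
      intro y
      simp [m, Fintype.linearCombination_apply, Fin.sum_univ_three]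
    have hmker : LinearMap.ker F ≤ LinearMap.ker m := by
      intro y hy
      obtain ⟨t, ht⟩ := hall ⟨y, hy⟩
      have ht' : t • k = y := congrArg Subtype.val ht
      rw [LinearMap.mem_ker, ← ht', map_smul, hm, ← h0, ← h1, ← h2]
      rw [show p 0 * q 0 * a + (p 0 * q 1 + p 1 * q 0) * b + p 1 * q 1 * c = 0 by
        linear_combination habc, smul_zero]
    -- A functional on `ℂ³` killing the single relation factors through `F` and extends to the
    -- normal space. Prescribed values `a, b, c` are thus attained exactly under apolarity to `p ·
    -- q`.
    obtain ⟨l, hl⟩ : ∃ l : Module.Dual ℂ (Vec N ⧸ tangentSpace X x), l.comp F = m := by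
      have hmem : m ∈ (LinearMap.ker F).dualAnnihilator := by
        rw [Submodule.mem_dualAnnihilator]
        exact fun y hy => hmker hy
      rw [← LinearMap.range_dualMap_eq_dualAnnihilator_ker] at hmem
      obtain ⟨l, hl⟩ := hmem
      exact ⟨l, hl⟩
    have hl' : ∀ y, l (F y) = m y := fun y => LinearMap.congr_fun hl y
    refine ⟨l, ?_, ?_, ?_⟩
    · have := hl' ![1, 0, 0]; rw [hF, hm] at this; simpa using this
    · have := hl' ![0, 1, 0]; rw [hF, hm] at this; simpa using this
    · have := hl' ![0, 0, 1]; rw [hF, hm] at this; simpa using this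

/-! ### Hyperplane sections -/

theorem constantCoeff_sectionEquation (l : Module.Dual ℂ (Vec N)) :
    MvPowerSeries.coeff 0 (φ.sectionEquation l) = l (valueAt φ.series) := by
  rw [sectionEquation, map_sum, LinearMap.pi_apply_eq_sum_univ l]
  refine Finset.sum_congr rfl fun k _ => ?_
  simp [valueAt, mul_comm]
  left; congr 1; ext j; simp [Pi.single_apply, eq_comm]

theorem coeff_single_sectionEquation (l : Module.Dual ℂ (Vec N)) (i : Fin 2) :
    MvPowerSeries.coeff (Finsupp.single i 1) (φ.sectionEquation l) =
      l (valueAt (partialDeriv i φ.series)) := by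
  have h : ∀ k, valueAt (partialDeriv i φ.series) k =
      MvPowerSeries.coeff (Finsupp.single i 1) (φ.series k) := by
    intro k
    rw [valueAt, partialDeriv, ← MvPowerSeries.coeff_zero_eq_constantCoeff_apply,
      MvPowerSeries.coeff_pderiv]
    simp
  rw [sectionEquation, map_sum, LinearMap.pi_apply_eq_sum_univ l]
  refine Finset.sum_congr rfl fun k _ => ?_
  rw [h]
  simp [mul_comm]
  left; congr 1; ext j; simp [Pi.single_apply, eq_comm]

/-- The factor is 2 for `i = j` and 1 otherwise: the ratio between a second derivative at the origin
and the Taylor coefficient. -/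
theorem coeff_add_single_sectionEquation (l : Module.Dual ℂ (Vec N)) (i j : Fin 2) :
    MvPowerSeries.coeff (Finsupp.single i 1 + Finsupp.single j 1) (φ.sectionEquation l) *
      ((Finsupp.single i 1 : Fin 2 →₀ ℕ) j + 1) = l (φ.second i j) := by
  have h : ∀ k, φ.second i j k =
      MvPowerSeries.coeff (Finsupp.single i 1 + Finsupp.single j 1) (φ.series k) *
        ((Finsupp.single i 1 : Fin 2 →₀ ℕ) j + 1) := by
    intro k
    rw [second, valueAt, partialDeriv, partialDeriv,
      ← MvPowerSeries.coeff_zero_eq_constantCoeff_apply,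
      MvPowerSeries.coeff_pderiv, MvPowerSeries.coeff_pderiv]
    simp
  rw [sectionEquation, map_sum, LinearMap.pi_apply_eq_sum_univ l, Finset.sum_mul]
  refine Finset.sum_congr rfl fun k _ => ?_
  rw [h]
  simp only [map_smul, smul_eq_mul]
  rw [show (fun j => if k = j then (1 : ℂ) else 0) = Pi.single k 1 by
    ext j; simp [Pi.single_apply, eq_comm]]
  ring

end LocalParam

/-- An exponent in two variables. -/
theorem finsupp_fin_two_cases (m : Fin 2 →₀ ℕ) :
    m = 0 ∨ (∃ i, m = Finsupp.single i 1) ∨ (∃ i j, m = Finsupp.single i 1 + Finsupp.single j 1) ∨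
      3 ≤ m.degree := by
  have hdeg : m.degree = m 0 + m 1 := by
    rw [Finsupp.degree_eq_sum, Fin.sum_univ_two]
  by_cases h3 : 3 ≤ m.degree
  · exact Or.inr (Or.inr (Or.inr h3))
  have hext : ∀ m' : Fin 2 →₀ ℕ, m 0 = m' 0 → m 1 = m' 1 → m = m' := fun m' h0 h1 => by
    ext i; fin_cases i <;> assumption
  have hcases : (m 0 = 0 ∧ m 1 = 0) ∨ (m 0 = 1 ∧ m 1 = 0) ∨ (m 0 = 0 ∧ m 1 = 1) ∨
      (m 0 = 2 ∧ m 1 = 0) ∨ (m 0 = 1 ∧ m 1 = 1) ∨ (m 0 = 0 ∧ m 1 = 2) := by omega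
  rcases hcases with ⟨h0, h1⟩ | ⟨h0, h1⟩ | ⟨h0, h1⟩ | ⟨h0, h1⟩ | ⟨h0, h1⟩ | ⟨h0, h1⟩
  · exact Or.inl (hext _ (by simp [h0]) (by simp [h1]))
  · exact Or.inr (Or.inl ⟨0, hext _ (by simp [h0]) (by simp [h1])⟩)
  · exact Or.inr (Or.inl ⟨1, hext _ (by simp [h0]) (by simp [h1])⟩)
  · exact Or.inr (Or.inr (Or.inl ⟨0, 0, hext _ (by simp [h0]) (by simp [h1])⟩))
  · exact Or.inr (Or.inr (Or.inl ⟨0, 1, hext _ (by simp [h0]) (by simp [h1])⟩))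
  · exact Or.inr (Or.inr (Or.inl ⟨1, 1, hext _ (by simp [h0]) (by simp [h1])⟩))

/-- The value of the part of degree at most two of a power series in two variables. -/
theorem eval_truncTotal_three (G : MvPowerSeries (Fin 2) ℂ) (z : Fin 2 → ℂ)
    (h0 : MvPowerSeries.coeff 0 G = 0)
    (h1 : ∀ i, MvPowerSeries.coeff (Finsupp.single i 1) G = 0) :
    MvPolynomial.eval z (G.truncTotal 3) =
      MvPowerSeries.coeff (Finsupp.single 0 1 + Finsupp.single 0 1) G * z 0 ^ 2 +
      MvPowerSeries.coeff (Finsupp.single 0 1 + Finsupp.single 1 1) G * (z 0 * z 1) +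
      MvPowerSeries.coeff (Finsupp.single 1 1 + Finsupp.single 1 1) G * z 1 ^ 2 := by
  have hp : G.truncTotal 3 =
      MvPolynomial.monomial (Finsupp.single 0 1 + Finsupp.single 0 1)
        (MvPowerSeries.coeff (Finsupp.single 0 1 + Finsupp.single 0 1) G) +
      MvPolynomial.monomial (Finsupp.single 0 1 + Finsupp.single 1 1)
        (MvPowerSeries.coeff (Finsupp.single 0 1 + Finsupp.single 1 1) G) +
      MvPolynomial.monomial (Finsupp.single 1 1 + Finsupp.single 1 1)
        (MvPowerSeries.coeff (Finsupp.single 1 1 + Finsupp.single 1 1) G) := by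
    have hne : ∀ a b : Fin 2 →₀ ℕ, (a 0 ≠ b 0 ∨ a 1 ≠ b 1) → a ≠ b := by
      rintro a b h rfl
      simp at h
    ext m
    simp only [MvPolynomial.coeff_add, MvPolynomial.coeff_monomial]
    rcases finsupp_fin_two_cases m with rfl | ⟨i, rfl⟩ | ⟨i, j, hm⟩ | h3
    · rw [MvPowerSeries.coeff_truncTotal _ (by simp), h0, if_neg (hne _ _ (by simp)),
        if_neg (hne _ _ (by simp)), if_neg (hne _ _ (by simp))]
      simp
    · rw [MvPowerSeries.coeff_truncTotal _ (by simp), h1]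
      fin_cases i <;>
      · rw [if_neg (hne _ _ (by simp)), if_neg (hne _ _ (by simp)), if_neg (hne _ _ (by simp))]
        simp
    · have hm' : m = Finsupp.single 0 1 + Finsupp.single 0 1 ∨
          m = Finsupp.single 0 1 + Finsupp.single 1 1 ∨
          m = Finsupp.single 1 1 + Finsupp.single 1 1 := by
        rw [hm]
        fin_cases i <;> fin_cases j
        · exact Or.inl rfl
        · exact Or.inr (Or.inl rfl)
        · exact Or.inr (Or.inl (add_comm _ _))
        · exact Or.inr (Or.inr rfl)
      rw [MvPowerSeries.coeff_truncTotal _ (by simp [hm, map_add])]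
      rcases hm' with rfl | rfl | rfl
      · rw [if_pos rfl, if_neg (hne _ _ (by simp)), if_neg (hne _ _ (by simp)), add_zero, add_zero]
      · rw [if_pos rfl, if_neg (hne _ _ (by simp)), if_neg (hne _ _ (by simp)), zero_add, add_zero]
      · rw [if_pos rfl, if_neg (hne _ _ (by simp)), if_neg (hne _ _ (by simp)), zero_add, zero_add]
    · have hne' : ∀ i j : Fin 2, Finsupp.single i 1 + Finsupp.single j 1 ≠ m := by
        rintro i j rfl
        simp [map_add] at h3
      rw [MvPowerSeries.coeff_truncTotal_eq_zero _ h3, if_neg (hne' _ _), if_neg (hne' _ _),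
        if_neg (hne' _ _)]
      simp
  rw [hp]
  simp only [map_add, MvPolynomial.eval_monomial]
  have hprod : ∀ i j : Fin 2, ((Finsupp.single i 1 + Finsupp.single j 1 : Fin 2 →₀ ℕ).prod
      fun a b => z a ^ b) = z i * z j := by
    intro i j
    rw [Finsupp.prod_add_index' (by simp) (by intro a b c; rw [pow_add])]
    simp
  rw [hprod, hprod, hprod]
  ring

namespace LocalParam

variable {X : Set (PSpace N)} {x : PSpace N} {φ : LocalParam X x}

/-- At a smooth point the position vector and the first derivatives span the tangent space, so
containing it amounts to the vanishing of the terms of degree below 2. -/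
theorem hasDoublePoint_iff (hx : IsSmoothPoint X x) (l : Module.Dual ℂ (Vec N)) :
    φ.HasDoublePoint l ↔ (∀ w ∈ tangentSpace X x, l w = 0) ∧
      ¬ (l (φ.second 0 0) = 0 ∧ l (φ.second 0 1) = 0 ∧ l (φ.second 1 1) = 0) := by
  have hT : (∀ w ∈ tangentSpace X x, l w = 0) ↔ l (valueAt φ.series) = 0 ∧
      ∀ i, l (valueAt (partialDeriv i φ.series)) = 0 := by
    rw [← span_frame (φ := φ) hx]
    constructor
    · exact fun h => ⟨h _ (Submodule.subset_span (Or.inl rfl)),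
        fun i => h _ (Submodule.subset_span (Or.inr ⟨i, rfl⟩))⟩
    · rintro ⟨h0, h1⟩ w hw
      induction hw using Submodule.span_induction with
      | mem y hy =>
        rcases hy with rfl | ⟨i, rfl⟩
        · exact h0
        · exact h1 i
      | zero => simp
      | add y z _ _ hy hz => simp [hy, hz]
      | smul c y _ hy => simp [hy]
  have h2 : ∀ i j, MvPowerSeries.coeff (Finsupp.single i 1 + Finsupp.single j 1)
      (φ.sectionEquation l) = 0 ↔ l (φ.second i j) = 0 := by
    intro i j
    rw [← coeff_add_single_sectionEquation]
    rw [mul_eq_zero, or_iff_left (Nat.cast_add_one_ne_zero _)]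
  have hord := MvPowerSeries.order_eq_nat (f := φ.sectionEquation l) (n := 2)
  rw [HasDoublePoint, hT]
  rw [show ((2 : ℕ∞)) = ((2 : ℕ) : ℕ∞) from rfl, hord]
  constructor
  · rintro ⟨⟨d, hd, hd2⟩, hlow⟩
    refine ⟨⟨?_, fun i => ?_⟩, ?_⟩
    · rw [← constantCoeff_sectionEquation]
      exact hlow _ (by simp)
    · rw [← coeff_single_sectionEquation]
      exact hlow _ (by simp)
    · rintro ⟨h00, h01, h11⟩
      apply hd
      rcases finsupp_fin_two_cases d with rfl | ⟨i, rfl⟩ | ⟨i, j, rfl⟩ | h3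
      · simp at hd2
      · simp at hd2
      · rw [h2]
        fin_cases i <;> fin_cases j
        · exact h00
        · exact h01
        · exact (congrArg l (φ.second_comm 1 0)).trans h01
        · exact h11
      · omega
  · rintro ⟨⟨h0, h1⟩, hne⟩
    refine ⟨?_, fun d hd => ?_⟩
    · by_contra! hall
      apply hne
      refine ⟨?_, ?_, ?_⟩ <;>
      · rw [← h2]
        by_contra hc
        exact hall _ hc (by simp [map_add])
    · rcases finsupp_fin_two_cases d with rfl | ⟨i, rfl⟩ | ⟨i, j, rfl⟩ | h3
      · rw [constantCoeff_sectionEquation]; exact h0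
      · rw [coeff_single_sectionEquation]; exact h1 i
      · simp [map_add] at hd
      · omega

theorem mk_mem_tangentDirections {l : Module.Dual ℂ (Vec N)}
    (hl : l (valueAt φ.series) = 0) (hl' : ∀ i, l (valueAt (partialDeriv i φ.series)) = 0)
    (z : Fin 2 → ℂ) (hz : z ≠ 0) :
    (Projectivization.mk ℂ z hz : Direction) ∈ φ.tangentDirections l ↔
      l (φ.second 0 0) * z 0 ^ 2 + 2 * l (φ.second 0 1) * (z 0 * z 1) +
        l (φ.second 1 1) * z 1 ^ 2 = 0 := by
  obtain ⟨a, ha⟩ := Projectivization.exists_smul_eq_mk_rep ℂ z hz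
  rw [tangentDirections, Set.mem_ofPred_eq, eval_truncTotal_three _ _
    (by rw [constantCoeff_sectionEquation, hl])
    (fun i => by rw [coeff_single_sectionEquation, hl']), ← ha,
    ← coeff_add_single_sectionEquation, ← coeff_add_single_sectionEquation,
    ← coeff_add_single_sectionEquation]
  -- The quadratic part of the equation is half the form in the second derivatives, and the
  -- representative is `a • z`; this explains the factors `2` and `a ^ 2`.
  have ha0 : (a : ℂ) ≠ 0 := a.ne_zero
  simp only [Units.smul_def, Pi.smul_apply, smul_eq_mul]
  simp
  constructor
  · intro h
    have h' : (a : ℂ) ^ 2 ≠ 0 := pow_ne_zero 2 ha0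
    refine (mul_eq_zero.1 (show (a : ℂ) ^ 2 * _ = 0 from ?_)).resolve_left h'
    linear_combination 2 * h
  · intro h
    linear_combination (a : ℂ) ^ 2 / 2 * h

/-- Tangent pairs in terms of the second fundamental form. -/
theorem isTangentPair_iff (hx : IsSmoothPoint X x) (r s : Direction) :
    φ.IsTangentPair r s ↔ ∃ l : Module.Dual ℂ (Vec N ⧸ tangentSpace X x),
      ¬ (l (φ.normal 0 0) = 0 ∧ l (φ.normal 0 1) = 0 ∧ l (φ.normal 1 1) = 0) ∧
      ∀ (z : Fin 2 → ℂ) (hz : z ≠ 0),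
        (l (φ.normal 0 0) * z 0 ^ 2 + 2 * l (φ.normal 0 1) * (z 0 * z 1) +
          l (φ.normal 1 1) * z 1 ^ 2 = 0 ↔
        Projectivization.mk ℂ z hz = r ∨ Projectivization.mk ℂ z hz = s) := by
  have hframe : ∀ l : Module.Dual ℂ (Vec N), (∀ w ∈ tangentSpace X x, l w = 0) →
      l (valueAt φ.series) = 0 ∧ ∀ i, l (valueAt (partialDeriv i φ.series)) = 0 := by
    intro l hl
    exact ⟨hl _ (φ.frame_le_tangentSpace hx.1 (Submodule.subset_span (Or.inl rfl))),
      fun i => hl _ (φ.frame_le_tangentSpace hx.1 (Submodule.subset_span (Or.inr ⟨i, rfl⟩)))⟩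
  constructor
  · rintro ⟨l, hd, ht⟩
    rw [hasDoublePoint_iff hx] at hd
    obtain ⟨h0, h1⟩ := hframe l hd.1
    refine ⟨(tangentSpace X x).liftQ l fun w hw => hd.1 w hw, hd.2, fun z hz => ?_⟩
    have := mk_mem_tangentDirections h0 h1 z hz
    rw [ht] at this
    exact this.symm
  · rintro ⟨l, hne, hz⟩
    have hl : ∀ w ∈ tangentSpace X x, (l.comp (tangentSpace X x).mkQ) w = 0 := by
      intro w hw
      rw [LinearMap.comp_apply, Submodule.mkQ_apply, (Submodule.Quotient.mk_eq_zero _).2 hw,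
        map_zero]
    obtain ⟨h0, h1⟩ := hframe _ hl
    refine ⟨l.comp (tangentSpace X x).mkQ, (hasDoublePoint_iff hx _).2 ⟨hl, hne⟩, ?_⟩
    ext t
    induction t using Projectivization.ind with
    | h z hz' =>
      rw [mk_mem_tangentDirections h0 h1 z hz']
      exact hz z hz'

/-- The tangent pairs are the pairs harmonic to the conjugate pair. -/
theorem isTangentPair_mk_iff (hx : IsSmoothPoint X x) {p q : Fin 2 → ℂ} (hII : φ.II p q = 0)
    (hl : ∀ a b c : ℂ, a * (p 0 * q 0) + b * (p 0 * q 1 + p 1 * q 0) + c * (p 1 * q 1) = 0 →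
        ∃ l : Module.Dual ℂ (Vec N ⧸ tangentSpace X x), l (φ.normal 0 0) = a ∧
          l (φ.normal 0 1) = b ∧ l (φ.normal 1 1) = c) {u s : Fin 2 → ℂ} (hu : u ≠ 0)
    (hs : s ≠ 0) :
    φ.IsTangentPair (Projectivization.mk ℂ u hu) (Projectivization.mk ℂ s hs) ↔
      det2 p u * det2 q s + det2 q u * det2 p s = 0 := by
  rw [isTangentPair_iff hx]
  constructor
  · rintro ⟨l, hne, hz⟩
    -- The form is `det2 z u * det2 z s'`. Applying `l` to `II(p, q) = 0` turns it into the
    -- harmonicity of `u, s'` with respect to `p, q`.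
    obtain ⟨s', hs', ha, hb, hc⟩ := exists_factor_of_zero hne hu ((hz u hu).2 (Or.inl rfl))
    have hrel := congrArg l hII
    rw [II_apply] at hrel
    simp only [map_add, map_smul, smul_eq_mul, map_zero] at hrel
    have key : det2 p u * det2 q s' + det2 q u * det2 p s' = 0 := by
      simp only [det2]
      rw [ha, hc] at hrel
      linear_combination 2 * hrel - (p 0 * q 1 + p 1 * q 0) * hb
    have hquad : ∀ z : Fin 2 → ℂ, l (φ.normal 0 0) * z 0 ^ 2 + 2 * l (φ.normal 0 1) * (z 0 * z 1) +
          l (φ.normal 1 1) * z 1 ^ 2 = det2 z u * det2 z s' := by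
      intro z
      rw [hb, ha, hc]
      simp only [det2]
      ring
    have hzz : ∀ z : Fin 2 → ℂ, det2 z z = 0 := fun z => by simp [det2]; ring
    have hs1 := (hz s' hs').1 (by rw [hquad, hzz, mul_zero])
    have hs2 := (hz s hs).2 (Or.inr rfl)
    rw [hquad] at hs2
    rw [mk_eq_mk_iff_det2, mk_eq_mk_iff_det2] at hs1
    -- The second root `s'` is `u` or `s`. In the former case `u` is a double root, and then `s`,
    -- being a root, coincides with it as well.
    have hss : det2 s s' = 0 := by
      rcases hs1 with h | h
      · obtain ⟨c, rfl⟩ := (Projectivization.mk_eq_mk_iff' ℂ s' u hs' hu).1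
          ((mk_eq_mk_iff_det2 hs' hu).2 h)
        have h2 : det2 s (c • u) = c * det2 s u := by simp [det2]; ring
        rw [h2] at hs2 ⊢
        have : det2 s u = 0 ∨ c = 0 ∨ det2 s u = 0 := by simpa using hs2
        rcases this with h | h | h <;> simp [h]
      · simp only [det2] at h ⊢; linear_combination -h
    obtain ⟨c, rfl⟩ := (Projectivization.mk_eq_mk_iff' ℂ s s' hs hs').1
      ((mk_eq_mk_iff_det2 hs hs').2 hss)
    have h3 : ∀ w, det2 w (c • s') = c * det2 w s' := fun w => by simp [det2]; ring
    rw [h3, h3]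
    linear_combination c * key
  · intro h
    -- Coefficients of `det2 z u * det2 z s`; the middle one is halved because the quadratic form
    -- contains `2 * l (φ.normal 0 1)`.
    obtain ⟨l, ha, hb, hc⟩ := hl (u 1 * s 1) (-(u 0 * s 1 + u 1 * s 0) / 2) (u 0 * s 0) (by
      simp only [det2] at h
      linear_combination h / 2)
    refine ⟨l, ?_, fun z hz => ?_⟩
    · rw [ha, hb, hc]
      rintro ⟨h1, h2, h3⟩
      rcases symm_product_eq_zero h3 (by linear_combination -2 * h2) h1 with h | h
      · exact hu h
      · exact hs h
    · rw [mk_eq_mk_iff_det2, mk_eq_mk_iff_det2, ← mul_eq_zero, ha, hb, hc]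
      simp only [det2]
      constructor <;> intro h <;> linear_combination h

/-- The conjugate pair and the involution of tangents when the first normal space is a plane. -/
theorem pencil_of_finrank_eq_two (hx : IsSmoothPoint X x)
    (h : Module.finrank ℂ φ.firstNormal = 2) :
    ((∃ p q, p ≠ q ∧
        (∀ r s, φ.Conjugate r s ↔ (r = p ∧ s = q) ∨ (r = q ∧ s = p)) ∧
        ∃ σ, IsProjectiveInvolution σ ∧
          (∀ r s, φ.IsTangentPair r s ↔ σ r = s) ∧
          (∀ r, σ r = r ↔ r = p ∨ r = q)) ∨
      (∃ p, (∀ r s, φ.Conjugate r s ↔ r = p ∧ s = p) ∧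
        (∀ r s, φ.IsTangentPair r s ↔ r = p ∨ s = p))) ∧
    (∀ r, (∃ s, φ.Conjugate r s) ↔ φ.IsTangentPair r r) := by
  obtain ⟨p, q, hp, hq, hII, hrel, hl⟩ := φ.exists_relation_of_finrank_eq_two h
  have hconj : ∀ r s, φ.Conjugate r s ↔
      (r = Projectivization.mk ℂ p hp ∧ s = Projectivization.mk ℂ q hq) ∨
        (r = Projectivization.mk ℂ q hq ∧ s = Projectivization.mk ℂ p hp) := by
    intro r s
    induction r using Projectivization.ind with
    | h u hu =>
    induction s using Projectivization.ind with
    | h w hw =>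
      rw [conjugate_mk]
      simp only [mk_eq_mk_iff_det2]
      rw [← factorization_unique hu hw hp hq, II_apply]
      constructor
      · exact hrel _ _ _
      · rintro ⟨t, h0, h1, h2⟩
        rw [II_apply] at hII
        rw [h0, h1, h2, mul_smul t, mul_smul t, mul_smul t, ← smul_add, ← smul_add, hII, smul_zero]
  have hself : ∀ r, (∃ s, φ.Conjugate r s) ↔
      r = Projectivization.mk ℂ p hp ∨ r = Projectivization.mk ℂ q hq := by
    intro r
    constructor
    · rintro ⟨s, hs⟩
      rcases (hconj r s).1 hs with h | h
      · exact Or.inl h.1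
      · exact Or.inr h.1
    · rintro (h | h)
      · exact ⟨_, (hconj _ _).2 (Or.inl ⟨h, rfl⟩)⟩
      · exact ⟨_, (hconj _ _).2 (Or.inr ⟨h, rfl⟩)⟩
  refine ⟨?_, fun r => ?_⟩
  -- For proportional `p` and `q` harmonicity degenerates to `det2 p u * det2 p s = 0`.
  · by_cases hpq : det2 p q = 0
    · right
      have hpq' := (mk_eq_mk_iff_det2 hp hq).2 hpq
      refine ⟨Projectivization.mk ℂ p hp, fun r s => ?_, fun r s => ?_⟩
      · rw [hconj, ← hpq', or_self]
      · induction r using Projectivization.ind with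
        | h u hu =>
        induction s using Projectivization.ind with
        | h s hs =>
          rw [isTangentPair_mk_iff hx hII hl, mk_eq_mk_iff_det2, mk_eq_mk_iff_det2]
          obtain ⟨c, rfl⟩ := (Projectivization.mk_eq_mk_iff' ℂ p q hp hq).1 hpq'
          have hc : c ≠ 0 := by rintro rfl; simp at hp
          rw [← mul_eq_zero]
          simp only [det2, Pi.smul_apply, smul_eq_mul]
          constructor
          · intro h
            refine (mul_eq_zero.1 (show (2 : ℂ) * _ = 0 from ?_)).resolve_left two_ne_zero
            linear_combination c * h
          · intro h
            refine (mul_eq_zero.1 (show c * _ = 0 from ?_)).resolve_left hc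
            linear_combination 2 * h
    · left
      refine ⟨Projectivization.mk ℂ p hp, Projectivization.mk ℂ q hq,
        fun h => hpq ((mk_eq_mk_iff_det2 hp hq).1 h), hconj, ?_⟩
      -- By Cramer's rule this is the reflection fixing `p` and negating `q`, which exchanges the
      -- members of each harmonic pair.
      let g : (Fin 2 → ℂ) →ₗ[ℂ] (Fin 2 → ℂ) :=
        { toFun := fun z => (det2 p q)⁻¹ • (det2 z q • p - det2 p z • q)
          map_add' := by
            intro z w; ext i; simp [det2]; ring
          map_smul' := by
            intro c z; ext i; simp [det2]; ring }
      have hg : ∀ z i, g z i = (det2 p q)⁻¹ * (det2 z q * p i - det2 p z * q i) := fun z i => rfl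
      have hgg : ∀ z, g (g z) = z := by
        intro z
        have hz : ∀ i, det2 p q * z i = det2 z q * p i + det2 p z * q i := by
          intro i
          fin_cases i <;> · simp [det2]; ring
        have e1 : det2 (g z) q = det2 z q := by
          have : det2 (g z) q = (det2 p q)⁻¹ * (det2 z q * det2 p q) := by
            rw [det2, hg, hg]; simp only [det2]; ring
          rw [this]; field_simp
        have e2 : det2 p (g z) = -det2 p z := by
          have : det2 p (g z) = (det2 p q)⁻¹ * (-det2 p z * det2 p q) := by
            rw [det2, hg, hg]; simp only [det2]; ring
          rw [this]; field_simp
        ext i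
        rw [hg, e1, e2, neg_mul, sub_neg_eq_add, ← hz, inv_mul_cancel_left₀ hpq]
      let e : (Fin 2 → ℂ) ≃ₗ[ℂ] (Fin 2 → ℂ) :=
        LinearEquiv.ofLinearMap g g (LinearMap.ext hgg) (LinearMap.ext hgg)
      have hmk : ∀ (z : Fin 2 → ℂ) (hz : z ≠ 0),
          Projectivization.map e.toLinearMap e.injective (Projectivization.mk ℂ z hz) =
            Projectivization.mk ℂ (g z) (fun h => hz (e.map_eq_zero_iff.1 h)) := fun z hz => rfl
      have htp : ∀ r s, φ.IsTangentPair r s ↔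
          Projectivization.map e.toLinearMap e.injective r = s := by
        intro r s
        induction r using Projectivization.ind with
        | h u hu =>
        induction s using Projectivization.ind with
        | h s hs =>
          rw [isTangentPair_mk_iff hx hII hl, hmk, mk_eq_mk_iff_det2]
          have : det2 (g u) s =
              -((det2 p q)⁻¹ * (det2 p u * det2 q s + det2 q u * det2 p s)) := by
            rw [det2, hg, hg]; simp only [det2]; ring
          rw [this]
          simp [hpq]
      have hfix : ∀ r, Projectivization.map e.toLinearMap e.injective r = r ↔
          r = Projectivization.mk ℂ p hp ∨ r = Projectivization.mk ℂ q hq := by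
        intro r
        rw [← htp]
        induction r using Projectivization.ind with
        | h u hu =>
          rw [isTangentPair_mk_iff hx hII hl, mk_eq_mk_iff_det2, mk_eq_mk_iff_det2, ← mul_eq_zero]
          simp only [det2]
          constructor
          · intro h; linear_combination h / 2
          · intro h; linear_combination 2 * h
      refine ⟨_, ⟨⟨e, rfl⟩, ?_, ?_⟩, htp, hfix⟩
      · intro hid
        -- The direction of `p + q` is neither that of `p` nor that of `q`, so it is not fixed.
        have hpq0 : p + q ≠ 0 := by
          intro h
          apply hpq
          have : p = -q := eq_neg_of_add_eq_zero_left h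
          rw [this]; simp [det2]; ring
        have := (hfix (Projectivization.mk ℂ (p + q) hpq0)).1 (congrFun hid _)
        rw [mk_eq_mk_iff_det2, mk_eq_mk_iff_det2] at this
        apply hpq
        simp only [det2, Pi.add_apply] at this ⊢
        rcases this with h | h
        · linear_combination -h
        · linear_combination h
      · intro r
        induction r using Projectivization.ind with
        | h u hu =>
          rw [hmk, hmk]
          congr 1
          exact hgg u
  · rw [hself]
    induction r using Projectivization.ind with
    | h u hu =>
      rw [isTangentPair_mk_iff hx hII hl, mk_eq_mk_iff_det2, mk_eq_mk_iff_det2, ← mul_eq_zero]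
      simp only [det2]
      constructor
      · intro h; linear_combination 2 * h
      · intro h; linear_combination h / 2

end LocalParam

/-! ### Frames of polynomial vector fields on a surface -/

section Frame

variable {X : Set (PSpace N)}

theorem exists_euler_derivation [(idealOf X).IsPrime] :
    ∃ E : Derivation ℂ (FunctionField (idealOf X)) (FunctionField (idealOf X)),
      ap E (genericPoint (idealOf X)) = genericPoint (idealOf X) := by
  obtain ⟨E, hE⟩ := exists_derivation (genericPoint (idealOf X)) fun f hf => by
    have h := toFF_eq_zero.2 (euler_mem hf)
    rw [derivation_apply, map_sum] at h
    simpa [euler_X, genericPoint] using h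
  exact ⟨E, funext hE⟩

theorem tangentMap_injective {n : ℕ} (I : Ideal (MvPolynomial (Fin n) ℂ)) [I.IsPrime] :
    Function.Injective (tangentMap (genericPoint I)) :=
  fun _ _ h => derivation_ext fun k => congrFun h k

theorem finrank_derivation_of_surface (hX : IsProjectiveSurface X) [(idealOf X).IsPrime] :
    Module.finrank (FunctionField (idealOf X))
      (Derivation ℂ (FunctionField (idealOf X)) (FunctionField (idealOf X))) = 3 := by
  obtain ⟨x, hx⟩ := exists_isTranscendenceBasis_of_ringKrullDim (m := 3)
    (R := MvPolynomial (Fin (N + 1)) ℂ ⧸ idealOf X) (L := FunctionField (idealOf X))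
    (by exact_mod_cast hX.dim)
  exact (finrank_derivation hx).1

/-- A frame of polynomial vector fields tangent to the cone over a surface, the last of which is
the Euler field. -/
structure Frame (I : Ideal (MvPolynomial (Fin (N + 1)) ℂ)) [I.IsPrime] where
  C : Fin 3 → Derivation ℂ (FunctionField I) (FunctionField I)
  D : Fin 3 → Derivation ℂ (MvPolynomial (Fin (N + 1)) ℂ) (MvPolynomial (Fin (N + 1)) ℂ)
  linearIndependent : LinearIndependent (FunctionField I) C
  comp : ∀ i f, toFF I (D i f) = C i (toFF I f)
  euler : D 2 = euler (N + 1)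

/-- If `E` were zero, the generic point would vanish, and then every derivation would vanish,
against dimension 3. -/
theorem derivation_ne_zero (hX : IsProjectiveSurface X) [(idealOf X).IsPrime]
    {E : Derivation ℂ (FunctionField (idealOf X)) (FunctionField (idealOf X))}
    (hE : ap E (genericPoint (idealOf X)) = genericPoint (idealOf X)) : E ≠ 0 := by
  rintro rfl
  have h0 : ∀ k, genericPoint (idealOf X) k = 0 := fun k => (congrFun hE k).symm
  have hsub : ∀ C : Derivation ℂ (FunctionField (idealOf X)) (FunctionField (idealOf X)), C = 0 :=
    fun C => derivation_ext fun k => by rw [h0, map_zero, map_zero]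
  have : Subsingleton (Derivation ℂ (FunctionField (idealOf X)) (FunctionField (idealOf X))) :=
    ⟨fun a b => by rw [hsub a, hsub b]⟩
  have h3 := finrank_derivation_of_surface hX
  rw [Module.finrank_zero_of_subsingleton] at h3
  omega

/-- Every direction different from the Euler field is, up to a factor, part of a frame. -/
theorem exists_frame_of_notMem (hX : IsProjectiveSurface X) [(idealOf X).IsPrime]
    {E A : Derivation ℂ (FunctionField (idealOf X)) (FunctionField (idealOf X))}
    (hE : ap E (genericPoint (idealOf X)) = genericPoint (idealOf X))
    (hA : A ∉ Submodule.span (FunctionField (idealOf X)) {E}) :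
    ∃ F : Frame (idealOf X), ∃ h : FunctionField (idealOf X), h ≠ 0 ∧ F.C 1 = h • A := by
  set L := FunctionField (idealOf X) with hL
  have hE0 := derivation_ne_zero hX hE
  have h3 := finrank_derivation_of_surface hX
  have hfin : Module.Finite L (Derivation ℂ L L) :=
    Module.finite_of_finrank_pos (by rw [h3]; norm_num)
  -- `A` and `E` are completed to a basis; rescaling `B` and `A` by their denominators makes them
  -- polynomial, while `E` is already the Euler field.
  obtain ⟨B, hB⟩ : ∃ B, B ∉ Submodule.span L (Set.range ![A, E]) := by
    by_contra! hall
    have htop : Submodule.span L (Set.range ![A, E]) = ⊤ := Submodule.eq_top_iff'.2 hall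
    have := finrank_range_le_card (R := L) ![A, E]
    rw [Set.finrank, htop, finrank_top, h3, Fintype.card_fin] at this
    omega
  have hli : LinearIndependent L ![B, A, E] := by
    refine linearIndependent_finCons.2 ⟨linearIndependent_finCons.2
      ⟨linearIndependent_finCons.2 ⟨linearIndependent_empty_type, ?_⟩, ?_⟩, hB⟩
    · simpa using hE0
    · rwa [Matrix.range_cons, Matrix.range_empty, Set.union_empty]
  obtain ⟨h₀, hh₀, D₀, hD₀⟩ := exists_polynomial_derivation B
  obtain ⟨h₁, hh₁, D₁, hD₁⟩ := exists_polynomial_derivation A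
  have hn₀ : toFF (idealOf X) h₀ ≠ 0 := fun h => hh₀ (toFF_eq_zero.1 h)
  have hn₁ : toFF (idealOf X) h₁ ≠ 0 := fun h => hh₁ (toFF_eq_zero.1 h)
  refine ⟨⟨![toFF (idealOf X) h₀ • B, toFF (idealOf X) h₁ • A, E], ![D₀, D₁, euler (N + 1)], ?_, ?_,
    rfl⟩, toFF (idealOf X) h₁, hn₁, rfl⟩
  · have := hli.units_smul ![Units.mk0 _ hn₀, Units.mk0 _ hn₁, 1]
    convert this using 1
    ext i : 1
    fin_cases i
    · rfl
    · rfl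
    · exact (one_smul (FunctionField (idealOf X)) E).symm
  · intro i f
    fin_cases i
    · exact hD₀ f
    · exact hD₁ f
    · change toFF (idealOf X) (euler (N + 1) f) = E (toFF (idealOf X) f)
      induction f using MvPolynomial.induction_on with
      | C a =>
        rw [← MvPolynomial.algebraMap_eq, Derivation.map_algebraMap, AlgHom.commutes,
          Derivation.map_algebraMap, map_zero]
      | add f g hf hg => simp only [map_add, hf, hg]
      | mul_X f i hf =>
        have hEi : E (toFF (idealOf X) (MvPolynomial.X i)) =
          toFF (idealOf X) (MvPolynomial.X i) := congrFun hE i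
        rw [Derivation.leibniz, map_mul, Derivation.leibniz, map_add, euler_X, hEi,
          smul_eq_mul, smul_eq_mul, map_mul, map_mul, hf, smul_eq_mul, smul_eq_mul]

theorem exists_frame (hX : IsProjectiveSurface X) [(idealOf X).IsPrime] :
    Nonempty (Frame (idealOf X)) := by
  obtain ⟨E, hE⟩ := exists_euler_derivation (X := X)
  have h3 := finrank_derivation_of_surface hX
  obtain ⟨A, hA⟩ : ∃ A, A ∉ Submodule.span (FunctionField (idealOf X)) {E} := by
    by_contra! hall
    have htop : Submodule.span (FunctionField (idealOf X)) {E} = ⊤ :=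
      Submodule.eq_top_iff'.2 hall
    have := finrank_span_singleton (K := FunctionField (idealOf X)) (derivation_ne_zero hX hE)
    rw [htop, finrank_top, h3] at this
    omega
  obtain ⟨F, -⟩ := exists_frame_of_notMem hX hE hA
  exact ⟨F⟩

namespace Frame

variable {I : Ideal (MvPolynomial (Fin (N + 1)) ℂ)} [I.IsPrime] (F : Frame I)

theorem mem {f : MvPolynomial (Fin (N + 1)) ℂ} (hf : f ∈ I) (i : Fin 3) : F.D i f ∈ I := by
  rw [← toFF_eq_zero, F.comp, toFF_eq_zero.2 hf, map_zero]

theorem iterate_mem {f : MvPolynomial (Fin (N + 1)) ℂ} (hf : f ∈ I) (i : Fin 3) (k : ℕ) :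
    (F.D i : MvPolynomial (Fin (N + 1)) ℂ →ₗ[ℂ] MvPolynomial (Fin (N + 1)) ℂ)^[k] f ∈ I := by
  induction k with
  | zero => exact hf
  | succ k ih =>
    rw [Function.iterate_succ_apply']
    exact F.mem ih i

/-- The vector fields of the frame. -/
def field (i : Fin 3) (k : Fin (N + 1)) : MvPolynomial (Fin (N + 1)) ℂ :=
  F.D i (MvPolynomial.X k)

/-- The derivatives of the vector fields of the frame. -/
def fieldDeriv (p : Fin 3 × Fin 3) (k : Fin (N + 1)) : MvPolynomial (Fin (N + 1)) ℂ :=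
  F.D p.1 (F.D p.2 (MvPolynomial.X k))

theorem field_two (k : Fin (N + 1)) : F.field 2 k = MvPolynomial.X k := by
  rw [field, F.euler, euler_X]

theorem toFF_field (i : Fin 3) :
    (fun k => toFF I (F.field i k)) = ap (F.C i) (genericPoint I) :=
  funext fun k => F.comp i (MvPolynomial.X k)

theorem toFF_fieldDeriv (p : Fin 3 × Fin 3) :
    (fun k => toFF I (F.fieldDeriv p k)) = ap (F.C p.1) (ap (F.C p.2) (genericPoint I)) :=
  funext fun k => by rw [fieldDeriv, F.comp, F.comp]; rfl

theorem span_C (h3 : Module.finrank (FunctionField I)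
      (Derivation ℂ (FunctionField I) (FunctionField I)) = 3) :
    Submodule.span (FunctionField I) (Set.range F.C) = ⊤ := by
  have hfin : Module.Finite (FunctionField I)
      (Derivation ℂ (FunctionField I) (FunctionField I)) :=
    Module.finite_of_finrank_pos (by rw [h3]; norm_num)
  apply Submodule.eq_top_of_finrank_eq
  rw [finrank_span_eq_card F.linearIndependent, h3, Fintype.card_fin]

theorem linearIndependent_field :
    LinearIndependent (FunctionField I) fun i k => toFF I (F.field i k) := by
  have h := F.linearIndependent.map' (tangentMap (genericPoint I))
    (LinearMap.ker_eq_bot.2 (tangentMap_injective I))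
  have e : (fun i k => toFF I (F.field i k)) = tangentMap (genericPoint I) ∘ F.C :=
    funext fun i => F.toFF_field i
  rwa [e]

theorem span_field (h3 : Module.finrank (FunctionField I)
      (Derivation ℂ (FunctionField I) (FunctionField I)) = 3) :
    Submodule.span (FunctionField I) (Set.range fun i k => toFF I (F.field i k)) =
      movingTangent (genericPoint I) := by
  rw [movingTangent, LinearMap.range_eq_map, ← F.span_C h3, Submodule.map_span, ← Set.range_comp]
  congr 2
  exact funext fun i => F.toFF_field i

/-- Nine second derivatives suffice: replacing frame fields by combinations with function
coefficients adds, by the Leibniz rule, only tangent vectors. -/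
theorem span_osc (h3 : Module.finrank (FunctionField I)
      (Derivation ℂ (FunctionField I) (FunctionField I)) = 3) :
    Submodule.span (FunctionField I)
      (Set.range fun a k => toFF I (Sum.elim F.field F.fieldDeriv a k)) =
      movingOsc (genericPoint I) := by
  apply le_antisymm
  · rw [Submodule.span_le]
    rintro _ ⟨a | p, rfl⟩
    · simp only [Sum.elim_inl, SetLike.mem_coe, F.toFF_field]
      exact movingTangent_le_movingOsc (ap_mem_movingTangent _)
    · simp only [Sum.elim_inr, SetLike.mem_coe, F.toFF_fieldDeriv]
      exact ap_ap_mem_movingOsc _ _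
  · have h1 : movingTangent (genericPoint I) ≤ Submodule.span (FunctionField I)
        (Set.range fun a k => toFF I (Sum.elim F.field F.fieldDeriv a k)) := by
      rw [← F.span_field h3]
      refine Submodule.span_mono ?_
      rintro _ ⟨i, rfl⟩
      exact ⟨Sum.inl i, rfl⟩
    refine sup_le h1 (Submodule.span_le.2 ?_)
    rintro _ ⟨⟨A, B⟩, rfl⟩
    have hmem : ∀ C, C ∈ Submodule.span (FunctionField I) (Set.range F.C) := fun C => by
      rw [F.span_C h3]; trivial
    obtain ⟨a, rfl⟩ := (Submodule.mem_span_range_iff_exists_fun _).1 (hmem A)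
    obtain ⟨b, rfl⟩ := (Submodule.mem_span_range_iff_exists_fun _).1 (hmem B)
    have hsum : ∀ (c : Fin 3 → FunctionField I) (u : Fin (N + 1) → FunctionField I),
        ap (∑ i, c i • F.C i) u = ∑ i, c i • ap (F.C i) u := by
      intro c u
      simp only [Fin.sum_univ_three, add_ap, smul_ap]
    simp only [SetLike.mem_coe]
    rw [hsum]
    refine Submodule.sum_mem _ fun i _ => Submodule.smul_mem _ _ ?_
    rw [hsum]
    have hadd : ap (F.C i) (∑ j, b j • ap (F.C j) (genericPoint I)) =
        ∑ j, (F.C i (b j) • ap (F.C j) (genericPoint I) +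
          b j • ap (F.C i) (ap (F.C j) (genericPoint I))) := by
      simp only [Fin.sum_univ_three, ap_add, ap_smul]
    rw [hadd]
    refine Submodule.sum_mem _ fun j _ => add_mem (Submodule.smul_mem _ _ ?_)
      (Submodule.smul_mem _ _ ?_)
    · exact h1 (ap_mem_movingTangent _)
    · rw [← F.toFF_fieldDeriv (i, j)]
      exact Submodule.subset_span ⟨Sum.inr (i, j), rfl⟩

/-- The tangent space contains the values of the vector fields of a frame. -/
theorem field_mem_tangentAt {v : Vec N} (hv : ∀ f ∈ I, MvPolynomial.eval v f = 0) (i : Fin 3) :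
    (fun k => MvPolynomial.eval v (F.field i k)) ∈ tangentAt I v := by
  rw [mem_tangentAt]
  intro f hf
  have h := hv _ (F.mem hf i)
  rw [derivation_apply, map_sum] at h
  rw [differential_apply, ← h]
  simp [field]

end Frame

/-- At general points the tangent space has at most the dimension of the variety. -/
theorem exists_finrank_tangentAt_le {n : ℕ} {I : Ideal (MvPolynomial (Fin (n + 1)) ℂ)} [I.IsPrime]
    {m : ℕ} (hm : Module.finrank (FunctionField I)
      (Derivation ℂ (FunctionField I) (FunctionField I)) = m) :
    ∃ g ∉ I, ∀ v : Fin (n + 1) → ℂ, (∀ f ∈ I, MvPolynomial.eval v f = 0) →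
      MvPolynomial.eval v g ≠ 0 → Module.finrank ℂ (tangentAt I v) ≤ m := by
  obtain ⟨κ, a, ha, hspan, hli⟩ := exists_linearIndependent' (FunctionField I)
    fun (f : I) k => toFF I (MvPolynomial.pderiv k (f : MvPolynomial (Fin (n + 1)) ℂ))
  have hfin : Finite κ := hli.finite
  have : Fintype κ := Fintype.ofFinite κ
  -- Generic kernel vectors of the Jacobian come from derivations, so the nullity is at most `m`.
  -- The independent rows, finitely many equations, remain independent at general points.
  have hcard : n + 1 ≤ Fintype.card κ + m := by
    let M : Matrix κ (Fin (n + 1)) (FunctionField I) := fun i k =>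
      toFF I (MvPolynomial.pderiv k (a i : MvPolynomial (Fin (n + 1)) ℂ))
    have hker : LinearMap.ker M.mulVecLin ≤ movingTangent (genericPoint I) := by
      intro u hu
      have hu' : ∀ w ∈ Submodule.span (FunctionField I) (Set.range fun (f : I) k =>
          toFF I (MvPolynomial.pderiv k (f : MvPolynomial (Fin (n + 1)) ℂ))),
          ∑ k, w k * u k = 0 := by
        rw [← hspan]
        intro w hw
        induction hw using Submodule.span_induction with
        | mem y hy =>
          obtain ⟨i, rfl⟩ := hy
          exact congrFun (LinearMap.mem_ker.1 hu) i
        | zero => simp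
        | add y z _ _ hy hz => simp [add_mul, Finset.sum_add_distrib, hy, hz]
        | smul c y _ hy => simp [mul_assoc, ← Finset.mul_sum, hy]
      obtain ⟨C, hC⟩ := exists_derivation u fun f hf =>
        hu' _ (Submodule.subset_span ⟨⟨f, hf⟩, rfl⟩)
      exact ⟨C, funext hC⟩
    have h1 := LinearMap.finrank_range_add_finrank_ker M.mulVecLin
    have h2 := Submodule.finrank_mono hker
    have h3 := Submodule.finrank_le (LinearMap.range M.mulVecLin)
    rw [movingTangent, LinearMap.finrank_range_of_inj (tangentMap_injective I), hm] at h2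
    rw [Module.finrank_fin_fun] at h1
    rw [Module.finrank_fintype_fun_eq_card] at h3
    omega
  obtain ⟨g, hg, hind⟩ := exists_linearIndependent_eval
    (u := fun (i : κ) k => MvPolynomial.pderiv k (a i : MvPolynomial (Fin (n + 1)) ℂ)) hli
  refine ⟨g, hg, fun v hv hgv => ?_⟩
  have hli' := hind v hv hgv
  let M : Matrix κ (Fin (n + 1)) ℂ := fun i k =>
    MvPolynomial.eval v (MvPolynomial.pderiv k (a i : MvPolynomial (Fin (n + 1)) ℂ))
  have hrank : M.rank = Fintype.card κ := LinearIndependent.rank_matrix hli'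
  have hle : tangentAt I v ≤ LinearMap.ker M.mulVecLin := by
    intro w hw
    rw [LinearMap.mem_ker]
    ext i
    have := (mem_tangentAt.1 hw) (a i) (a i).2
    rw [differential_apply] at this
    exact this
  have h1 := LinearMap.finrank_range_add_finrank_ker M.mulVecLin
  have h2 := Submodule.finrank_mono hle
  rw [Module.finrank_fin_fun] at h1
  have h3 : Module.finrank ℂ (LinearMap.range M.mulVecLin) = Fintype.card κ := hrank
  omega

end Frame

/-! ### The osculating space at a general point -/

section Osculating

variable {X : Set (PSpace N)}

theorem constantCoeff_doubleFlow {m : ℕ}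
    (D₀ D₁ : Derivation ℂ (MvPolynomial (Fin m) ℂ) (MvPolynomial (Fin m) ℂ))
    (v : Fin m → ℂ) (f : MvPolynomial (Fin m) ℂ) :
    MvPowerSeries.constantCoeff (doubleFlow D₀ D₁ v f) = MvPolynomial.eval v f := by
  have h := coeff_doubleFlow D₀ D₁ v f 0 0
  have h0 : (Finsupp.cons 0 (Finsupp.cons 0 0) : Fin 2 →₀ ℕ) = 0 := by
    ext i; fin_cases i <;> rfl
  rw [h0, MvPowerSeries.coeff_zero_eq_constantCoeff_apply] at h
  simpa using h

theorem coeff_single_doubleFlow {m : ℕ}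
    (D : Fin 2 → Derivation ℂ (MvPolynomial (Fin m) ℂ) (MvPolynomial (Fin m) ℂ))
    (v : Fin m → ℂ) (f : MvPolynomial (Fin m) ℂ) (i : Fin 2) :
    MvPowerSeries.coeff (Finsupp.single i 1) (doubleFlow (D 0) (D 1) v f) =
      MvPolynomial.eval v (D i f) := by
  have h0 : (Finsupp.single 0 1 : Fin 2 →₀ ℕ) = Finsupp.cons 1 (Finsupp.cons 0 0) := by
    ext i
    fin_cases i
    · exact Finsupp.single_eq_same
    · exact Finsupp.single_eq_of_ne (by decide)
  have h1 : (Finsupp.single 1 1 : Fin 2 →₀ ℕ) = Finsupp.cons 0 (Finsupp.cons 1 0) := by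
    ext i
    fin_cases i
    · exact Finsupp.single_eq_of_ne (by decide)
    · exact Finsupp.single_eq_same
  fin_cases i
  · change MvPowerSeries.coeff (Finsupp.single 0 1) _ = _
    rw [h0, coeff_doubleFlow]
    simp
  · change MvPowerSeries.coeff (Finsupp.single 1 1) _ = _
    rw [h1, coeff_doubleFlow]
    simp

theorem eval_eq_zero_of_mk_mem {v : Vec N} (hv : v ≠ 0) (hvX : Projectivization.mk ℂ v hv ∈ X)
    {f : MvPolynomial (Fin (N + 1)) ℂ} (hf : f ∈ idealOf X) : MvPolynomial.eval v f = 0 :=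
  mem_idealOf.1 hf v ⟨hv, hvX⟩

/-- The flows of a frame give a local parametrization. -/
theorem Frame.nonempty_localParam [(idealOf X).IsPrime] (F : Frame (idealOf X)) {v : Vec N}
    (hv : v ≠ 0) (hvX : Projectivization.mk ℂ v hv ∈ X)
    (hli : LinearIndependent ℂ fun i k => MvPolynomial.eval v (F.field i k)) :
    Nonempty (LocalParam X (Projectivization.mk ℂ v hv)) := by
  set D : Fin 2 → _ := ![F.D 0, F.D 1] with hD
  set Φ : Fin (N + 1) → MvPowerSeries (Fin 2) ℂ :=
    fun k => doubleFlow (D 0) (D 1) v (MvPolynomial.X k) with hΦ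
  have hval : valueAt Φ = v := by
    ext k
    rw [valueAt, hΦ, constantCoeff_doubleFlow, MvPolynomial.eval_X]
  have hpart : ∀ i, valueAt (partialDeriv i Φ) =
      fun k => MvPolynomial.eval v (D i (MvPolynomial.X k)) := by
    intro i
    ext k
    rw [valueAt, partialDeriv, ← MvPowerSeries.coeff_zero_eq_constantCoeff_apply,
      MvPowerSeries.coeff_pderiv, zero_add, hΦ, coeff_single_doubleFlow]
    simp
  refine ⟨⟨Φ, ⟨by rwa [hval], by simp only [hval]⟩, fun f hf => ?_, ?_⟩⟩
  · have : MvPolynomial.aeval Φ = doubleFlow (D 0) (D 1) v :=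
      (MvPolynomial.aeval_unique _).symm
    rw [this]
    ext m
    obtain ⟨a, b, rfl⟩ : ∃ a b, m = Finsupp.cons a (Finsupp.cons b 0) :=
      ⟨m 0, m 1, by ext i; fin_cases i <;> rfl⟩
    rw [coeff_doubleFlow, map_zero]
    -- Every Taylor coefficient of an equation along the flows is an iterated derivative, which
    -- stays in the ideal and vanishes at `v`.
    have hmem : (F.D 1 : MvPolynomial (Fin (N + 1)) ℂ →ₗ[ℂ] MvPolynomial (Fin (N + 1)) ℂ)^[b]
        ((F.D 0 : MvPolynomial (Fin (N + 1)) ℂ →ₗ[ℂ] MvPolynomial (Fin (N + 1)) ℂ)^[a] f) ∈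
        idealOf X := F.iterate_mem (F.iterate_mem hf _ _) _ _
    have h0 := eval_eq_zero_of_mk_mem hv hvX hmem
    simp only [hD, Matrix.cons_val_zero, Matrix.cons_val_one]
    rw [h0, mul_zero, mul_zero]
  -- The Euler field, of index 2, supplies the position vector.
  · have h := hli.comp ![2, 0, 1] (by decide)
    convert h using 1
    funext i
    fin_cases i
    · change valueAt Φ = _
      rw [hval]
      funext k
      simp [F.field_two]
    · exact hpart 0
    · exact hpart 1

namespace LocalParam

theorem exists_smul_valueAt_eq {v : Vec N} {hv : v ≠ 0}
    (φ : LocalParam X (Projectivization.mk ℂ v hv)) :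
    ∃ c : ℂ, c ≠ 0 ∧ c • valueAt φ.series = v := by
  obtain ⟨h, hb⟩ := φ.base
  obtain ⟨c, hc⟩ := (Projectivization.mk_eq_mk_iff' ℂ _ _ hv h).1 hb.symm
  refine ⟨c, ?_, hc⟩
  rintro rfl
  exact hv (by simpa using hc.symm)

theorem aeval_smul_series {x : PSpace N} (φ : LocalParam X x) {c : ℂ} (hc : c ≠ 0)
    {f : MvPolynomial (Fin (N + 1)) ℂ} (hf : f ∈ idealOf X) :
    MvPolynomial.aeval (fun k => c • φ.series k) f = 0 := by
  have := φ.equations _ (aeval_smul_mem hf hc)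
  rw [← AlgHom.comp_apply, MvPolynomial.comp_aeval] at this
  convert this using 3
  simp [MvPowerSeries.algebraMap_apply, MvPowerSeries.smul_eq_C_mul]

/-- Differentiate `f (c Φ) = 0` twice; the constant `c` makes the base vector equal to the chosen
`v`. -/
theorem hessian_add_differential {x : PSpace N} (φ : LocalParam X x) {v : Vec N} {c : ℂ}
    (hc : c ≠ 0) (hcv : c • valueAt φ.series = v) {f : MvPolynomial (Fin (N + 1)) ℂ}
    (hf : f ∈ idealOf X) (i j : Fin 2) :
    hessian v f (c • valueAt (partialDeriv i φ.series)) (c • valueAt (partialDeriv j φ.series)) +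
      differential v f (c • φ.second i j) = 0 := by
  have h := second_derivative MvPowerSeries.constantCoeff
    (fun a => by simp [MvPowerSeries.algebraMap_apply])
    (MvPowerSeries.pderiv ℂ i) (MvPowerSeries.pderiv ℂ j) (fun k => c • φ.series k) f
  rw [φ.aeval_smul_series hc hf, map_zero, map_zero, map_zero] at h
  have hv : (fun k => MvPowerSeries.constantCoeff (c • φ.series k)) = v := by
    rw [← hcv]; ext k; simp [valueAt]
  rw [hv] at h
  have h1 : ∀ i, c • valueAt (partialDeriv i φ.series) = fun k =>
      MvPowerSeries.constantCoeff (MvPowerSeries.pderiv ℂ i (c • φ.series k)) := by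
    intro i
    ext k; simp [valueAt, partialDeriv]
  have h2 : c • φ.second i j = fun k => MvPowerSeries.constantCoeff
      (MvPowerSeries.pderiv ℂ i (MvPowerSeries.pderiv ℂ j (c • φ.series k))) := by
    ext k; simp [valueAt, partialDeriv, LocalParam.second]
  rw [h, h1, h1, h2]

end LocalParam

namespace Frame

variable [(idealOf X).IsPrime] (F : Frame (idealOf X))

theorem hessian_add_differential {v : Vec N} (hv : ∀ f ∈ idealOf X, MvPolynomial.eval v f = 0)
    {f : MvPolynomial (Fin (N + 1)) ℂ} (hf : f ∈ idealOf X) (p : Fin 3 × Fin 3) :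
    hessian v f (fun k => MvPolynomial.eval v (F.field p.1 k))
      (fun k => MvPolynomial.eval v (F.field p.2 k)) +
      differential v f (fun k => MvPolynomial.eval v (F.fieldDeriv p k)) = 0 := by
  have h := second_derivative (MvPolynomial.eval v) (fun a => by simp) (F.D p.1) (F.D p.2)
    MvPolynomial.X f
  rw [MvPolynomial.aeval_X_left_apply, hv _ (F.mem (F.mem hf _) _)] at h
  rw [h]
  simp [field, fieldDeriv]

/-- The derivative of the Euler field along `D i` is the field `D i` itself, which is tangent, so
the differential term disappears. -/
theorem hessian_field_eq_zero {v : Vec N} (hv : ∀ f ∈ idealOf X, MvPolynomial.eval v f = 0)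
    {f : MvPolynomial (Fin (N + 1)) ℂ} (hf : f ∈ idealOf X) (i : Fin 3) :
    hessian v f (fun k => MvPolynomial.eval v (F.field i k)) v = 0 := by
  have h := F.hessian_add_differential hv hf (i, 2)
  have h1 : (fun k => MvPolynomial.eval v (F.field 2 k)) = v := by
    funext k; simp [F.field_two]
  have h2 : F.fieldDeriv (i, 2) = F.field i := by
    funext k
    rw [fieldDeriv]
    exact congrArg (F.D i) (F.field_two k)
  simp only [h1, h2] at h
  rw [mem_tangentAt.1 (F.field_mem_tangentAt hv i) f hf, add_zero] at h
  exact h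

theorem span_field_eval {v : Vec N} (hv : ∀ f ∈ idealOf X, MvPolynomial.eval v f = 0)
    (hli : LinearIndependent ℂ fun i k => MvPolynomial.eval v (F.field i k))
    (hT : Module.finrank ℂ (tangentAt (idealOf X) v) ≤ 3) :
    Submodule.span ℂ (Set.range fun i k => MvPolynomial.eval v (F.field i k)) =
      tangentAt (idealOf X) v := by
  refine Submodule.eq_of_le_of_finrank_le ?_ ?_
  · rw [Submodule.span_le]
    rintro _ ⟨i, rfl⟩
    exact F.field_mem_tangentAt hv i
  · rwa [finrank_span_eq_card hli, Fintype.card_fin]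

theorem isSmoothPoint {v : Vec N} (hv : v ≠ 0) (hvX : Projectivization.mk ℂ v hv ∈ X)
    (hli : LinearIndependent ℂ fun i k => MvPolynomial.eval v (F.field i k))
    (hT : Module.finrank ℂ (tangentAt (idealOf X) v) ≤ 3) :
    IsSmoothPoint X (Projectivization.mk ℂ v hv) := by
  refine ⟨hvX, ?_⟩
  rw [tangentSpace_mk, ← F.span_field_eval (fun f hf => eval_eq_zero_of_mk_mem hv hvX hf) hli hT,
    finrank_span_eq_card hli, Fintype.card_fin]

/-- The osculating space, in terms of a frame. -/
theorem osculatingSpace_eq {v : Vec N} (hv : v ≠ 0) (hvX : Projectivization.mk ℂ v hv ∈ X)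
    (hli : LinearIndependent ℂ fun i k => MvPolynomial.eval v (F.field i k))
    (hT : Module.finrank ℂ (tangentAt (idealOf X) v) ≤ 3)
    (φ : LocalParam X (Projectivization.mk ℂ v hv)) :
    φ.osculatingSpace = Submodule.span ℂ
      (Set.range fun a k => MvPolynomial.eval v (Sum.elim F.field F.fieldDeriv a k)) := by
  have hv0 : ∀ f ∈ idealOf X, MvPolynomial.eval v f = 0 :=
    fun f hf => eval_eq_zero_of_mk_mem hv hvX hf
  have hsm := F.isSmoothPoint hv hvX hli hT
  have hspan := F.span_field_eval hv0 hli hT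
  obtain ⟨c, hc, hcv⟩ := φ.exists_smul_valueAt_eq
  have hframe := LocalParam.span_frame (φ := φ) hsm
  rw [LocalParam.osculatingSpace_eq hsm, tangentSpace_mk]
  rw [tangentSpace_mk] at hframe
  have hsplit : Submodule.span ℂ
      (Set.range fun a k => MvPolynomial.eval v (Sum.elim F.field F.fieldDeriv a k)) =
      tangentAt (idealOf X) v ⊔ Submodule.span ℂ
        (Set.range fun p k => MvPolynomial.eval v (F.fieldDeriv p k)) := by
    rw [← hspan, ← Submodule.span_union, ← Set.Sum.elim_range]
    congr 2
    funext a
    cases a <;> rfl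
  rw [hsplit]
  let B : idealOf X → LinearMap.BilinForm ℂ (Vec N) := fun f => hessian v f
  let d : idealOf X → Vec N →ₗ[ℂ] ℂ := fun f => differential v f
  have hTd : ∀ w, (∀ f, d f w = 0) → w ∈ tangentAt (idealOf X) v :=
    fun w hw => mem_tangentAt.2 fun f hf => hw ⟨f, hf⟩
  have hs : ∀ (f : idealOf X) (i j : Fin 3),
      B f (fun k => MvPolynomial.eval v (F.field i k))
        (fun k => MvPolynomial.eval v (F.field j k)) +
      d f (fun k => MvPolynomial.eval v (F.fieldDeriv (i, j) k)) = 0 :=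
    fun f i j => F.hessian_add_differential hv0 f.2 (i, j)
  apply le_antisymm
  · refine sup_le le_sup_left (Submodule.span_le.2 ?_)
    rintro _ ⟨⟨i, j⟩, rfl⟩
    have h := jet_mem_sup_span hTd hs
      (e' := fun i => c • valueAt (partialDeriv i φ.series)) (s' := fun i j => c • φ.second i j)
      (fun f i j => φ.hessian_add_differential hc hcv f.2 i j) (fun i => by
        rw [hspan, ← hframe]
        exact Submodule.smul_mem _ _ (Submodule.subset_span (Or.inr ⟨i, rfl⟩))) i j
    have h' := Submodule.smul_mem _ c⁻¹ h
    rwa [inv_smul_smul₀ hc] at h'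
  · refine sup_le le_sup_left (Submodule.span_le.2 ?_)
    rintro _ ⟨⟨i, j⟩, rfl⟩
    -- A parametrization has only two derivatives, so `v` is added as a third frame vector with zero
    -- second derivatives. This is legitimate because the Hessians vanish on pairs of a tangent
    -- vector and `v`.
    let e : Option (Fin 2) → Vec N := fun a =>
      a.elim v fun i => c • valueAt (partialDeriv i φ.series)
    let s : Option (Fin 2) → Option (Fin 2) → Vec N := fun a b =>
      a.elim 0 fun i => b.elim 0 fun j => c • φ.second i j
    have heT : ∀ a, e a ∈ tangentAt (idealOf X) v := by
      intro a
      rw [← hframe]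
      rcases a with _ | i
      · have h : valueAt φ.series ∈ Submodule.span ℂ ({valueAt φ.series} ∪
            Set.range fun i => valueAt (partialDeriv i φ.series)) :=
          Submodule.subset_span (Or.inl rfl)
        have h' := Submodule.smul_mem _ c h
        rwa [hcv] at h'
      · exact Submodule.smul_mem _ _ (Submodule.subset_span (Or.inr ⟨i, rfl⟩))
    have hHv : ∀ (f : idealOf X), ∀ w ∈ tangentAt (idealOf X) v, B f w v = 0 := by
      intro f w hw
      rw [← hspan] at hw
      induction hw using Submodule.span_induction with
      | mem y hy =>
        obtain ⟨i, rfl⟩ := hy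
        exact F.hessian_field_eq_zero hv0 f.2 i
      | zero => simp
      | add y z _ _ hy hz => simp [hy, hz]
      | smul a y _ hy => simp [hy]
    have hse : ∀ (f : idealOf X) a b, B f (e a) (e b) + d f (s a b) = 0 := by
      intro f a b
      rcases a with _ | i
      · change B f v (e b) + d f 0 = 0
        rw [map_zero, add_zero]
        exact (hessian_comm v f _ _).trans (hHv f _ (heT b))
      · rcases b with _ | j
        · change B f (e (some i)) v + d f 0 = 0
          rw [map_zero, add_zero]
          exact hHv f _ (heT _)
        · exact φ.hessian_add_differential hc hcv f.2 i j
    have hTe : tangentAt (idealOf X) v ≤ Submodule.span ℂ (Set.range e) := by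
      rw [← hframe, Submodule.span_le]
      rintro _ (rfl | ⟨i, rfl⟩)
      · have h : e none ∈ Submodule.span ℂ (Set.range e) := Submodule.subset_span ⟨_, rfl⟩
        have h' := Submodule.smul_mem _ c⁻¹ h
        have hcv' : c⁻¹ • v = valueAt φ.series := by rw [inv_smul_eq_iff₀ hc, hcv]
        change c⁻¹ • v ∈ _ at h'
        rwa [hcv'] at h'
      · have h : e (some i) ∈ Submodule.span ℂ (Set.range e) := Submodule.subset_span ⟨_, rfl⟩
        have h' := Submodule.smul_mem _ c⁻¹ h
        change c⁻¹ • c • valueAt (partialDeriv i φ.series) ∈ _ at h'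
        rwa [inv_smul_smul₀ hc] at h'
    have h := jet_mem_sup_span hTd hse hs
      (fun i => hTe (F.field_mem_tangentAt hv0 i)) i j
    refine sup_le_sup_left (α := Submodule ℂ (Vec N)) (Submodule.span_le.2 ?_) _ h
    rintro _ ⟨⟨a, b⟩, rfl⟩
    rcases a with _ | i
    · exact zero_mem _
    · rcases b with _ | j
      · exact zero_mem _
      · exact Submodule.smul_mem _ _ (Submodule.subset_span ⟨(i, j), rfl⟩)

end Frame

/-- Smoothness and the dimension of the osculating space at a general point. -/
theorem exists_general_point (hX : IsProjectiveSurface X) [(idealOf X).IsPrime] :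
    ∃ g ∉ idealOf X, ∀ (v : Vec N) (hv : v ≠ 0), Projectivization.mk ℂ v hv ∈ X →
      MvPolynomial.eval v g ≠ 0 →
      IsSmoothPoint X (Projectivization.mk ℂ v hv) ∧
      Nonempty (LocalParam X (Projectivization.mk ℂ v hv)) ∧
      ∀ φ : LocalParam X (Projectivization.mk ℂ v hv),
        3 + Module.finrank ℂ φ.firstNormal =
          Module.finrank (FunctionField (idealOf X)) (movingOsc (genericPoint (idealOf X))) := by
  have h3 := finrank_derivation_of_surface hX
  obtain ⟨F⟩ := exists_frame hX
  obtain ⟨g₁, hg₁, h₁⟩ := exists_finrank_tangentAt_le h3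
  obtain ⟨g₂, hg₂, h₂⟩ := exists_linearIndependent_eval F.linearIndependent_field
  obtain ⟨g₃, hg₃, h₃⟩ := exists_finrank_span_eval (I := idealOf X) (Sum.elim F.field F.fieldDeriv)
  -- The three factors ensure that the tangent space is not too large, that the frame is
  -- independent, and that the osculating rank is generic.
  refine ⟨g₁ * g₂ * g₃, ?_, fun v hv hvX hg => ?_⟩
  · have hp : (idealOf X).IsPrime := inferInstance
    rw [hp.mul_mem_iff_mem_or_mem, hp.mul_mem_iff_mem_or_mem]
    tauto
  · simp only [map_mul, ne_eq, mul_eq_zero, not_or] at hg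
    have hv0 : ∀ f ∈ idealOf X, MvPolynomial.eval v f = 0 :=
      fun f hf => eval_eq_zero_of_mk_mem hv hvX hf
    have hT := h₁ v hv0 hg.1.1
    have hli := h₂ v hv0 hg.1.2
    have hsm := F.isSmoothPoint hv hvX hli hT
    refine ⟨hsm, F.nonempty_localParam hv hvX hli, fun φ => ?_⟩
    rw [← LocalParam.finrank_osculatingSpace (φ := φ) hsm, F.osculatingSpace_eq hv hvX hli hT,
      h₃ v hv0 hg.2, F.span_osc h3]

end Osculating

/-! ### Surfaces in linear subspaces -/

section Linear

variable {X : Set (PSpace N)}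

/-- A linear form as a polynomial. -/
def linearForm (l : Module.Dual ℂ (Vec N)) : MvPolynomial (Fin (N + 1)) ℂ :=
  ∑ k, MvPolynomial.C (l (Pi.single k 1)) * MvPolynomial.X k

theorem dual_apply_eq_sum (l : Module.Dual ℂ (Vec N)) (v : Vec N) :
    l v = ∑ k, l (Pi.single k 1) * v k := by
  rw [LinearMap.pi_apply_eq_sum_univ l v]
  refine Finset.sum_congr rfl fun k _ => ?_
  have : (fun j => if k = j then (1 : ℂ) else 0) = Pi.single k 1 := by
    ext j; simp [Pi.single_apply, eq_comm]
  rw [this, smul_eq_mul, mul_comm]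

theorem eval_linearForm (l : Module.Dual ℂ (Vec N)) (v : Vec N) :
    MvPolynomial.eval v (linearForm l) = l v := by
  rw [dual_apply_eq_sum, linearForm]
  simp

theorem mem_of_forall_dual {W : Submodule ℂ (Vec N)} {v : Vec N}
    (h : ∀ l : Module.Dual ℂ (Vec N), (∀ w ∈ W, l w = 0) → l v = 0) : v ∈ W := by
  by_contra hv
  obtain ⟨l, hl, hW⟩ := Submodule.exists_dual_map_eq_bot_of_notMem hv inferInstance
  refine hl (h l fun w hw => ?_)
  have : l w ∈ W.map l := ⟨w, hw, rfl⟩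
  rwa [hW, Submodule.mem_bot] at this

theorem mem_linearSubspace_mk {W : Submodule ℂ (Vec N)} {v : Vec N} (hv : v ≠ 0) :
    Projectivization.mk ℂ v hv ∈ linearSubspace W ↔ v ∈ W := by
  rw [linearSubspace, Set.mem_ofPred_eq, Projectivization.submodule_mk,
    Submodule.span_singleton_le_iff_mem]

/-- If the generic point lies in a subspace which does not move, the variety lies in a linear
subspace. -/
theorem subset_linearSubspace_of_stable [(idealOf X).IsPrime]
    {U : Submodule (FunctionField (idealOf X)) (Fin (N + 1) → FunctionField (idealOf X))}
    (hU : ∀ C : Derivation ℂ (FunctionField (idealOf X)) (FunctionField (idealOf X)),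
      ∀ u ∈ U, ap C u ∈ U) (hg : genericPoint (idealOf X) ∈ U) :
    ∃ W : Submodule ℂ (Vec N),
      Module.finrank ℂ W = Module.finrank (FunctionField (idealOf X)) U ∧
        X ⊆ linearSubspace W := by
  obtain ⟨w, hw, hwU⟩ := exists_constant_frame
    (fun c hc => mem_range_of_forall_derivation_eq_zero hc) U hU
  obtain ⟨y, hy⟩ := hwU _ hg
  refine ⟨Submodule.span ℂ (Set.range w), ?_, ?_⟩
  · rw [finrank_span_eq_card hw, Fintype.card_fin]
  · intro x hx
    induction x using Projectivization.ind with
    | h v hv =>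
      rw [mem_linearSubspace_mk]
      -- A linear form killing the constant frame kills the generic point, hence belongs to the
      -- ideal of `X`.
      refine mem_of_forall_dual fun l hl => ?_
      rw [← eval_linearForm]
      refine eval_eq_zero_of_mk_mem hv hx ?_
      rw [← toFF_eq_zero, linearForm, map_sum]
      have h1 : ∀ k, toFF (idealOf X) (MvPolynomial.C (l (Pi.single k 1)) * MvPolynomial.X k) =
          ∑ i, y i * algebraMap ℂ _ (l (Pi.single k 1) * w i k) := by
        intro k
        rw [map_mul, ← MvPolynomial.algebraMap_eq, AlgHom.commutes]
        change _ * genericPoint (idealOf X) k = _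
        rw [hy, Finset.mul_sum]
        exact Finset.sum_congr rfl fun i _ => by rw [map_mul]; ring
      simp only [h1]
      rw [Finset.sum_comm]
      refine Finset.sum_eq_zero fun i _ => ?_
      rw [← Finset.mul_sum, ← map_sum, ← dual_apply_eq_sum,
        hl _ (Submodule.subset_span ⟨i, rfl⟩), map_zero, mul_zero]

/-- A surface contained in a plane is a plane. -/
theorem eq_linearSubspace_of_subset (hX : IsProjectiveSurface X) {W : Submodule ℂ (Vec N)}
    (hW : Module.finrank ℂ W = 3) (hXW : X ⊆ linearSubspace W) : X = linearSubspace W := by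
  obtain ⟨b⟩ : Nonempty (Module.Basis (Fin 3) ℂ W) := ⟨Module.finBasisOfFinrankEq ℂ W hW⟩
  set w : Fin 3 → Vec N := fun i => b i with hw
  have hli : LinearIndependent ℂ w := b.linearIndependent.map' W.subtype (Submodule.ker_subtype W)
  have hspan : ∀ v ∈ W, ∃ c : Fin 3 → ℂ, v = Fintype.linearCombination ℂ w c := by
    intro v hv
    refine ⟨b.repr ⟨v, hv⟩, ?_⟩
    have := congrArg W.subtype (b.sum_repr ⟨v, hv⟩)
    rw [map_sum] at this
    rw [Fintype.linearCombination_apply]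
    exact this.symm
  obtain ⟨π, hπ⟩ := LinearMap.exists_leftInverse_of_injective
    (Fintype.linearCombination ℂ w)
    (LinearMap.ker_eq_bot.2 hli.fintypeLinearCombination_injective)
  have hπv : ∀ v ∈ W, Fintype.linearCombination ℂ w (π v) = v := by
    intro v hv
    obtain ⟨c, rfl⟩ := hspan v hv
    rw [← LinearMap.comp_apply π, hπ, LinearMap.id_apply]
  have hcone : ∀ v ∈ cone X, v ∈ W := by
    rintro v ⟨hv, hvX⟩
    exact (mem_linearSubspace_mk hv).1 (hXW hvX)
  -- `ρ` restricts polynomials to `W`. Since `X` lies in `ℙ(W)`, its coordinate ring is a quotient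
  -- of a polynomial ring in three variables through `ψ`.
  let ρ : MvPolynomial (Fin (N + 1)) ℂ →ₐ[ℂ] MvPolynomial (Fin 3) ℂ :=
    MvPolynomial.aeval fun k => ∑ i, MvPolynomial.C (w i k) * MvPolynomial.X i
  have hρ : ∀ (c : Fin 3 → ℂ) f, MvPolynomial.eval c (ρ f) =
      MvPolynomial.eval (Fintype.linearCombination ℂ w c) f := by
    intro c f
    rw [← MvPolynomial.coe_aeval_eq_eval, RingHom.coe_coe, ← AlgHom.comp_apply,
      MvPolynomial.comp_aeval, ← MvPolynomial.aeval_eq_eval]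
    congr 2
    ext k
    simp [Fintype.linearCombination_apply, mul_comm]
  let ψ : MvPolynomial (Fin 3) ℂ →ₐ[ℂ] MvPolynomial (Fin (N + 1)) ℂ ⧸ idealOf X :=
    MvPolynomial.aeval fun j => Ideal.Quotient.mk _ (linearForm (LinearMap.proj j ∘ₗ π))
  have hψρ : ∀ f, ψ (ρ f) = Ideal.Quotient.mk (idealOf X) f := by
    intro f
    have : ψ.comp ρ = Ideal.Quotient.mkₐ ℂ (idealOf X) := by
      refine MvPolynomial.algHom_ext fun k => ?_
      have h1 : ψ (ρ (MvPolynomial.X k)) = Ideal.Quotient.mk (idealOf X)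
          (∑ i, MvPolynomial.C (w i k) * linearForm (LinearMap.proj i ∘ₗ π)) := by
        simp only [ρ, MvPolynomial.aeval_X, map_sum, map_mul]
        refine Finset.sum_congr rfl fun i _ => ?_
        simp only [ψ, MvPolynomial.aeval_X, MvPolynomial.aeval_C]
        rfl
      rw [AlgHom.comp_apply, h1, Ideal.Quotient.mkₐ_eq_mk, Ideal.Quotient.eq, mem_idealOf]
      intro v hv
      have h2 := congrFun (hπv v (hcone v hv)) k
      rw [Fintype.linearCombination_apply] at h2
      simp only [map_sub, map_sum, map_mul, MvPolynomial.eval_C, eval_linearForm,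
        MvPolynomial.eval_X, sub_eq_zero]
      rw [← h2]
      simp [mul_comm]
    exact congrArg (fun g => g f) this
  have hρ0 : ∀ f ∈ idealOf X, ρ f = 0 := by
    intro f hf
    by_contra h0
    -- An equation of `X` not vanishing on `W` would lower the dimension of this quotient below 3.
    have h1 := ringKrullDim_succ_le_of_surjective ψ.toRingHom
      (fun q : MvPolynomial (Fin (N + 1)) ℂ ⧸ idealOf X => by
        obtain ⟨p, rfl⟩ := Ideal.Quotient.mk_surjective q
        exact ⟨ρ p, hψρ p⟩)
      (mem_nonZeroDivisors_of_ne_zero h0)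
      ((hψρ f).trans (Ideal.Quotient.eq_zero_iff_mem.2 hf))
    rw [hX.dim, MvPolynomial.ringKrullDim_of_isNoetherianRing, ringKrullDim_eq_zero_of_field,
      Nat.card_fin] at h1
    norm_num at h1
  refine hXW.antisymm fun x hx => ?_
  obtain ⟨S, hS, hXS⟩ := hX.closed
  induction x using Projectivization.ind with
  | h v hv =>
    rw [mem_linearSubspace_mk] at hx
    rw [hXS]
    intro f hf
    obtain ⟨d, hd⟩ := hS f hf
    rw [eval_rep_eq_zero_iff hd]
    have hfI : f ∈ idealOf X := by
      rw [mem_idealOf]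
      rintro u ⟨hu, huX⟩
      exact (eval_rep_eq_zero_iff hd u hu).1 ((hXS _).1 huX f hf)
    rw [← hπv v hx, ← hρ, hρ0 f hfI, map_zero]

/-- A parametrization satisfies the linear equations of the plane coefficientwise, so all its
derivatives at the origin lie in `W`. -/
theorem finrank_firstNormal_of_isPlane {x : PSpace N} (hx : IsSmoothPoint X x)
    (φ : LocalParam X x) (hX : IsPlane X) : Module.finrank ℂ φ.firstNormal = 0 := by
  obtain ⟨W, hW, rfl⟩ := hX
  have h := LocalParam.finrank_osculatingSpace (φ := φ) hx
  have hle : φ.osculatingSpace ≤ W := by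
    have key : ∀ l : Module.Dual ℂ (Vec N), (∀ w ∈ W, l w = 0) →
        ∑ k, l (Pi.single k 1) • φ.series k = 0 := by
      intro l hl
      have h1 : linearForm l ∈ idealOf (linearSubspace W) := by
        rw [mem_idealOf]
        rintro v ⟨hv, hvX⟩
        rw [eval_linearForm]
        exact hl v ((mem_linearSubspace_mk hv).1 hvX)
      have h2 := φ.equations _ h1
      rw [linearForm, map_sum] at h2
      rw [← h2]
      refine Finset.sum_congr rfl fun k _ => ?_
      rw [map_mul, MvPolynomial.aeval_X, MvPolynomial.aeval_C, Algebra.smul_def]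
    have hval : ∀ (l : Module.Dual ℂ (Vec N)) (T : MvPowerSeries (Fin 2) ℂ →ₗ[ℂ] ℂ),
        (∀ w ∈ W, l w = 0) → l (fun k => T (φ.series k)) = 0 := by
      intro l T hl
      have h1 := congrArg T (key l hl)
      rw [map_sum, map_zero] at h1
      rw [dual_apply_eq_sum, ← h1]
      exact Finset.sum_congr rfl fun k _ => by rw [map_smul, smul_eq_mul]
    let ε : MvPowerSeries (Fin 2) ℂ →ₗ[ℂ] ℂ := MvPowerSeries.coeff 0
    rw [LocalParam.osculatingSpace, Submodule.span_le]
    rintro _ ((rfl | ⟨i, rfl⟩) | ⟨p, rfl⟩)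
    · exact mem_of_forall_dual fun l hl => hval l ε hl
    · exact mem_of_forall_dual fun l hl =>
        hval l (ε ∘ₗ (MvPowerSeries.pderiv ℂ i).toLinearMap) hl
    · exact mem_of_forall_dual fun l hl =>
        hval l (ε ∘ₗ (MvPowerSeries.pderiv ℂ p.1).toLinearMap ∘ₗ
          (MvPowerSeries.pderiv ℂ p.2).toLinearMap) hl
  have h2 := Submodule.finrank_mono hle
  omega

theorem finrank_movingTangent (hX : IsProjectiveSurface X) [(idealOf X).IsPrime] :
    Module.finrank (FunctionField (idealOf X)) (movingTangent (genericPoint (idealOf X))) = 3 := by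
  rw [movingTangent, LinearMap.finrank_range_of_inj (tangentMap_injective _),
    finrank_derivation_of_surface hX]

theorem genericPoint_mem_movingTangent [(idealOf X).IsPrime] :
    genericPoint (idealOf X) ∈ movingTangent (genericPoint (idealOf X)) := by
  obtain ⟨E, hE⟩ := exists_euler_derivation (X := X)
  exact ⟨E, hE⟩

/-- Dimension 3 makes the osculating and tangent spaces equal, so the tangent space is stable under
all derivations. -/
theorem isPlane_of_finrank_movingOsc (hX : IsProjectiveSurface X) [(idealOf X).IsPrime]
    (h : Module.finrank (FunctionField (idealOf X)) (movingOsc (genericPoint (idealOf X))) = 3) :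
    IsPlane X := by
  have heq : movingTangent (genericPoint (idealOf X)) = movingOsc (genericPoint (idealOf X)) :=
    Submodule.eq_of_le_of_finrank_eq movingTangent_le_movingOsc
      (by rw [h, finrank_movingTangent hX])
  obtain ⟨W, hW, hXW⟩ := subset_linearSubspace_of_stable
    (U := movingTangent (genericPoint (idealOf X)))
    (fun C u hu => by rw [heq]; exact ap_mem_movingOsc C hu) genericPoint_mem_movingTangent
  rw [finrank_movingTangent hX] at hW
  exact ⟨W, hW, eq_linearSubspace_of_subset hX hW hXW⟩

end Linear

/-! ### Ruled developable surfaces -/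

section Developable

theorem aeval_mul_of_isHomogeneous {R : Type*} [CommRing R] [Algebra ℂ R] {n d : ℕ}
    {f : MvPolynomial (Fin n) ℂ} (hf : f.IsHomogeneous d) (c : R) (v : Fin n → R) :
    MvPolynomial.aeval (fun k => c * v k) f = c ^ d * MvPolynomial.aeval v f := by
  rw [MvPolynomial.aeval_def, MvPolynomial.aeval_def, MvPolynomial.eval₂_eq',
    MvPolynomial.eval₂_eq', Finset.mul_sum]
  refine Finset.sum_congr rfl fun m hm => ?_
  have hd : ∑ i, m i = d := by
    have := hf (MvPolynomial.mem_support_iff.1 hm)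
    rw [Finsupp.weight_apply, Finsupp.sum_fintype] at this
    · simpa using this
    · simp
  simp only [mul_pow, Finset.prod_mul_distrib]
  rw [Finset.prod_pow_eq_pow_sum, hd]
  ring

/-- A polynomial vanishing at a nonconstant power series is zero. -/
theorem polynomial_eq_zero_of_aeval_eq_zero {γ : PowerSeries ℂ}
    (hγ : ∀ c : ℂ, γ ≠ algebraMap ℂ (PowerSeries ℂ) c) {q : Polynomial ℂ}
    (hq : Polynomial.aeval γ q = 0) : q = 0 := by
  by_contra h0
  have hint : IsIntegral ℂ γ := isAlgebraic_iff_isIntegral.1 ⟨q, h0, hq⟩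
  obtain ⟨c, hc⟩ := minpoly.mem_range_of_degree_eq_one ℂ γ
    (IsAlgClosed.degree_eq_one_of_irreducible ℂ (minpoly.irreducible hint))
  exact hγ c hc.symm

/-- A form vanishing along a formal curve contained in a line vanishes on the line. -/
theorem eval_eq_zero_of_curve_in_line {n d : ℕ} {f : MvPolynomial (Fin n) ℂ}
    (hf : f.IsHomogeneous d) {v a : Fin n → ℂ} {α β : PowerSeries ℂ}
    (hα : PowerSeries.constantCoeff α = 1) (hβ : PowerSeries.constantCoeff β = 0) (hβ0 : β ≠ 0)
    (h : MvPolynomial.aeval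
      (fun k => α * algebraMap ℂ _ (v k) + β * algebraMap ℂ (PowerSeries ℂ) (a k)) f = 0)
    (y z : ℂ) : MvPolynomial.eval (y • v + z • a) f = 0 := by
  have hα0 : α ≠ 0 := by rintro rfl; simp at hα
  have hinv : α * α⁻¹ = 1 := PowerSeries.mul_inv_cancel _ (by rw [hα]; exact one_ne_zero)
  -- Homogeneity allows division by `α`. The parameter `γ` vanishes at 0 without being zero, so it
  -- is transcendental over `ℂ` and the restriction of `f` to the line is the zero polynomial.
  set γ := α⁻¹ * β with hγ
  have hβγ : β = α * γ := by rw [hγ, ← mul_assoc, hinv, one_mul]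
  have hγc : ∀ c : ℂ, γ ≠ algebraMap ℂ (PowerSeries ℂ) c := by
    intro c hc
    rw [hc] at hβγ
    have h1 := hβ
    rw [hβγ, map_mul, hα, one_mul, PowerSeries.algebraMap_apply] at h1
    have h2 : c = 0 := by simpa using h1
    rw [h2, map_zero, mul_zero] at hβγ
    exact hβ0 hβγ
  set q : Polynomial ℂ := MvPolynomial.aeval
    (fun k => Polynomial.C (v k) + Polynomial.X * Polynomial.C (a k)) f with hq
  have hq0 : q = 0 := by
    apply polynomial_eq_zero_of_aeval_eq_zero hγc
    have h1 : (fun k => α * algebraMap ℂ _ (v k) + β * algebraMap ℂ (PowerSeries ℂ) (a k)) =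
        fun k => α * (algebraMap ℂ _ (v k) + γ * algebraMap ℂ (PowerSeries ℂ) (a k)) := by
      funext k
      rw [hβγ]; ring
    rw [h1, aeval_mul_of_isHomogeneous hf] at h
    have h2 := (mul_eq_zero.1 h).resolve_left (pow_ne_zero _ hα0)
    rw [hq, ← AlgHom.comp_apply, MvPolynomial.comp_aeval]
    have h3 : (fun k => Polynomial.aeval γ
        (Polynomial.C (v k) + Polynomial.X * Polynomial.C (a k))) =
        fun k => algebraMap ℂ _ (v k) + γ * algebraMap ℂ (PowerSeries ℂ) (a k) := by
      funext k
      rw [map_add, map_mul, Polynomial.aeval_C, Polynomial.aeval_C, Polynomial.aeval_X]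
    rw [h3, h2]
  have heval : ∀ s : ℂ, MvPolynomial.eval (v + s • a) f = 0 := by
    intro s
    have h1 := congrArg (Polynomial.aeval s) hq0
    rw [hq, ← AlgHom.comp_apply, MvPolynomial.comp_aeval, map_zero,
      MvPolynomial.aeval_eq_eval] at h1
    rw [← h1]
    change _ = MvPolynomial.eval _ f
    congr 2
    ext k
    simp
    exact mul_comm _ _
  have hne : ∀ y : ℂ, y ≠ 0 → MvPolynomial.eval (y • v + z • a) f = 0 := by
    intro y hy
    have h1 : y • v + z • a = y • (v + (y⁻¹ * z) • a) := by
      rw [smul_add, smul_smul, mul_inv_cancel_left₀ hy]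
    rw [h1, eval_smul_of_isHomogeneous hf, heval, mul_zero]
  by_cases hy : y = 0
  -- The missing case `y = 0` follows because a polynomial in `y` vanishing off 0 vanishes
  -- identically.
  · set p : Polynomial ℂ := MvPolynomial.aeval
      (fun k => Polynomial.X * Polynomial.C (v k) + Polynomial.C (z * a k)) f with hp
    have hpe : ∀ s : ℂ, Polynomial.eval s p = MvPolynomial.eval (s • v + z • a) f := by
      intro s
      rw [← Polynomial.coe_aeval_eq_eval, hp, ← AlgHom.comp_apply,
        MvPolynomial.comp_aeval, MvPolynomial.aeval_eq_eval]
      congr 2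
      ext k
      simp
      exact mul_comm _ _
    have hp0 : p = 0 := by
      refine Polynomial.eq_zero_of_infinite_isRoot _
        (Set.Infinite.mono (s := {0}ᶜ) ?_ (Set.finite_singleton (0 : ℂ)).infinite_compl)
      intro s hs
      exact (hpe s).trans (hne s hs)
    rw [← hpe, hp0, Polynomial.eval_zero]
  · exact hne y hy

/-- The transition matrices for the iterates of a derivation. -/
def transition {R ι : Type*} [CommRing R] [Algebra ℂ R] [Fintype ι] [DecidableEq ι]
    (A : Derivation ℂ R R) (c : Matrix ι ι R) : ℕ → Matrix ι ι R
  | 0 => 1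
  | n + 1 => fun i j => A (transition A c n i j) + ∑ l, transition A c n i l * c l j

theorem iterate_sub_transition_mem {R ι κ : Type*} [CommRing R] [Algebra ℂ R] [Fintype ι]
    [DecidableEq ι] {I : Ideal R} {A : Derivation ℂ R R} (hA : ∀ f ∈ I, A f ∈ I)
    {c : Matrix ι ι R} {u : ι → κ → R} (hu : ∀ i k, A (u i k) - ∑ j, c i j * u j k ∈ I)
    (n : ℕ) (i : ι) (k : κ) :
    (A : R →ₗ[ℂ] R)^[n] (u i k) - ∑ j, transition A c n i j * u j k ∈ I := by
  induction n with
  | zero => simp [transition, Matrix.one_apply]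
  | succ n ih =>
    have h1 := hA _ ih
    rw [Function.iterate_succ_apply']
    rw [map_sub, map_sum] at h1
    have h2 : ∑ l, transition A c n i l * (A (u l k) - ∑ j, c l j * u j k) ∈ I :=
      Ideal.sum_mem _ fun l _ => Ideal.mul_mem_left _ _ (hu l k)
    have h3 := add_mem h1 h2
    convert h3 using 1
    simp only [Derivation.coeFn_coe, Derivation.leibniz, smul_eq_mul, transition, add_mul, mul_sub,
      Finset.sum_add_distrib, Finset.sum_sub_distrib, Finset.mul_sum, Finset.sum_mul]
    rw [Finset.sum_comm (f := fun j l => transition A c n i l * c l j * u j k)]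
    simp only [mul_assoc, mul_comm (u _ k)]
    ring

/-- The flow of a family of vectors whose derivatives are combinations of the family. -/
theorem exists_flow_eq_sum {m : ℕ} {ι κ : Type*} [Fintype ι] [DecidableEq ι]
    {I : Ideal (MvPolynomial (Fin m) ℂ)}
    {A : Derivation ℂ (MvPolynomial (Fin m) ℂ) (MvPolynomial (Fin m) ℂ)}
    (hA : ∀ f ∈ I, A f ∈ I) {c : Matrix ι ι (MvPolynomial (Fin m) ℂ)}
    {u : ι → κ → MvPolynomial (Fin m) ℂ} (hu : ∀ i k, A (u i k) - ∑ j, c i j * u j k ∈ I)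
    {v : Fin m → ℂ} (hv : ∀ f ∈ I, MvPolynomial.eval v f = 0) :
    ∃ R : Matrix ι ι (PowerSeries ℂ), (∀ i j, PowerSeries.constantCoeff (R i j) =
        (1 : Matrix ι ι ℂ) i j) ∧
      ∀ i k, flow A v (u i k) =
        ∑ j, R i j * algebraMap ℂ (PowerSeries ℂ) (MvPolynomial.eval v (u j k)) := by
  -- `R` is the formal fundamental solution of the linear system with matrix `c` along the flow; it
  -- starts at the identity because `transition` does.
  refine ⟨fun i j => PowerSeries.mk fun n =>
    (n.factorial : ℂ)⁻¹ * MvPolynomial.eval v (transition A c n i j), fun i j => ?_,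
    fun i k => ?_⟩
  · rw [← PowerSeries.coeff_zero_eq_constantCoeff_apply, PowerSeries.coeff_mk]
    simp [transition, Matrix.one_apply, apply_ite]
  · ext n
    have h := hv _ (iterate_sub_transition_mem hA hu n i k)
    rw [map_sub, sub_eq_zero, map_sum] at h
    rw [coeff_flow, h, map_sum, Finset.mul_sum]
    refine Finset.sum_congr rfl fun j _ => ?_
    rw [PowerSeries.algebraMap_apply, PowerSeries.coeff_mul_C, PowerSeries.coeff_mk, map_mul]
    simp [mul_assoc]

theorem flow_eq_zero {m : ℕ} {I : Ideal (MvPolynomial (Fin m) ℂ)}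
    {A : Derivation ℂ (MvPolynomial (Fin m) ℂ) (MvPolynomial (Fin m) ℂ)}
    (hA : ∀ f ∈ I, A f ∈ I) {v : Fin m → ℂ} (hv : ∀ f ∈ I, MvPolynomial.eval v f = 0)
    {f : MvPolynomial (Fin m) ℂ} (hf : f ∈ I) : flow A v f = 0 := by
  have hmem : ∀ n, (A : MvPolynomial (Fin m) ℂ →ₗ[ℂ] MvPolynomial (Fin m) ℂ)^[n] f ∈ I := by
    intro n
    induction n with
    | zero => exact hf
    | succ n ih =>
      rw [Function.iterate_succ_apply']
      exact hA _ ih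
  ext n
  rw [coeff_flow, hv _ (hmem n), mul_zero, map_zero]

end Developable

section Developable

/-- If the acceleration of a vector field is a combination of the position and the velocity, then
its flow stays in a line. -/
theorem exists_flow_eq_aeval_line {n : ℕ} {I : Ideal (MvPolynomial (Fin n) ℂ)}
    {B : Derivation ℂ (MvPolynomial (Fin n) ℂ) (MvPolynomial (Fin n) ℂ)}
    (hB : ∀ f ∈ I, B f ∈ I) {a b : MvPolynomial (Fin n) ℂ}
    (hab : ∀ k, B (B (MvPolynomial.X k)) -
      (a * MvPolynomial.X k + b * B (MvPolynomial.X k)) ∈ I)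
    {v w : Fin n → ℂ} (hv : ∀ f ∈ I, MvPolynomial.eval v f = 0)
    (hw : ∀ k, MvPolynomial.eval v (B (MvPolynomial.X k)) = w k)
    (hli : LinearIndependent ℂ ![v, w]) :
    ∃ α β : PowerSeries ℂ, PowerSeries.constantCoeff α = 1 ∧ PowerSeries.constantCoeff β = 0 ∧
      β ≠ 0 ∧ ∀ f, flow B v f = MvPolynomial.aeval
        (fun k => α * algebraMap ℂ _ (v k) + β * algebraMap ℂ (PowerSeries ℂ) (w k)) f := by
  -- Position and velocity satisfy a linear system with companion matrix, so the flow remains in the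
  -- span of their initial values.
  obtain ⟨R, hR, hflow⟩ := exists_flow_eq_sum (I := I) hB (c := !![0, 1; a, b])
    (u := ![MvPolynomial.X, fun k => B (MvPolynomial.X k)]) (by
      intro i k
      fin_cases i
      · simp
      · simpa using hab k) hv
  have hX : ∀ k, flow B v (MvPolynomial.X k) =
      R 0 0 * algebraMap ℂ _ (v k) + R 0 1 * algebraMap ℂ (PowerSeries ℂ) (w k) := by
    intro k
    have := hflow 0 k
    rw [Fin.sum_univ_two] at this
    simpa [hw] using this
  refine ⟨R 0 0, R 0 1, by simp [hR], by simp [hR], fun h0 => ?_, fun f => ?_⟩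
  -- If `β` were zero, the first-order term would make the velocity `w` a multiple of `v`.
  · have h1 : ∀ k, w k = PowerSeries.coeff 1 (R 0 0) * v k := by
      intro k
      have := congrArg (PowerSeries.coeff 1) (hX k)
      rw [coeff_flow, h0, zero_mul, add_zero, PowerSeries.algebraMap_apply,
        PowerSeries.coeff_mul_C] at this
      simpa [hw] using this
    have h2 := LinearIndependent.pair_iff.1 hli (PowerSeries.coeff 1 (R 0 0)) (-1) (by
      ext k
      simp [h1 k])
    exact absurd h2.2 (by norm_num)
  · have : flow B v = MvPolynomial.aeval fun k => flow B v (MvPolynomial.X k) :=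
      MvPolynomial.aeval_unique _
    rw [this]
    simp only [hX]

/-- The derivative of a polynomial in a constant direction. -/
def directional {n : ℕ} (w : Fin n → ℂ) (f : MvPolynomial (Fin n) ℂ) : MvPolynomial (Fin n) ℂ :=
  ∑ k, MvPolynomial.C (w k) * MvPolynomial.pderiv k f

theorem eval_directional {n : ℕ} (v w : Fin n → ℂ) (f : MvPolynomial (Fin n) ℂ) :
    MvPolynomial.eval v (directional w f) = differential v f w := by
  rw [directional, differential_apply]
  simp [mul_comm]

theorem directional_isHomogeneous {n d : ℕ} (w : Fin n → ℂ) {f : MvPolynomial (Fin n) ℂ}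
    (hf : f.IsHomogeneous d) : (directional w f).IsHomogeneous (d - 1) := by
  refine MvPolynomial.IsHomogeneous.sum _ _ _ fun k _ => ?_
  simpa using (MvPolynomial.isHomogeneous_C _ (w k)).mul (hf.pderiv (i := k))

/-- If the frame of the tangent spaces moves by combinations of itself along a vector field, then
the tangent space is constant along its flow. -/
theorem Frame.flow_directional_eq_zero {I : Ideal (MvPolynomial (Fin (N + 1)) ℂ)} [I.IsPrime]
    (F : Frame I)
    {B : Derivation ℂ (MvPolynomial (Fin (N + 1)) ℂ) (MvPolynomial (Fin (N + 1)) ℂ)}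
    (hB : ∀ f ∈ I, B f ∈ I) {c : Matrix (Fin 3) (Fin 3) (MvPolynomial (Fin (N + 1)) ℂ)}
    (hc : ∀ i k, B (F.field i k) - ∑ j, c i j * F.field j k ∈ I) {v : Vec N}
    (hv : ∀ f ∈ I, MvPolynomial.eval v f = 0) {f : MvPolynomial (Fin (N + 1)) ℂ} (hf : f ∈ I)
    {w : Vec N}
    (hw : w ∈ Submodule.span ℂ (Set.range fun i k => MvPolynomial.eval v (F.field i k))) :
    flow B v (directional w f) = 0 := by
  obtain ⟨R, hR, hflow⟩ := exists_flow_eq_sum (I := I) hB hc hv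
  -- Along the flow the differential of `f` kills the moving frame, which is `R` times the initial
  -- frame. As `R` starts at the identity its determinant is nonzero, so the initial frame is killed
  -- too.
  have hdet : R.det ≠ 0 := by
    intro h0
    have h1 := congrArg PowerSeries.constantCoeff h0
    rw [RingHom.map_det, map_zero] at h1
    have h2 : (PowerSeries.constantCoeff).mapMatrix R = (1 : Matrix (Fin 3) (Fin 3) ℂ) := by
      ext i j; exact hR i j
    rw [h2, Matrix.det_one] at h1
    exact one_ne_zero h1
  have hCf : ∀ (c : ℂ), flow B v (MvPolynomial.C c) = algebraMap ℂ (PowerSeries ℂ) c := by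
    intro c
    rw [← MvPolynomial.algebraMap_eq, AlgHom.commutes]
  have hdir : ∀ w : Vec N, flow B v (directional w f) =
      ∑ k, algebraMap ℂ (PowerSeries ℂ) (w k) * flow B v (MvPolynomial.pderiv k f) := by
    intro w
    rw [directional, map_sum]
    exact Finset.sum_congr rfl fun k _ => by rw [map_mul, hCf]
  have hvec : (fun j => flow B v (directional (fun k => MvPolynomial.eval v (F.field j k)) f)) =
      0 := by
    refine Matrix.eq_zero_of_mulVec_eq_zero hdet ?_
    ext1 i
    have h1 := flow_eq_zero hB hv (F.mem hf i)
    rw [derivation_apply, map_sum] at h1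
    rw [Pi.zero_apply, ← h1, Matrix.mulVec, dotProduct]
    have h2 : ∀ k, flow B v (MvPolynomial.pderiv k f * F.D i (MvPolynomial.X k)) =
        ∑ j, R i j * (algebraMap ℂ (PowerSeries ℂ) (MvPolynomial.eval v (F.field j k)) *
          flow B v (MvPolynomial.pderiv k f)) := by
      intro k
      rw [map_mul]
      change _ * flow B v (F.field i k) = _
      rw [hflow, Finset.mul_sum]
      exact Finset.sum_congr rfl fun j _ => by ring
    simp only [h2, hdir]
    rw [Finset.sum_comm]
    exact Finset.sum_congr rfl fun j _ => by rw [Finset.mul_sum]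
  induction hw using Submodule.span_induction with
  | mem y hy =>
    obtain ⟨j, rfl⟩ := hy
    exact congrFun hvec j
  | zero => rw [hdir]; simp
  | add y z _ _ hy hz =>
    rw [hdir] at hy hz ⊢
    simp only [Pi.add_apply, map_add, add_mul, Finset.sum_add_distrib, hy, hz, add_zero]
  | smul a y _ hy =>
    rw [hdir] at hy ⊢
    simp only [Pi.smul_apply, smul_eq_mul, map_mul, mul_assoc, ← Finset.mul_sum, hy, mul_zero]

variable {X : Set (PSpace N)}

/-- The integral lines of a suitable vector field through a general point. -/
theorem Frame.exists_line [(idealOf X).IsPrime] (hcl : IsZariskiClosed X)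
    (F : Frame (idealOf X))
    {B : Derivation ℂ (MvPolynomial (Fin (N + 1)) ℂ) (MvPolynomial (Fin (N + 1)) ℂ)}
    (hB : ∀ f ∈ idealOf X, B f ∈ idealOf X) {a b : MvPolynomial (Fin (N + 1)) ℂ}
    (hab : ∀ k, B (B (MvPolynomial.X k)) -
      (a * MvPolynomial.X k + b * B (MvPolynomial.X k)) ∈ idealOf X)
    {c : Matrix (Fin 3) (Fin 3) (MvPolynomial (Fin (N + 1)) ℂ)}
    (hc : ∀ i k, B (F.field i k) - ∑ j, c i j * F.field j k ∈ idealOf X)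
    {v : Vec N} (hv : v ≠ 0) (hvX : Projectivization.mk ℂ v hv ∈ X)
    (hsm : IsSmoothPoint X (Projectivization.mk ℂ v hv))
    (hspan : Submodule.span ℂ (Set.range fun i k => MvPolynomial.eval v (F.field i k)) =
      tangentAt (idealOf X) v)
    {w : Vec N} (hw : ∀ k, MvPolynomial.eval v (B (MvPolynomial.X k)) = w k)
    (hli : LinearIndependent ℂ ![v, w]) :
    ∃ L : Submodule ℂ (Vec N), Module.finrank ℂ L = 2 ∧
      Projectivization.mk ℂ v hv ∈ linearSubspace L ∧ linearSubspace L ⊆ X ∧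
        ∀ y ∈ linearSubspace L, IsSmoothPoint X y →
          tangentSpace X y = tangentSpace X (Projectivization.mk ℂ v hv) := by
  have hv0 : ∀ f ∈ idealOf X, MvPolynomial.eval v f = 0 :=
    fun f hf => eval_eq_zero_of_mk_mem hv hvX hf
  obtain ⟨α, β, hα, hβ, hβ0, hflow⟩ := exists_flow_eq_aeval_line hB hab hv0 hw hli
  have hL : ∀ u ∈ Submodule.span ℂ {v, w}, ∃ y z : ℂ, u = y • v + z • w := by
    intro u hu
    obtain ⟨y, z, h⟩ := Submodule.mem_span_pair.1 hu
    exact ⟨y, z, h.symm⟩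
  refine ⟨Submodule.span ℂ {v, w}, ?_, ?_, ?_, ?_⟩
  · have h := finrank_span_eq_card hli
    rwa [Matrix.range_cons, Matrix.range_cons, Matrix.range_empty, Set.union_empty,
      Fintype.card_fin] at h
  · rw [mem_linearSubspace_mk]
    exact Submodule.subset_span (Set.mem_insert _ _)
  · intro x hx
    obtain ⟨S, hS, hXS⟩ := hcl
    induction x using Projectivization.ind with
    | h u hu =>
      rw [mem_linearSubspace_mk] at hx
      rw [hXS]
      intro f hf
      obtain ⟨d, hd⟩ := hS f hf
      rw [eval_rep_eq_zero_iff hd]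
      have hfI : f ∈ idealOf X := by
        rw [mem_idealOf]
        rintro u ⟨hu, huX⟩
        exact (eval_rep_eq_zero_iff hd u hu).1 ((hXS _).1 huX f hf)
      obtain ⟨y, z, rfl⟩ := hL u hx
      exact eval_eq_zero_of_curve_in_line hd hα hβ hβ0
        (by rw [← hflow, flow_eq_zero hB hv0 hfI]) y z
  · intro x hx hxs
    induction x using Projectivization.ind with
    | h u hu =>
      rw [mem_linearSubspace_mk] at hx
      symm
      -- It is enough to show inclusion, both spaces having dimension 3. For `t` tangent at `v`,
      -- each form `directional t f` vanishes along the formal curve, hence on the whole line.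
      apply Submodule.eq_of_le_of_finrank_eq
      · rw [tangentSpace_mk, tangentSpace_mk, ← hspan]
        intro t ht
        rw [mem_tangentAt]
        intro f hf
        rw [← eval_directional]
        have hsum : directional t f = ∑ d ∈ Finset.range (f.totalDegree + 1),
            directional t (MvPolynomial.homogeneousComponent d f) := by
          conv_lhs => rw [← MvPolynomial.sum_homogeneousComponent f]
          simp only [directional, map_sum, Finset.mul_sum]
          rw [Finset.sum_comm]
        rw [hsum, map_sum]
        refine Finset.sum_eq_zero fun d _ => ?_
        obtain ⟨y, z, rfl⟩ := hL u hx
        exact eval_eq_zero_of_curve_in_line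
          (directional_isHomogeneous t (MvPolynomial.homogeneousComponent_isHomogeneous d f))
          hα hβ hβ0 (by
            rw [← hflow, F.flow_directional_eq_zero hB hc hv0 (homogeneousComponent_mem hf d) ht])
          y z
      · rw [hsm.2, hxs.2]

/-- A surface whose moving tangent spaces are constant in some direction is developable. -/
theorem isRuledDevelopable_of_degenerate (hX : IsProjectiveSurface X) [(idealOf X).IsPrime]
    {E A : Derivation ℂ (FunctionField (idealOf X)) (FunctionField (idealOf X))}
    (hE : ap E (genericPoint (idealOf X)) = genericPoint (idealOf X))
    (hA : A ∉ Submodule.span (FunctionField (idealOf X)) {E})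
    (hAT : ∀ C, ap A (ap C (genericPoint (idealOf X))) ∈
      movingTangent (genericPoint (idealOf X)))
    (hAA : ap A (ap A (genericPoint (idealOf X))) ∈ Submodule.span (FunctionField (idealOf X))
      {genericPoint (idealOf X), ap A (genericPoint (idealOf X))}) :
    IsRuledDevelopable X := by
  have h3 := finrank_derivation_of_surface hX
  obtain ⟨F, h, hh, hF⟩ := exists_frame_of_notMem hX hE hA
  have hrel : ∀ i, ∃ g ∉ idealOf X, ∃ c : Fin 3 → MvPolynomial (Fin (N + 1)) ℂ,
      ∀ k, g * F.fieldDeriv (1, i) k - ∑ j, c j * F.field j k ∈ idealOf X := by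
    intro i
    apply exists_relation_of_mem_span
    rw [F.span_field h3, F.toFF_fieldDeriv]
    simp only
    rw [hF, smul_ap]
    exact Submodule.smul_mem _ _ (hAT _)
  choose g hg c hc using hrel
  obtain ⟨g', hg', c', hc'⟩ : ∃ g ∉ idealOf X, ∃ c : Fin 2 → MvPolynomial (Fin (N + 1)) ℂ,
      ∀ k, g * F.fieldDeriv (1, 1) k -
        ∑ j, c j * (![MvPolynomial.X, F.field 1] : Fin 2 → _) j k ∈ idealOf X := by
    apply exists_relation_of_mem_span
    set U := Submodule.span (FunctionField (idealOf X)) (Set.range fun j k =>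
      toFF (idealOf X) ((![MvPolynomial.X, F.field 1] : Fin 2 → _) j k)) with hU
    have hX1 : genericPoint (idealOf X) ∈ U := Submodule.subset_span ⟨0, rfl⟩
    have hX2 : ap (F.C 1) (genericPoint (idealOf X)) ∈ U := by
      rw [← F.toFF_field]
      exact Submodule.subset_span ⟨1, rfl⟩
    have hX3 : ap A (genericPoint (idealOf X)) ∈ U := by
      rw [hF, smul_ap] at hX2
      have := Submodule.smul_mem _ h⁻¹ hX2
      rwa [inv_smul_smul₀ hh] at this
    have hX4 : ap A (ap A (genericPoint (idealOf X))) ∈ U := by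
      refine (Submodule.span_le.2 ?_) hAA
      rintro _ (rfl | rfl)
      · exact hX1
      · exact hX3
    rw [F.toFF_fieldDeriv]
    simp only
    rw [hF, smul_ap, smul_ap, ap_smul]
    exact Submodule.smul_mem _ _ (add_mem (Submodule.smul_mem _ _ hX3)
      (Submodule.smul_mem _ _ hX4))
  have hp : (idealOf X).IsPrime := inferInstance
  -- `G` clears all denominators at once. Multiplying the field by a function changes the
  -- parametrization of its integral lines only.
  set G := (∏ i, g i) * g' with hG
  have hGI : G ∉ idealOf X := by
    rw [hG, hp.mul_mem_iff_mem_or_mem]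
    rintro (h1 | h1)
    · exact exists_prod_notMem g hg h1
    · exact hg' h1
  have hdvd : ∀ i, ∃ q, G = q * g i := fun i =>
    dvd_iff_exists_eq_mul_left.1 ((Finset.dvd_prod_of_mem g (Finset.mem_univ i)).mul_right g')
  choose q hq using hdvd
  set q' := ∏ i, g i with hq'
  set B := G • F.D 1 with hBdef
  have hBap : ∀ f, B f = G * F.D 1 f := fun f => rfl
  have hB : ∀ f ∈ idealOf X, B f ∈ idealOf X := fun f hf =>
    Ideal.mul_mem_left _ _ (F.mem hf 1)
  have hBc : ∀ i k, B (F.field i k) - ∑ j, (q i * c i j) * F.field j k ∈ idealOf X := by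
    intro i k
    have h1 := Ideal.mul_mem_left (idealOf X) (q i) (hc i k)
    convert h1 using 1
    rw [hBap, hq i, mul_sub, Finset.mul_sum, mul_assoc]
    simp only [mul_assoc]
    rfl
  -- The extra term `F.D 1 G` is the Leibniz contribution of the factor `G` in `B = G • F.D 1`.
  have hBB : ∀ k, B (B (MvPolynomial.X k)) - ((G * q' * c' 0) * MvPolynomial.X k +
      (q' * c' 1 + F.D 1 G) * B (MvPolynomial.X k)) ∈ idealOf X := by
    intro k
    have h1 := Ideal.mul_mem_left (idealOf X) (G * q') (hc' k)
    convert h1 using 1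
    rw [hBap, hBap, Derivation.leibniz, Fin.sum_univ_two]
    simp only [Matrix.cons_val_zero, Matrix.cons_val_one, smul_eq_mul]
    change G * (G * F.fieldDeriv (1, 1) k + F.field 1 k * F.D 1 G) -
      (G * q' * c' 0 * MvPolynomial.X k + (q' * c' 1 + F.D 1 G) * (G * F.field 1 k)) = _
    linear_combination G * F.fieldDeriv (1, 1) k * hG
  obtain ⟨g₁, hg₁, h₁⟩ := exists_finrank_tangentAt_le h3
  obtain ⟨g₂, hg₂, h₂⟩ := exists_linearIndependent_eval F.linearIndependent_field
  rw [IsRuledDevelopable, forGeneralPoint_iff]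
  refine ⟨g₁ * g₂ * G, ?_, fun v hv hvX hgv => ?_⟩
  · rw [hp.mul_mem_iff_mem_or_mem, hp.mul_mem_iff_mem_or_mem]
    tauto
  · rw [map_mul, map_mul, mul_ne_zero_iff, mul_ne_zero_iff] at hgv
    have hv0 : ∀ f ∈ idealOf X, MvPolynomial.eval v f = 0 :=
      fun f hf => eval_eq_zero_of_mk_mem hv hvX hf
    have hT := h₁ v hv0 hgv.1.1
    have hli := h₂ v hv0 hgv.1.2
    have hsm := F.isSmoothPoint hv hvX hli hT
    refine ⟨hsm, F.exists_line (w := fun k => MvPolynomial.eval v (B (MvPolynomial.X k)))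
      hX.closed hB hBB (c := fun i j => q i * c i j) hBc hv hvX hsm
      (F.span_field_eval hv0 hli hT) (fun _ => rfl) ?_⟩
    have hli2 : LinearIndependent ℂ ![v, fun k => MvPolynomial.eval v (F.field 1 k)] := by
      have h := hli.comp ![2, 1] (by decide)
      convert h using 1
      funext i
      fin_cases i
      · funext k
        simp [F.field_two]
      · rfl
    rw [LinearIndependent.pair_iff] at hli2 ⊢
    intro s t hst
    have h0 := hli2 s (t * MvPolynomial.eval v G) (by
      rw [← hst]
      ext k
      simp only [Pi.add_apply, Pi.smul_apply, smul_eq_mul, hBap, map_mul, mul_assoc]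
      rfl)
    exact ⟨h0.1, (mul_eq_zero.1 h0.2).resolve_right hgv.2⟩

end Developable

/-! ### Geometric conclusions from the generic osculating dimension -/

theorem liesInThreeSpace_or_isRuledDevelopable {X : Set (PSpace N)} (hX : IsProjectiveSurface X)
    [(idealOf X).IsPrime]
    (h : Module.finrank (FunctionField (idealOf X)) (movingOsc (genericPoint (idealOf X))) = 4) :
    LiesInThreeSpace X ∨ IsRuledDevelopable X := by
  obtain ⟨E, hE⟩ := exists_euler_derivation (X := X)
  rcases movingOsc_stable_or_exists_degenerate (tangentMap_injective (idealOf X))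
    (finrank_derivation_of_surface hX) h hE (derivation_ne_zero hX hE) with hst | ⟨A, hA, hAT, hAA⟩
  · obtain ⟨W, hW, hXW⟩ := subset_linearSubspace_of_stable hst
      (movingTangent_le_movingOsc genericPoint_mem_movingTangent)
    exact Or.inl ⟨W, hW.trans h, hXW⟩
  · exact Or.inr (isRuledDevelopable_of_degenerate hX hE hA hAT hAA)

/-- Being a `Φ` surface is detected by the moving osculating space. -/
theorem isPhiSurface_iff {X : Set (PSpace N)} (hX : IsProjectiveSurface X)
    [(idealOf X).IsPrime] : IsPhiSurface X ↔ 5 ≤ N ∧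
      Module.finrank (FunctionField (idealOf X)) (movingOsc (genericPoint (idealOf X))) = 5 := by
  obtain ⟨g, hg, hgen⟩ := exists_general_point hX
  rw [IsPhiSurface, forGeneralPoint_iff]
  refine and_congr_right fun _ => ⟨?_, fun h => ⟨g, hg, fun v hv hvX hgv φ => ?_⟩⟩
  · rintro ⟨g', hg', h⟩
    have hp : (idealOf X).IsPrime := inferInstance
    -- Irreducibility: two non-empty open subsets of `X` share a point, where a parametrization
    -- exists and both dimension counts apply.
    obtain ⟨v, hv, hvX, hgv⟩ := exists_mem_cone_of_notMem (g := g * g') (by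
      rw [hp.mul_mem_iff_mem_or_mem]; tauto)
    rw [map_mul, mul_ne_zero_iff] at hgv
    obtain ⟨hsm, ⟨φ⟩, hφ⟩ := hgen v hv hvX hgv.1
    have h1 := h v hv hvX hgv.2 φ
    have h2 := hφ φ
    rw [LocalParam.dimOsc_eq hsm] at h1
    omega
  · obtain ⟨hsm, -, hφ⟩ := hgen v hv hvX hgv
    have h2 := hφ φ
    rw [LocalParam.dimOsc_eq hsm]
    omega

end ProjSurface

end

open ProjSurface in
theorem proposition3p1 (N : ℕ) (X : Set (PSpace N)) (hX : IsProjectiveSurface X) :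
    ∃ d : ℤ, (d = -1 ∨ d = 0 ∨ d = 1 ∨ d = 2) ∧
      ForGeneralPoint X fun x => IsSmoothPoint X x ∧ Nonempty (LocalParam X x) ∧
        ∀ φ : LocalParam X x,
          φ.dimII = d ∧ φ.dimII = φ.dimOsc - 3 ∧
          -- the empty linear system
          ((φ.dimII = -1 ↔ φ.linearSystem = ∅) ∧
            (φ.linearSystem = ∅ ↔ φ.osculatingSpace = tangentSpace X x) ∧
            (φ.osculatingSpace = tangentSpace X x ↔ IsPlane X)) ∧
          -- a unique quadric
          ((φ.dimII = 0 ↔ ∃! Q, Q ∈ φ.linearSystem) ∧ (φ.dimII = 0 ↔ φ.dimOsc = 3) ∧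
            (φ.dimII = 0 → (∀ r, ∃ s, φ.Conjugate r s) ∧
              (LiesInThreeSpace X ∨ IsRuledDevelopable X))) ∧
          -- a pencil of quadrics
          ((φ.dimII = 1 ↔ φ.dimOsc = 4) ∧ (φ.dimII = 1 ∧ 5 ≤ N ↔ IsPhiSurface X) ∧
            (φ.dimII = 1 →
              ((∃ p q, p ≠ q ∧
                  (∀ r s, φ.Conjugate r s ↔ (r = p ∧ s = q) ∨ (r = q ∧ s = p)) ∧
                  ∃ σ, IsProjectiveInvolution σ ∧
                    (∀ r s, φ.IsTangentPair r s ↔ σ r = s) ∧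
                    (∀ r, σ r = r ↔ r = p ∨ r = q)) ∨
                (∃ p, (∀ r s, φ.Conjugate r s ↔ r = p ∧ s = p) ∧
                  (∀ r s, φ.IsTangentPair r s ↔ r = p ∨ s = p))) ∧
              (∀ r, (∃ s, φ.Conjugate r s) ↔ φ.IsTangentPair r r))) ∧
          -- a net of quadrics
          ((φ.dimII = 2 ↔ φ.dimOsc = 5) ∧
            (φ.dimII = 2 → ∀ r s, ¬ φ.Conjugate r s)) := by

  have hp := hX.prime
  obtain ⟨g, hg, hgen⟩ := exists_general_point hX
  set r := Module.finrank (FunctionField (idealOf X)) (movingOsc (genericPoint (idealOf X))) with hr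
  -- `r` is 3 plus the dimension of the first normal space, while `dimII` is that dimension minus 1.
  refine ⟨(r : ℤ) - 4, ?_, forGeneralPoint_iff.2 ⟨g, hg, fun v hv hvX hgv => ?_⟩⟩
  -- The bounds on `r` are read off at one general point, where three vectors span the first normal
  -- space.
  · obtain ⟨v, hv, hvX, hgv⟩ := exists_mem_cone_of_notMem hg
    obtain ⟨-, ⟨φ⟩, hφ⟩ := hgen v hv hvX hgv
    have h1 := hφ φ
    have h2 := φ.finrank_firstNormal_le
    omega
  obtain ⟨hsm, hne, hφ⟩ := hgen v hv hvX hgv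
  refine ⟨hsm, hne, fun φ => ?_⟩
  have hrk := hφ φ
  have hII := φ.dimII_eq
  have hosc := φ.dimOsc_eq hsm
  have hempty : φ.linearSystem = ∅ ↔ Module.finrank ℂ φ.firstNormal = 0 := by
    have hfin : Module.Finite ℂ φ.quadrics := by
      unfold LocalParam.quadrics
      infer_instance
    rw [← φ.finrank_quadrics]
    exact (setOf_submodule_le_eq_empty_iff φ.quadrics).trans Submodule.finrank_eq_zero.symm
  have huniq : (∃! Q, Q ∈ φ.linearSystem) ↔ Module.finrank ℂ φ.firstNormal = 1 := by
    rw [← φ.finrank_quadrics]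
    exact existsUnique_submodule_le_iff φ.quadrics
  have hosct := φ.osculatingSpace_eq_tangentSpace_iff hsm
  refine ⟨by omega, by omega, ⟨?_, ?_, ?_⟩, ⟨?_, by omega, fun h => ⟨?_, ?_⟩⟩,
    ⟨by omega, ?_, fun h => ?_⟩, by omega, fun h => ?_⟩
  · rw [hempty]; omega
  · rw [hempty, hosct]
  · rw [hosct]
    exact ⟨fun h => isPlane_of_finrank_movingOsc hX (by omega),
      finrank_firstNormal_of_isPlane hsm φ⟩
  · rw [huniq]; omega
  · exact φ.exists_conjugate_of_finrank_le_one (by omega)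
  · exact liesInThreeSpace_or_isRuledDevelopable hX (by omega)
  · rw [isPhiSurface_iff hX]
    omega
  · exact φ.pencil_of_finrank_eq_two hsm (by omega)
  · exact φ.not_conjugate_of_finrank_eq_three (by omega)
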